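/- **Setting.** Let $\Omega\subset\mathbb R^2$ be a bounded polygonal Lipschitz domain and $V=H^1_0(\Omega)$. Let the coefficients $\mathbf A$ (symmetric $2\times2$ matrix), $\mathbf b$ (vector), $\gamma$ (scalar) satisfy, a.e. in $\Omega$, $|\mathbf A|,|\mathbf b|,|\gamma|\le M$ and $a_0|\xi|^2\le \mathbf A\xi\cdot\xi\le a_1|\xi|^2$ for all $\xi\in\mathbb R^2$, with $a_0,a_1>0$. For an open set $D$ put $a^D(v,w)=\int_D\mathbf A\nabla v\cdot\nabla w\,dx$ and $B^D(v,w)=a^D(v,w)+\int_D v\,\mathbf b\cdot\nabla w\,dx+\int_D\gamma vw\,dx$, and assume that $v\in V$ and $B^\Omega(v,w)=0$ for all $w\in V$ imply $v=0$. Given $f\in L^2(\Omega)$, let $u\in V$ satisfy $B^\Omega(u,v)=\int_\Omega fv\,dx$ for all $v\in V$, and put $\boldsymbol\sigma:=\mathbf A\nabla u+\mathbf b u$. **Mesh.** Let $\mathcal T$ be a finite partition of $\overline\Omega$ into compact polygonal domains, each bounded by a simple closed polygon (collinear consecutive edges are allowed), such that two distinct elements meet only in common edges or common vertices. Let $h_P\le1$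 be the diameter of $P\in\mathcal T$ and $\mathcal E(P)$ the set of its edges. With a constant $\rho>0$, every $P\in\mathcal T$ is star-shaped with respect to every point of a ball of radius at least $\rho h_P$, and every $E\in\mathcal E(P)$ has length $|E|\ge\rho h_P$. The coefficients are Lipschitz continuous in the interior of each $P\in\mathcal T$. For $E\in\mathcal E(P)$ let $\mathcal T(E)$ be the set of the one or two elements of $\mathcal T$ that have the edge $E$. Let $[v]_E$ be the difference of the two one-sided values on an interior edge $E$ (up to a sign), and $[v]_E=v|_E$ on a boundary edge. Sobolev spaces and (semi)norms on $P$ refer to its interior, with $\|v\|_{1,P}^2=\|v\|_{L^2(P)}^2+|v|_{1,P}^2$ and $|v|_{1,P}=\|\nabla v\|_{L^2(P)}$. **Method.** Let $\Pi_k$ be the $L^2(P)$ projection onto the polynomials $\mathbb P_k(P)$ of degree at most $k$ (componentwise for vectors), and let $\Pi_1^\nabla v\in\mathbb P_1(P)$ be given by $\int_P\nabla(\Pi^\nabla_1v-v)\cdot\nabla\chi\,dx=0$ for all $\chi\in\mathbb P_1(P)$ and $\int_{\partial P}\Pi^\nabla_1v\,ds=\int_{\partial P}v\,ds$. Let $V_h(P)$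 be the space of all $v\in H^1(P)$ with $\Delta v\in\mathbb P_1(P)$, with constant normal derivative $\partial v/\partial\mathbf n_P$ on each $E\in\mathcal E(P)$, and with $v-\Pi_1^\nabla v\perp\mathbb P_1(P)$ in $L^2(P)$. Let $V_h$ be the space of all $v_h$ with $v_h|_P\in V_h(P)$ for all $P\in\mathcal T$ and $\int_E[v_h]_E\,ds=0$ for all edges $E$. For each $P\in\mathcal T$ let $S^P$ be a symmetric positive definite bilinear form on $V_h(P)$ with $$C_s^{-1}a^P(v,v)\le S^P(v,v)\le C_s\,a^P(v,v)\quad\text{for all }v\in V_h(P)\text{ with }\Pi_1v=0 .$$ Let $u_h\in V_h$ satisfy, for all $v_h\in V_h$, $$\sum_{P\in\mathcal T}\Big(B^P(\Pi_1u_h,\Pi_1v_h)+S^P\big((1-\Pi_1)u_h,(1-\Pi_1)v_h\big)\Big)=\sum_{P\in\mathcal T}\int_P f\,\Pi_1v_h\,dx .$$ **Estimator.** For $P\in\mathcal T$ put $$\begin{aligned}\eta_P^2&=h_P^2\|f-\gamma\Pi_1u_h\|_{L^2(P)}^2,&\zeta_P^2&=S^P\big((1-\Pi_1)u_h,(1-\Pi_1)u_h\big),\\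 \Lambda_P^2&=\|(1-\Pi_0)(\mathbf A\nabla\Pi_1u_h+\mathbf b\,\Pi_1u_h)\|_{L^2(P)}^2,&\Xi_P^2&=\sum_{E\in\mathcal E(P)}|E|^{-1}\|[\Pi_1u_h]_E\|_{L^2(E)}^2,\end{aligned}$$ and $\mathrm{osc}_1(g,P)=\|h_P(1-\Pi_1)g\|_{L^2(P)}$. **Theorem (local efficiency up to oscillation).** There is a constant $C>0$, depending only on $\rho$, $C_s$, $a_0$, $a_1$ and $M$ (in particular not on the mesh, $f$, $u$, $u_h$), such that for every $P\in\mathcal T$ $$\begin{aligned} \zeta_P^2&\le C\big(|u-u_h|_{1,P}^2+|u-\Pi_1u_h|_{1,P}^2\big),\\ \eta_P^2&\le C\big(\|u-u_h\|_{1,P}^2+|u-\Pi_1u_h|_{1,P}^2+\|(1-\Pi_0)\boldsymbol\sigma\|_{L^2(P)}^2+\mathrm{osc}_1^2(f-\gamma u,P)\big),\\ \Lambda_P^2&\le C\big(\|u-u_h\|_{1,P}^2+|u-\Pi_1u_h|_{1,P}^2+\|(1-\Pi_0)\boldsymbol\sigma\|_{L^2(P)}^2\big),\\ \Xi_P^2&\le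 C\sum_{E\in\mathcal E(P)}\sum_{P'\in\mathcal T(E)}\big(\|u-u_h\|_{1,P'}^2+|u-\Pi_1u_h|_{1,P'}^2\big). \end{aligned}$$ -/

import Mathlib

open MeasureTheory Set Filter Topology
open scoped ContDiff NNReal

noncomputable section

namespace NCVEM

/-- The Euclidean plane. -/
abbrev E2 : Type := EuclideanSpace ℝ (Fin 2)

/-! ### Sobolev spaces -/

/-- Square of the `L²(U)` norm of a scalar or vector field. -/
def l2Sq {F : Type*} [NormedAddCommGroup F] (U : Set E2) (v : E2 → F) : ℝ :=
  ∫ x in U, ‖v x‖ ^ 2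

/-- `g ∈ L²(U; ℝ²)` is the weak gradient of `v` on the open set `U`. -/
def HasWeakGrad (U : Set E2) (v : E2 → ℝ) (g : E2 → E2) : Prop :=
  MemLp g 2 (volume.restrict U) ∧
    ∀ φ : E2 → ℝ, ContDiff ℝ ∞ φ → HasCompactSupport φ → tsupport φ ⊆ U →
      ∀ e : E2, ∫ x in U, v x * fderiv ℝ φ x e = -∫ x in U, inner ℝ (g x) e * φ x

/-- `v ∈ H¹(U)`. -/
def MemH1 (U : Set E2) (v : E2 → ℝ) : Prop :=
  MemLp v 2 (volume.restrict U) ∧ ∃ g, HasWeakGrad U v g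

open Classical in
/-- The weak gradient of `v ∈ H¹(U)` (unique almost everywhere on `U`). -/
def weakGrad (U : Set E2) (v : E2 → ℝ) : E2 → E2 :=
  if h : ∃ g, HasWeakGrad U v g then h.choose else 0

/-- Square of the seminorm `|v|_{1,U}`. -/
def h1SemiSq (U : Set E2) (v : E2 → ℝ) : ℝ := l2Sq U (weakGrad U v)

/-- Square of the norm `‖v‖_{1,U}`. -/
def h1NormSq (U : Set E2) (v : E2 → ℝ) : ℝ := l2Sq U v + h1SemiSq U v

/-- `v ∈ H¹₀(U)`, the closure of the compactly supported smooth functions in `H¹(U)`. -/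
def MemH10 (U : Set E2) (v : E2 → ℝ) : Prop :=
  MemH1 U v ∧ ∃ φ : ℕ → E2 → ℝ,
    (∀ n, ContDiff ℝ ∞ (φ n) ∧ HasCompactSupport (φ n) ∧ tsupport (φ n) ⊆ U) ∧
    Tendsto (fun n => h1NormSq U (φ n - v)) atTop (𝓝 0)

/-! ### Line integrals and traces -/

/-- `∫_E g ds` over the segment `E = conv {a, b}`, by its parametrization. -/
def edgeInt (a b : E2) (g : E2 → ℝ) : ℝ :=
  dist a b * ∫ t in (0 : ℝ)..1, g (AffineMap.lineMap a b t)

/-- The values of `τ` on `E = conv {a, b}` are the trace of `v ∈ H¹(U)` on `E`: some functions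
which are smooth up to the boundary converge to `v` in `H¹(U)` and to `τ` in `L²(E)`. -/
def IsTrace (U : Set E2) (a b : E2) (v τ : E2 → ℝ) : Prop :=
  MemLp (fun t : ℝ => τ (AffineMap.lineMap a b t)) 2 (volume.restrict (Icc (0 : ℝ) 1)) ∧
    ∃ φ : ℕ → E2 → ℝ, (∀ n, ContDiff ℝ ∞ (φ n)) ∧
      Tendsto (fun n => h1NormSq U (φ n - v)) atTop (𝓝 0) ∧
      Tendsto (fun n => edgeInt a b (fun x => (φ n x - τ x) ^ 2)) atTop (𝓝 0)

open Classical in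
/-- The trace of `v ∈ H¹(U)` on `conv {a, b} ⊆ ∂U` (unique almost everywhere on that edge). -/
def trace (U : Set E2) (a b : E2) (v : E2 → ℝ) : E2 → ℝ :=
  if h : ∃ τ, IsTrace U a b v τ then h.choose else 0

/-! ### Domains, polygons, meshes -/

/-- `Ω` is a bounded Lipschitz domain (locally, in rotated coordinates, the set above the graph of
a Lipschitz function) whose boundary is a finite union of segments. -/
def IsPolygonalLipschitzDomain (Ω : Set E2) : Prop :=
  IsOpen Ω ∧ IsConnected Ω ∧ Bornology.IsBounded Ω ∧
    (∀ x ∈ frontier Ω, ∃ (R : E2 ≃ₗᵢ[ℝ] E2) (K : ℝ≥0) (φ : ℝ → ℝ) (r : ℝ),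
      LipschitzWith K φ ∧ 0 < r ∧ ∀ y ∈ Metric.ball x r, y ∈ Ω ↔ φ (R y 0) < R y 1) ∧
    ∃ s : Finset (E2 × E2), frontier Ω = ⋃ e ∈ s, segment ℝ e.1 e.2

/-- A polygonal domain: a compact set with non-empty interior whose boundary is the simple closed
polygon with the `m + 3` nodes `vert j` and the edges `conv {vert j, vert (j + 1)}`; the index is
cyclic, as addition in `Fin (m + 3)` is, and collinear consecutive edges are allowed. By the Jordan
curve theorem the set is the closed region inside that polygon, so it is simply connected and its
interior is a Lipschitz domain. -/
structure Polygon where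
  m : ℕ
  vert : Fin (m + 3) → E2
  carrier : Set E2
  vert_injective : Function.Injective vert
  edge_inter_next : ∀ j,
    segment ℝ (vert j) (vert (j + 1)) ∩ segment ℝ (vert (j + 1)) (vert (j + 1 + 1)) = {vert (j + 1)}
  edge_disjoint : ∀ j k, k ≠ j → k ≠ j + 1 → j ≠ k + 1 →
    Disjoint (segment ℝ (vert j) (vert (j + 1))) (segment ℝ (vert k) (vert (k + 1)))
  isCompact : IsCompact carrier
  interior_nonempty : (interior carrier).Nonempty
  frontier_eq : frontier carrier = ⋃ j, segment ℝ (vert j) (vert (j + 1))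

namespace Polygon

variable (P : Polygon)

/-- The index set of the edges of `P`. -/
abbrev Idx : Type := Fin (P.m + 3)

/-- The edge `E(j)` of `P`. -/
def edge (j : P.Idx) : Set E2 := segment ℝ (P.vert j) (P.vert (j + 1))

/-- The length `|E(j)|`. -/
def len (j : P.Idx) : ℝ := dist (P.vert j) (P.vert (j + 1))

/-- The interior of `P`, on which the function spaces live. -/
def dom : Set E2 := interior P.carrier

/-- The diameter `h_P`. -/
def h : ℝ := Metric.diam P.carrier

/-- `∫_{E(j)} g ds`. -/
def eInt (j : P.Idx) (g : E2 → ℝ) : ℝ := edgeInt (P.vert j) (P.vert (j + 1)) g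

/-- Mesh regularity of one polygonal domain with parameter `ρ`. -/
def Regular (ρ : ℝ) : Prop :=
  (∃ (c : E2) (r : ℝ), ρ * P.h ≤ r ∧ ∀ y ∈ Metric.ball c r, StarConvex ℝ y P.carrier) ∧
    ∀ j, ρ * P.h ≤ P.len j

end Polygon

/-- An admissible partition of `closure Ω` into finitely many polygonal domains: two distinct ones
meet only in common edges and common vertices. -/
structure Mesh (Ω : Set E2) where
  N : ℕ
  cell : Fin N → Polygon
  cover : ⋃ i, (cell i).carrier = closure Ω
  admissible : ∀ i k, i ≠ k → ∀ x ∈ (cell i).carrier ∩ (cell k).carrier,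
    (∃ j l, (cell i).edge j = (cell k).edge l ∧ x ∈ (cell i).edge j) ∨
      (∃ j l, x = (cell i).vert j ∧ x = (cell k).vert l)

/-! ### Projections onto polynomials -/

/-- `p` is a polynomial of degree at most one. -/
def IsAffine (p : E2 → ℝ) : Prop := ∃ (c : ℝ) (g : E2), ∀ x, p x = c + inner ℝ g x

/-- The `L²(P)` projection onto constants, the integral mean (componentwise for vectors). -/
def Pi0 {F : Type*} [NormedAddCommGroup F] [NormedSpace ℝ F] (P : Polygon) (v : E2 → F) : F :=
  ⨍ x in P.dom, v x

/-- `q` is the `L²(P)` projection of `v` onto the affine functions. -/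
def IsL2Proj (P : Polygon) (v q : E2 → ℝ) : Prop :=
  IsAffine q ∧ ∀ p, IsAffine p → ∫ x in P.dom, (v x - q x) * p x = 0

open Classical in
/-- The `L²(P)` projection `Π₁ v` onto the affine functions. -/
def Pi1 (P : Polygon) (v : E2 → ℝ) : E2 → ℝ :=
  if h : ∃ q, IsL2Proj P v q then h.choose else 0

/-- `q` is the Ritz projection of `v ∈ H¹(P)` onto the affine functions. -/
def IsRitzProj (P : Polygon) (v q : E2 → ℝ) : Prop :=
  IsAffine q ∧
    (∀ χ, IsAffine χ →
      ∫ x in P.dom, inner ℝ (weakGrad P.dom q x - weakGrad P.dom v x) (weakGrad P.dom χ x) = 0) ∧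
    ∑ j, P.eInt j q = ∑ j, P.eInt j (trace P.dom (P.vert j) (P.vert (j + 1)) v)

/-! ### Virtual element spaces -/

/-- The extended local space: `v ∈ H¹(P)` with affine Laplacian `p` and constant normal derivative
`κ j` on each edge `E(j)`, both in the weak sense of Green's formula. -/
def MemVhHat (P : Polygon) (v : E2 → ℝ) : Prop :=
  MemH1 P.dom v ∧ ∃ (p : E2 → ℝ) (κ : P.Idx → ℝ), IsAffine p ∧
    ∀ φ : E2 → ℝ, ContDiff ℝ ∞ φ →
      ∫ x in P.dom, fderiv ℝ φ x (weakGrad P.dom v x) =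
        -(∫ x in P.dom, p x * φ x) + ∑ j, κ j * P.eInt j φ

/-- The local virtual element space `V_h(P)`. -/
def MemVhLoc (P : Polygon) (v : E2 → ℝ) : Prop :=
  MemVhHat P v ∧ ∃ q, IsRitzProj P v q ∧
    ∀ p, IsAffine p → ∫ x in P.dom, (v x - q x) * p x = 0

namespace Mesh

variable {Ω : Set E2} (T : Mesh Ω)

open Classical in
/-- The cells that have the edge `E(j)` of the cell `i` as an edge: the cell `i` itself and, for an
interior edge, its neighbour across that edge. -/
def patch (i : Fin T.N) (j : (T.cell i).Idx) : Finset (Fin T.N) :=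
  Finset.univ.filter fun k => ∃ l, (T.cell k).edge l = (T.cell i).edge j

/-- The jump across the edge `E(j)` of the cell `i`, seen from that cell, of the piecewise function
which is `w k` on the cell `k`. The sum over the other cells at the edge has one term for an
interior edge and none for an edge on the boundary. -/
def jump (i : Fin T.N) (j : (T.cell i).Idx) (w : Fin T.N → E2 → ℝ) (x : E2) : ℝ :=
  w i x - ∑ k ∈ (T.patch i j).erase i, w k x

/-- The global nonconforming virtual element space `V_h`. -/
def MemVh (v : E2 → ℝ) : Prop :=
  (∀ i, MemVhLoc (T.cell i) v) ∧
    ∀ i j, (T.cell i).eInt j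
      (T.jump i j fun k => trace (T.cell k).dom ((T.cell i).vert j) ((T.cell i).vert (j + 1)) v) = 0

end Mesh

/-! ### The continuous problem -/

/-- The coefficients `A`, `b`, `γ` of the operator `v ↦ -div (A ∇ v + b v) + γ v`. -/
structure Coeffs where
  A : E2 → E2 →L[ℝ] E2
  b : E2 → E2
  γ : E2 → ℝ

namespace Coeffs

variable (c : Coeffs)

/-- `(A ∇v, ∇w)` on `U`. -/
def aForm (U : Set E2) (v w : E2 → ℝ) : ℝ :=
  ∫ x in U, inner ℝ (c.A x (weakGrad U v x)) (weakGrad U w x)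

/-- `(v, b · ∇w)` on `U`. -/
def bForm (U : Set E2) (v w : E2 → ℝ) : ℝ :=
  ∫ x in U, v x * inner ℝ (c.b x) (weakGrad U w x)

/-- `(γ v, w)` on `U`. -/
def cForm (U : Set E2) (v w : E2 → ℝ) : ℝ :=
  ∫ x in U, c.γ x * v x * w x

/-- The bilinear form `B` on `U`. -/
def BForm (U : Set E2) (v w : E2 → ℝ) : ℝ :=
  c.aForm U v w + c.bForm U v w + c.cForm U v w

/-- The flux `A ∇v + b v` on `U`. -/
def flux (U : Set E2) (v : E2 → ℝ) (x : E2) : E2 :=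
  c.A x (weakGrad U v x) + v x • c.b x

/-- The coefficients are bounded by `M` almost everywhere in `Ω`. -/
def BoundedBy (Ω : Set E2) (M : ℝ) : Prop :=
  ∀ᵐ x ∂(volume.restrict Ω), ‖c.A x‖ ≤ M ∧ ‖c.b x‖ ≤ M ∧ |c.γ x| ≤ M

/-- The coefficients are Lipschitz continuous on (the interior of) each cell. -/
def PiecewiseLipschitz {Ω : Set E2} (T : Mesh Ω) : Prop :=
  ∃ K : ℝ≥0, ∀ i, LipschitzOnWith K c.A (T.cell i).dom ∧ LipschitzOnWith K c.b (T.cell i).dom ∧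
    LipschitzOnWith K c.γ (T.cell i).dom

/-- `A` is symmetric and uniformly elliptic. -/
def Elliptic (Ω : Set E2) (a₀ a₁ : ℝ) : Prop :=
  ∀ᵐ x ∂(volume.restrict Ω), (∀ ξ η : E2, inner ℝ (c.A x ξ) η = inner ℝ ξ (c.A x η)) ∧
    ∀ ξ : E2, a₀ * ‖ξ‖ ^ 2 ≤ inner ℝ (c.A x ξ) ξ ∧ inner ℝ (c.A x ξ) ξ ≤ a₁ * ‖ξ‖ ^ 2

/-- The operator from `H¹₀(Ω)` to its dual is injective. -/
def InjectiveOp (Ω : Set E2) : Prop :=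
  ∀ v, MemH10 Ω v → (∀ w, MemH10 Ω w → c.BForm Ω v w = 0) → v =ᵐ[volume.restrict Ω] 0

/-- `u ∈ H¹₀(Ω)` is a weak solution with right-hand side `f`. -/
def IsWeakSolution (Ω : Set E2) (f u : E2 → ℝ) : Prop :=
  MemH10 Ω u ∧ ∀ v, MemH10 Ω v → c.BForm Ω u v = ∫ x in Ω, f x * v x

/-! ### The discrete problem -/

/-- The restriction of `S` to `V_h(P)` is an admissible stabilization with constant `Cs`: it is
symmetric, positive definite, and equivalent to `a^P` on the kernel of `Π₁`. (Every bilinear form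
on a space of functions extends to all functions; only its values on `V_h(P)` enter.) -/
def IsStabilization (P : Polygon) (Cs : ℝ) (S : LinearMap.BilinForm ℝ (E2 → ℝ)) : Prop :=
  (∀ v w, MemVhLoc P v → MemVhLoc P w → S v w = S w v) ∧
    (∀ v, MemVhLoc P v → ¬ v =ᵐ[volume.restrict P.dom] 0 → 0 < S v v) ∧
    ∀ v, MemVhLoc P v → Pi1 P v = 0 →
      Cs⁻¹ * c.aForm P.dom v v ≤ S v v ∧ S v v ≤ Cs * c.aForm P.dom v v

variable {Ω : Set E2} (T : Mesh Ω)

/-- The discrete bilinear form `B_h`. -/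
def discreteForm (S : Fin T.N → LinearMap.BilinForm ℝ (E2 → ℝ)) (v w : E2 → ℝ) : ℝ :=
  ∑ i, (c.BForm (T.cell i).dom (Pi1 (T.cell i) v) (Pi1 (T.cell i) w) +
    S i (v - Pi1 (T.cell i) v) (w - Pi1 (T.cell i) w))

/-- `u_h ∈ V_h` solves the discrete problem with right-hand side `f`. -/
def IsDiscreteSolution (S : Fin T.N → LinearMap.BilinForm ℝ (E2 → ℝ)) (f uh : E2 → ℝ) : Prop :=
  T.MemVh uh ∧ ∀ vh, T.MemVh vh →
    c.discreteForm T S uh vh = ∑ i, ∫ x in (T.cell i).dom, f x * Pi1 (T.cell i) vh x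

end Coeffs

/-! ### Error estimator and data terms (all squared) -/

/-- Volume residual `η_P²`. -/
def etaSq (c : Coeffs) (P : Polygon) (f uh : E2 → ℝ) : ℝ :=
  P.h ^ 2 * l2Sq P.dom (fun x => f x - c.γ x * Pi1 P uh x)

/-- Stabilization `ζ_P²`. -/
def zetaSq (P : Polygon) (S : LinearMap.BilinForm ℝ (E2 → ℝ)) (uh : E2 → ℝ) : ℝ :=
  S (uh - Pi1 P uh) (uh - Pi1 P uh)

/-- `‖(1 - Π₀) F‖²` in `L²(P; ℝ²)`. -/
def approxSq (P : Polygon) (F : E2 → E2) : ℝ :=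
  l2Sq P.dom (fun x => F x - Pi0 P F)

/-- Inconsistency `Λ_P²`. -/
def lambdaSq (c : Coeffs) (P : Polygon) (uh : E2 → ℝ) : ℝ :=
  approxSq P (c.flux P.dom (Pi1 P uh))

/-- Nonconformity `Ξ_P²` of the cell `i`. -/
def xiSq {Ω : Set E2} (T : Mesh Ω) (i : Fin T.N) (uh : E2 → ℝ) : ℝ :=
  ∑ j, ((T.cell i).len j)⁻¹ *
    (T.cell i).eInt j (fun x => T.jump i j (fun k => Pi1 (T.cell k) uh) x ^ 2)

/-- The squared oscillation `osc₁²(g, P)`. -/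
def oscSq (P : Polygon) (g : E2 → ℝ) : ℝ :=
  l2Sq P.dom (fun x => P.h * (g x - Pi1 P g x))

end NCVEM

end

/-! All four bounds are local. Each residual is compared with its counterpart for the exact
solution, and the constants do not depend on the mesh size because every cell is star-shaped with
respect to a ball of radius `ρ h`.

Two inequalities on such a cell carry the analysis: Poincaré (`StarBall.poincare`) and the edge
trace inequality (`StarBall.edgeInt_sq_le`). Both come from integrating along rays for smooth
functions and extend to `H¹` by density (`StarBall.exists_smooth_approx`). Since `v - Π₁ v` has mean
zero, Poincaré bounds `‖u_h - Π₁ u_h‖` by `h |u_h - Π₁ u_h|₁`, and with `h ≤ 1` this controls `‖u -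
Π₁ u_h‖` by the error.

Stabilization (`zetaSq_le`): `u_h - Π₁ u_h` lies in `V_h(P)` and is annihilated by `Π₁`, so `S` is
bounded by `a^P` there. Membership needs Green's formula for constant fields on `P`
(`Polygon.exists_green`), obtained by cutting `P` into triangles with apex at the centre of the
ball.

Inconsistency (`lambdaSq_le`): the mean is the best constant approximation, so the mean of the
discrete flux may be replaced by that of the exact flux. The rest is the difference of the fluxes,
bounded by `M` times the error.

Volume residual (`etaSq_le`): with `g = f - γ u`, split `f - γ Π₁ u_h = (g - Π₁ g) + Π₁ g + γ (u -
Π₁ u_h)`. The first part is the oscillation and the last is the error. The middle one, `p = Π₁ g`,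
is tested with `w = ψ p` for a bubble `ψ`. The weak equation gives `∫ g w = ∫ (σ - Π₀ σ) · ∇w`,
because `∫ ∇w = 0`. Norm equivalence and an inverse estimate for affine functions then bound `h ‖p‖`
(`StarBall.sq_mul_l2Sq_Pi1_le`).

Nonconformity (`xiSq_le`): on an edge `E`, the jump `J` of `Π₁ u_h` satisfies `‖J‖² ≤ ‖J - κ‖² +
|E|⁻¹ (∫ J)²` for every constant `κ`. The jump of a test function `φ` near `u` vanishes, so for
suitable `κ` the first term is a jump of mean-zero functions `Π₁ u_h - φ - m`. As `u_h` has jumps of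
mean zero, `∫ J` is up to sign the integral of the jump of `u_h - Π₁ u_h`, again of mean zero on
each cell. Trace and Poincaré inequalities bound both, and `φ → u`. Plane geometry enters by showing
that an edge has at most one neighbouring cell, and that it lies outside `Ω` if it has none. -/

namespace NCVEM

/-! ### The square of the `L²` norm -/

section L2

variable {F : Type*} [NormedAddCommGroup F] {U W : Set E2} {v w : E2 → F}

lemma l2Sq_nonneg (U : Set E2) (v : E2 → F) : 0 ≤ l2Sq U v :=
  integral_nonneg fun _ => by positivity

lemma l2Sq_congr (h : v =ᵐ[volume.restrict U] w) : l2Sq U v = l2Sq U w :=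
  integral_congr_ae (h.mono fun x hx => by simp only [hx])

lemma integrable_norm_sq (hv : MemLp v 2 (volume.restrict U)) :
    Integrable (fun x => ‖v x‖ ^ 2) (volume.restrict U) :=
  (memLp_two_iff_integrable_sq_norm hv.1).1 hv

lemma l2Sq_le_of_ae_le {G : Type*} [NormedAddCommGroup G] {g : E2 → G}
    (hg : MemLp g 2 (volume.restrict U)) {K : ℝ}
    (h : ∀ᵐ x ∂volume.restrict U, ‖v x‖ ^ 2 ≤ K * ‖g x‖ ^ 2) : l2Sq U v ≤ K * l2Sq U g := by
  rw [l2Sq, l2Sq, ← integral_const_mul]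
  exact integral_mono_of_nonneg (ae_of_all _ fun _ => by positivity)
    ((integrable_norm_sq hg).const_mul K) h

lemma norm_add_sq_le (a b : F) : ‖a + b‖ ^ 2 ≤ 2 * (‖a‖ ^ 2 + ‖b‖ ^ 2) := by
  nlinarith [norm_add_le a b, norm_nonneg (a + b), sq_nonneg (‖a‖ - ‖b‖), norm_nonneg a,
    norm_nonneg b]

lemma l2Sq_add_le (hv : MemLp v 2 (volume.restrict U)) (hw : MemLp w 2 (volume.restrict U)) :
    l2Sq U (v + w) ≤ 2 * (l2Sq U v + l2Sq U w) := by
  rw [l2Sq, l2Sq, l2Sq, ← integral_add (integrable_norm_sq hv) (integrable_norm_sq hw),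
    ← integral_const_mul]
  exact integral_mono_of_nonneg (ae_of_all _ fun _ => by positivity)
    (((integrable_norm_sq hv).add (integrable_norm_sq hw)).const_mul 2)
    (ae_of_all _ fun x => norm_add_sq_le _ _)

lemma l2Sq_neg : l2Sq U (-v) = l2Sq U v := by simp [l2Sq]

lemma l2Sq_sub_comm : l2Sq U (v - w) = l2Sq U (w - v) := by
  rw [← l2Sq_neg, neg_sub]

lemma l2Sq_sub_le (hv : MemLp v 2 (volume.restrict U)) (hw : MemLp w 2 (volume.restrict U)) :
    l2Sq U (v - w) ≤ 2 * (l2Sq U v + l2Sq U w) := by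
  rw [sub_eq_add_neg, ← l2Sq_neg (v := w)]
  exact l2Sq_add_le hv hw.neg

lemma l2Sq_mono_set (hUW : W ⊆ U) (hv : MemLp v 2 (volume.restrict U)) :
    l2Sq W v ≤ l2Sq U v :=
  setIntegral_mono_set (integrable_norm_sq hv) (ae_of_all _ fun _ => by positivity)
    (LE.le.eventuallyLE hUW)

lemma l2Sq_eq_zero (hv : MemLp v 2 (volume.restrict U)) :
    l2Sq U v = 0 ↔ v =ᵐ[volume.restrict U] 0 := by
  rw [l2Sq, integral_eq_zero_iff_of_nonneg (fun _ => by positivity) (integrable_norm_sq hv)]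
  constructor <;> intro h <;> filter_upwards [h] with x hx <;> simpa using hx

lemma integral_norm_sq_eq_toReal_eLpNorm_sq {α : Type*} [MeasurableSpace α] {μ : Measure α}
    {f : α → F} (hf : MemLp f 2 μ) : ∫ x, ‖f x‖ ^ 2 ∂μ = (eLpNorm f 2 μ).toReal ^ 2 := by
  rw [hf.eLpNorm_eq_integral_rpow_norm (by norm_num) (by norm_num), ENNReal.toReal_ofReal
    (by positivity), ← Real.rpow_natCast, ← Real.rpow_mul (by positivity)]
  norm_num

lemma l2Sq_eq_toReal_eLpNorm_sq (hv : MemLp v 2 (volume.restrict U)) :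
    l2Sq U v = (eLpNorm v 2 (volume.restrict U)).toReal ^ 2 :=
  integral_norm_sq_eq_toReal_eLpNorm_sq hv

end L2

/-! ### Weak gradients -/

section WeakGrad

variable {U W : Set E2} {v w : E2 → ℝ} {g g' : E2 → E2}

lemma memLp_inner (hg : MemLp g 2 (volume.restrict U)) (e : E2) :
    MemLp (fun x => inner ℝ (g x) e) 2 (volume.restrict U) :=
  MemLp.inner_const hg e

lemma memLp_of_continuous_bounded {F : Type*} [NormedAddCommGroup F]
    (hU : Bornology.IsBounded U) {φ : E2 → F} (hφ : Continuous φ) (p : ENNReal) :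
    MemLp φ p (volume.restrict U) := by
  have hc : IsCompact (closure U) := hU.isCompact_closure
  obtain ⟨K, hK⟩ := hc.exists_bound_of_continuousOn hφ.continuousOn
  have : MemLp φ p (volume.restrict (closure U)) := by
    have : IsFiniteMeasure (volume.restrict (closure U)) :=
      ⟨by rw [Measure.restrict_apply_univ]; exact hc.measure_lt_top⟩
    refine MemLp.of_bound hφ.aestronglyMeasurable K ?_
    exact (ae_restrict_iff' isClosed_closure.measurableSet).2 (ae_of_all _ hK)
  exact this.mono_measure (Measure.restrict_mono subset_closure le_rfl)

lemma memLp_of_continuous_hasCompactSupport {F : Type*} [NormedAddCommGroup F]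
    {φ : E2 → F} (hφ : Continuous φ) (hc : HasCompactSupport φ) (p : ENNReal) :
    MemLp φ p (volume.restrict U) :=
  (hφ.memLp_of_hasCompactSupport hc).restrict U

lemma continuous_fderiv_apply {φ : E2 → ℝ} (hφ : ContDiff ℝ ∞ φ) (e : E2) :
    Continuous fun x => fderiv ℝ φ x e :=
  (hφ.continuous_fderiv (by simp)).clm_apply continuous_const

lemma hasCompactSupport_fderiv_apply {φ : E2 → ℝ} (hφ : HasCompactSupport φ) (e : E2) :
    HasCompactSupport fun x => fderiv ℝ φ x e :=
  hφ.fderiv_apply (𝕜 := ℝ) e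

lemma integrable_mul_fderiv (hv : MemLp v 2 (volume.restrict U)) {φ : E2 → ℝ}
    (hφ : ContDiff ℝ ∞ φ) (hc : HasCompactSupport φ) (e : E2) :
    Integrable (fun x => v x * fderiv ℝ φ x e) (volume.restrict U) :=
  hv.integrable_mul (memLp_of_continuous_hasCompactSupport (continuous_fderiv_apply hφ e)
    (hasCompactSupport_fderiv_apply hc e) 2)

lemma integrable_inner_mul (hg : MemLp g 2 (volume.restrict U)) {φ : E2 → ℝ}
    (hφ : ContDiff ℝ ∞ φ) (hc : HasCompactSupport φ) (e : E2) :
    Integrable (fun x => inner ℝ (g x) e * φ x) (volume.restrict U) :=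
  (memLp_inner hg e).integrable_mul (memLp_of_continuous_hasCompactSupport hφ.continuous hc 2)

/-- The component of `g - g'` in any direction integrates to zero against all test functions, so the
fundamental lemma of the calculus of variations applies. Two coordinate directions suffice. As
`weakGrad` is chosen arbitrarily, every computation with it goes through this uniqueness. -/
lemma HasWeakGrad.ae_unique (hU : IsOpen U) (h : HasWeakGrad U v g) (h' : HasWeakGrad U v g') :
    g =ᵐ[volume.restrict U] g' := by
  have key : ∀ e : E2, ∀ᵐ x ∂volume.restrict U, inner ℝ (g x - g' x) e = 0 := by
    intro e
    rw [ae_restrict_iff' hU.measurableSet]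
    refine hU.ae_eq_zero_of_integral_contDiff_smul_eq_zero
      (f := fun x => inner ℝ (g x - g' x) e) ?_ ?_
    · exact locallyIntegrableOn_of_locallyIntegrable_restrict
        ((memLp_inner (h.1.sub h'.1) e).locallyIntegrable (by norm_num))
    · intro φ hφ hc hs
      have h1 := h.2 φ hφ hc hs e
      have h2 := h'.2 φ hφ hc hs e
      rw [h1, neg_inj] at h2
      have h3 : ∫ x in U, φ x • inner ℝ (g x - g' x) e = 0 := by
        rw [← sub_eq_zero, ← integral_sub (integrable_inner_mul h.1 hφ hc e)
          (integrable_inner_mul h'.1 hφ hc e)] at h2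
        rw [← h2]
        congr 1; ext x
        rw [inner_sub_left, smul_eq_mul]; ring
      rw [← h3, setIntegral_eq_integral_of_forall_compl_eq_zero]
      intro x hx
      rw [image_eq_zero_of_notMem_tsupport fun hh => hx (hs hh), zero_smul]
  have h0 := key (EuclideanSpace.single 0 1)
  have h1 := key (EuclideanSpace.single 1 1)
  filter_upwards [h0, h1] with x hx0 hx1
  rw [← sub_eq_zero]
  ext i
  fin_cases i
  · simpa [EuclideanSpace.inner_single_right] using hx0
  · simpa [EuclideanSpace.inner_single_right] using hx1

lemma MemH1.hasWeakGrad (hv : MemH1 U v) : HasWeakGrad U v (weakGrad U v) := by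
  rw [weakGrad, dif_pos hv.2]
  exact hv.2.choose_spec

lemma MemH1.memLp_weakGrad (hv : MemH1 U v) : MemLp (weakGrad U v) 2 (volume.restrict U) :=
  hv.hasWeakGrad.1

lemma HasWeakGrad.weakGrad_ae_eq (hU : IsOpen U) (h : HasWeakGrad U v g) :
    weakGrad U v =ᵐ[volume.restrict U] g := by
  have hex : ∃ g, HasWeakGrad U v g := ⟨g, h⟩
  rw [weakGrad, dif_pos hex]
  exact hex.choose_spec.ae_unique hU h

lemma HasWeakGrad.sub (hv : MemLp v 2 (volume.restrict U)) (hw : MemLp w 2 (volume.restrict U))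
    (h : HasWeakGrad U v g) (h' : HasWeakGrad U w g') : HasWeakGrad U (v - w) (g - g') := by
  refine ⟨h.1.sub h'.1, fun φ hφ hc hs e => ?_⟩
  have e1 : ∀ x, (v - w) x * fderiv ℝ φ x e = v x * fderiv ℝ φ x e - w x * fderiv ℝ φ x e :=
    fun x => by simp [sub_mul]
  have e2 : ∀ x, inner ℝ ((g - g') x) e * φ x = inner ℝ (g x) e * φ x - inner ℝ (g' x) e * φ x :=
    fun x => by simp [inner_sub_left, sub_mul]
  simp_rw [e1, e2]
  rw [integral_sub (integrable_mul_fderiv hv hφ hc e) (integrable_mul_fderiv hw hφ hc e),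
    integral_sub (integrable_inner_mul h.1 hφ hc e) (integrable_inner_mul h'.1 hφ hc e),
    h.2 φ hφ hc hs e, h'.2 φ hφ hc hs e]
  ring

lemma MemH1.sub (hv : MemH1 U v) (hw : MemH1 U w) : MemH1 U (v - w) :=
  ⟨hv.1.sub hw.1, _, hv.hasWeakGrad.sub hv.1 hw.1 hw.hasWeakGrad⟩

lemma MemH1.weakGrad_sub (hU : IsOpen U) (hv : MemH1 U v) (hw : MemH1 U w) :
    weakGrad U (v - w) =ᵐ[volume.restrict U] weakGrad U v - weakGrad U w :=
  (hv.hasWeakGrad.sub hv.1 hw.1 hw.hasWeakGrad).weakGrad_ae_eq hU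

/-- A test function supported in `W` is also one for `U`, and the integrals over `U`, over `W` and
over the plane coincide. -/
lemma HasWeakGrad.mono (hWU : W ⊆ U) (h : HasWeakGrad U v g) : HasWeakGrad W v g := by
  refine ⟨h.1.mono_measure (Measure.restrict_mono hWU le_rfl), fun φ hφ hc hs e => ?_⟩
  have := h.2 φ hφ hc (hs.trans hWU) e
  have z : ∀ x, x ∉ W → φ x = 0 := fun x hx =>
    image_eq_zero_of_notMem_tsupport fun hh => hx (hs hh)
  have z' : ∀ x, x ∉ W → fderiv ℝ φ x e = 0 := fun x hx => by
    rw [fderiv_of_notMem_tsupport ℝ fun hh => hx (hs hh)]; rfl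
  rw [setIntegral_eq_integral_of_forall_compl_eq_zero fun x hx => by rw [z' x (fun h => hx (hWU h)),
    mul_zero], setIntegral_eq_integral_of_forall_compl_eq_zero fun x hx => by
    rw [z x (fun h => hx (hWU h)), mul_zero]] at this
  rw [setIntegral_eq_integral_of_forall_compl_eq_zero fun x hx => by rw [z' x hx, mul_zero],
    setIntegral_eq_integral_of_forall_compl_eq_zero fun x hx => by rw [z x hx, mul_zero], this]

lemma MemH1.mono (hWU : W ⊆ U) (hv : MemH1 U v) : MemH1 W v :=
  ⟨hv.1.mono_measure (Measure.restrict_mono hWU le_rfl), _, hv.hasWeakGrad.mono hWU⟩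

lemma MemH1.weakGrad_mono (hW : IsOpen W) (hWU : W ⊆ U) (hv : MemH1 U v) :
    weakGrad W v =ᵐ[volume.restrict W] weakGrad U v :=
  (hv.hasWeakGrad.mono hWU).weakGrad_ae_eq hW

lemma continuous_gradient {φ : E2 → ℝ} (hφ : ContDiff ℝ ∞ φ) : Continuous (gradient φ) :=
  (InnerProductSpace.toDual ℝ E2).symm.continuous.comp (hφ.continuous_fderiv (by simp))

lemma inner_gradient (φ : E2 → ℝ) (x e : E2) : inner ℝ (gradient φ x) e = fderiv ℝ φ x e := by
  rw [gradient, InnerProductSpace.toDual_symm_apply]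

lemma norm_gradient (φ : E2 → ℝ) (x : E2) : ‖gradient φ x‖ = ‖fderiv ℝ φ x‖ := by
  rw [gradient, LinearIsometryEquiv.norm_map]

lemma hasWeakGrad_gradient (hU : Bornology.IsBounded U) {φ : E2 → ℝ} (hφ : ContDiff ℝ ∞ φ) :
    HasWeakGrad U φ (gradient φ) := by
  refine ⟨memLp_of_continuous_bounded hU (continuous_gradient hφ) 2, fun ψ hψ hc hs e => ?_⟩
  have z : ∀ x, x ∉ U → ψ x = 0 := fun x hx =>
    image_eq_zero_of_notMem_tsupport fun hh => hx (hs hh)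
  have z' : ∀ x, x ∉ U → fderiv ℝ ψ x e = 0 := fun x hx => by
    rw [fderiv_of_notMem_tsupport ℝ fun hh => hx (hs hh)]; rfl
  simp_rw [inner_gradient]
  rw [setIntegral_eq_integral_of_forall_compl_eq_zero fun x hx => by rw [z' x hx, mul_zero],
    setIntegral_eq_integral_of_forall_compl_eq_zero fun x hx => by rw [z x hx, mul_zero]]
  refine integral_mul_fderiv_eq_neg_fderiv_mul_of_integrable ?_ ?_ ?_
    (fun x _ => hφ.differentiable (by simp) x) (fun x _ => hψ.differentiable (by simp) x)
  · exact ((continuous_fderiv_apply hφ e).mul hψ.continuous).integrable_of_hasCompactSupport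
      hc.mul_left
  · exact (hφ.continuous.mul (continuous_fderiv_apply hψ e)).integrable_of_hasCompactSupport
      (hasCompactSupport_fderiv_apply hc e).mul_left
  · exact (hφ.continuous.mul hψ.continuous).integrable_of_hasCompactSupport hc.mul_left

lemma memH1_of_contDiff (hU : Bornology.IsBounded U) {φ : E2 → ℝ} (hφ : ContDiff ℝ ∞ φ) :
    MemH1 U φ :=
  ⟨memLp_of_continuous_bounded hU hφ.continuous 2, _, hasWeakGrad_gradient hU hφ⟩

lemma weakGrad_of_contDiff (hUo : IsOpen U) (hU : Bornology.IsBounded U) {φ : E2 → ℝ}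
    (hφ : ContDiff ℝ ∞ φ) : weakGrad U φ =ᵐ[volume.restrict U] gradient φ :=
  (hasWeakGrad_gradient hU hφ).weakGrad_ae_eq hUo

lemma h1SemiSq_nonneg (U : Set E2) (v : E2 → ℝ) : 0 ≤ h1SemiSq U v := l2Sq_nonneg _ _

lemma h1NormSq_nonneg (U : Set E2) (v : E2 → ℝ) : 0 ≤ h1NormSq U v :=
  add_nonneg (l2Sq_nonneg _ _) (h1SemiSq_nonneg _ _)

lemma h1SemiSq_sub_le (hU : IsOpen U) (hv : MemH1 U v) (hw : MemH1 U w) :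
    h1SemiSq U (v - w) ≤ 2 * (h1SemiSq U v + h1SemiSq U w) := by
  rw [h1SemiSq, l2Sq_congr (hv.weakGrad_sub hU hw)]
  exact l2Sq_sub_le hv.memLp_weakGrad hw.memLp_weakGrad

lemma h1NormSq_sub_le (hU : IsOpen U) (hv : MemH1 U v) (hw : MemH1 U w) :
    h1NormSq U (v - w) ≤ 2 * (h1NormSq U v + h1NormSq U w) := by
  have h1 := h1SemiSq_sub_le hU hv hw
  have h2 := l2Sq_sub_le hv.1 hw.1
  simp only [h1NormSq]
  linarith

lemma h1SemiSq_sub_comm (hU : IsOpen U) (hv : MemH1 U v) (hw : MemH1 U w) :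
    h1SemiSq U (v - w) = h1SemiSq U (w - v) := by
  rw [h1SemiSq, h1SemiSq, l2Sq_congr (hv.weakGrad_sub hU hw), l2Sq_congr (hw.weakGrad_sub hU hv),
    l2Sq_sub_comm]

lemma h1SemiSq_mono (hW : IsOpen W) (hWU : W ⊆ U) (hv : MemH1 U v) :
    h1SemiSq W v ≤ h1SemiSq U v := by
  rw [h1SemiSq, l2Sq_congr (hv.weakGrad_mono hW hWU)]
  exact l2Sq_mono_set hWU hv.memLp_weakGrad

lemma h1NormSq_mono (hW : IsOpen W) (hWU : W ⊆ U) (hv : MemH1 U v) :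
    h1NormSq W v ≤ h1NormSq U v :=
  add_le_add (l2Sq_mono_set hWU hv.1) (h1SemiSq_mono hW hWU hv)

end WeakGrad

/-! ### Affine functions -/

lemma IsAffine.contDiff {p : E2 → ℝ} (hp : IsAffine p) : ContDiff ℝ ∞ p := by
  obtain ⟨c, g, h⟩ := hp
  rw [funext h]
  exact contDiff_const.add (contDiff_const.inner ℝ contDiff_id)

lemma IsAffine.sub {p q : E2 → ℝ} (hp : IsAffine p) (hq : IsAffine q) : IsAffine (p - q) := by
  obtain ⟨c, g, h⟩ := hp
  obtain ⟨c', g', h'⟩ := hq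
  exact ⟨c - c', g - g', fun x => by simp [h, h', inner_sub_left]; ring⟩

lemma isAffine_const (c : ℝ) : IsAffine fun _ => c := ⟨c, 0, fun x => by simp⟩

lemma gradient_affine {p : E2 → ℝ} {c : ℝ} {g : E2} (h : ∀ x, p x = c + inner ℝ g x) (x : E2) :
    gradient p x = g := by
  refine HasGradientAt.gradient ?_
  rw [funext h]
  have : HasFDerivAt (fun y : E2 => c + inner ℝ g y) (innerSL ℝ g) x :=
    ((innerSL ℝ g).hasFDerivAt).const_add c
  exact this

end NCVEM

namespace NCVEM

/-! ### Compact sets that are star-shaped with respect to a ball -/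

/-- The compact set `K` is star-shaped with respect to every point of the ball `B(c, r)`. -/
structure StarBall (K : Set E2) (c : E2) (r : ℝ) : Prop where
  isCompact : IsCompact K
  nonempty : K.Nonempty
  pos : 0 < r
  star : ∀ y ∈ Metric.ball c r, StarConvex ℝ y K

namespace StarBall

variable {K : Set E2} {c : E2} {r : ℝ}

lemma recenter (hK : StarBall K c r) {y : E2} (hy : y ∈ Metric.ball c r) :
    StarBall K y (r - dist y c) :=
  ⟨hK.isCompact, hK.nonempty, by simpa using hy, fun z hz => hK.star z (by
    rw [Metric.mem_ball] at *
    linarith [dist_triangle z y c])⟩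

/-- A point `y` of the small ball is `(1 - l) z + l x` with `z ∈ B(c, r)`, hence it lies in `K`.
Shrinking `K` by the factor `l` towards `c` thus leaves a margin `(1 - l) r` to the boundary, the
room needed for mollification. -/
lemma ball_homothety_subset (hK : StarBall K c r) {x : E2} (hx : x ∈ K) {l : ℝ} (h0 : 0 ≤ l)
    (h1 : l < 1) : Metric.ball (c + l • (x - c)) ((1 - l) * r) ⊆ interior K := by
  refine interior_maximal (fun y hy => ?_) Metric.isOpen_ball
  have hl : 0 < 1 - l := by linarith
  set z : E2 := c + (1 - l)⁻¹ • (y - (c + l • (x - c))) with hz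
  have hzb : z ∈ Metric.ball c r := by
    rw [Metric.mem_ball, dist_eq_norm] at *
    rw [hz, add_sub_cancel_left, norm_smul, Real.norm_eq_abs, abs_of_pos (inv_pos.2 hl),
      inv_mul_lt_iff₀ hl]
    exact hy
  have hyz : y = (1 - l) • z + l • x := by
    rw [hz, smul_add, smul_inv_smul₀ hl.ne']
    module
  rw [hyz]
  exact hK.star z hzb hx hl.le h0 (by ring)

lemma ball_subset (hK : StarBall K c r) : Metric.ball c r ⊆ interior K := by
  obtain ⟨x, hx⟩ := hK.nonempty
  simpa using hK.ball_homothety_subset hx le_rfl zero_lt_one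

lemma homothety_mem_interior (hK : StarBall K c r) {x y : E2} (hx : x ∈ K)
    (hy : y ∈ Metric.ball c r) {l : ℝ} (h0 : 0 ≤ l) (h1 : l < 1) :
    y + l • (x - y) ∈ interior K :=
  (hK.recenter hy).ball_homothety_subset hx h0 h1
    (Metric.mem_ball_self (mul_pos (by linarith) (hK.recenter hy).pos))

lemma homothety_mem_interior_of_interior (hK : StarBall K c r) {x y : E2} (hx : x ∈ interior K)
    (hy : y ∈ Metric.ball c r) {l : ℝ} (h0 : 0 ≤ l) (h1 : l ≤ 1) :
    y + l • (x - y) ∈ interior K := by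
  rcases h1.lt_or_eq with h | rfl
  · exact hK.homothety_mem_interior (interior_subset hx) hy h0 h
  · simpa using hx

lemma frontier_subset (hK : StarBall K c r) : frontier K ⊆ K :=
  hK.isCompact.isClosed.frontier_subset

/-- Of two distinct boundary points on one ray from `c`, the nearer one would be interior. So each
ray meets the boundary at most once. -/
lemma eq_one_of_frontier (hK : StarBall K c r) {z : E2} {s : ℝ} (hz : z ∈ frontier K) (hs : 0 < s)
    (hz' : c + s • (z - c) ∈ frontier K) : s = 1 := by
  have hc : c ∈ Metric.ball c r := Metric.mem_ball_self hK.pos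
  rcases lt_trichotomy s 1 with h | h | h
  · exact absurd (hK.homothety_mem_interior (hK.frontier_subset hz) hc hs.le h) hz'.2
  · exact h
  · have := hK.homothety_mem_interior (hK.frontier_subset hz') hc (inv_pos.2 hs).le
      (inv_lt_one_of_one_lt₀ h)
    rw [add_sub_cancel_left, inv_smul_smul₀ hs.ne', add_sub_cancel] at this
    exact absurd this hz.2

/-- The boundary point is the last point of `K` on the ray from `c` through `x`; it exists by
compactness. -/
lemma exists_frontier (hK : StarBall K c r) {x : E2} (hx : x ∈ interior K) (hxc : x ≠ c) :
    ∃ z ∈ frontier K, ∃ s : ℝ, 0 < s ∧ s < 1 ∧ x = c + s • (z - c) := by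
  set S : Set ℝ := {t | 1 ≤ t ∧ c + t • (x - c) ∈ K} with hS
  have hn : 0 < ‖x - c‖ := norm_pos_iff.2 (sub_ne_zero.2 hxc)
  have hSc : IsCompact S := by
    refine Metric.isCompact_of_isClosed_isBounded ?_ ?_
    · exact (isClosed_le continuous_const continuous_id).inter
        (hK.isCompact.isClosed.preimage (by fun_prop))
    · obtain ⟨R, hR⟩ := hK.isCompact.isBounded.exists_norm_le
      refine Bornology.IsBounded.subset (Metric.isBounded_Icc 1 ((R + ‖c‖) / ‖x - c‖)) ?_
      rintro t ⟨h1, ht⟩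
      refine ⟨h1, (le_div_iff₀ hn).2 ?_⟩
      have h2 := hR _ ht
      have h3 : ‖t • (x - c)‖ ≤ ‖c + t • (x - c)‖ + ‖c‖ := by
        simpa using norm_sub_le (c + t • (x - c)) c
      rw [norm_smul, Real.norm_eq_abs, abs_of_pos (by linarith)] at h3
      linarith
  obtain ⟨t, ⟨ht1, htK⟩, hmax⟩ := hSc.exists_isMaxOn ⟨1, le_rfl, by
    simpa using interior_subset hx⟩ continuousOn_id
  have hfr : c + t • (x - c) ∈ frontier K := by
    refine ⟨subset_closure htK, fun hi => ?_⟩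
    have hcont : Continuous fun s : ℝ => c + s • (x - c) := by fun_prop
    have := hcont.continuousAt.preimage_mem_nhds (isOpen_interior.mem_nhds hi)
    obtain ⟨δ, hδ, hb⟩ := Metric.mem_nhds_iff.1 this
    have h4 : t + δ / 2 ∈ Metric.ball t δ := by
      rw [Metric.mem_ball, Real.dist_eq, add_sub_cancel_left, abs_of_pos (by linarith)]; linarith
    have h5 : t + δ / 2 ≤ t := hmax (a := t + δ / 2) ⟨by linarith, interior_subset (hb h4)⟩
    linarith
  have ht1' : 1 < t := lt_of_le_of_ne ht1 fun h => hfr.2 (by simpa [← h] using hx)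
  refine ⟨_, hfr, t⁻¹, by positivity, inv_lt_one_of_one_lt₀ ht1', ?_⟩
  rw [add_sub_cancel_left, inv_smul_smul₀ (by positivity), add_sub_cancel]

lemma isBounded_interior (hK : StarBall K c r) : Bornology.IsBounded (interior K) :=
  hK.isCompact.isBounded.subset interior_subset

end StarBall

/-! ### Density of smooth functions -/

section Density

lemma lintegral_comp_add_smul (F : E2 → ENNReal) (a : E2) {t : ℝ} (ht : t ≠ 0) :
    ∫⁻ x, F (a + t • x) = ENNReal.ofReal ((t ^ 2)⁻¹) * ∫⁻ x, F x := by
  have h1 : ∫⁻ x, F (a + t • x) = ∫⁻ x, F (a + x) ∂(Measure.map (t • ·) (volume : Measure E2)) :=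
    (lintegral_map_equiv (fun x => F (a + x)) (Homeomorph.smulOfNeZero t ht).toMeasurableEquiv).symm
  rw [h1, Measure.map_addHaar_smul _ ht, lintegral_smul_measure, lintegral_add_left_eq_self F a]
  simp

variable {F : Type*} [NormedAddCommGroup F] [NormedSpace ℝ F]

open scoped Convolution

lemma lintegral_sq_le_of_isProbability {α : Type*} [MeasurableSpace α] (μ : Measure α)
    [IsProbabilityMeasure μ] {f : α → ENNReal} (hf : AEMeasurable f μ) :
    (∫⁻ x, f x ∂μ) ^ 2 ≤ ∫⁻ x, f x ^ 2 ∂μ := by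
  have h := ENNReal.lintegral_mul_le_Lp_mul_Lq μ Real.HolderConjugate.two_two hf
    (aemeasurable_const (b := (1 : ENNReal)))
  simp only [Pi.mul_apply, mul_one, ENNReal.one_rpow, lintegral_const, measure_univ] at h
  calc (∫⁻ x, f x ∂μ) ^ 2 ≤ ((∫⁻ a, f a ^ (2 : ℝ) ∂μ) ^ (1 / 2 : ℝ)) ^ 2 := by gcongr
    _ = ∫⁻ x, f x ^ 2 ∂μ := by
      rw [← ENNReal.rpow_natCast, ← ENNReal.rpow_mul]
      norm_num

lemma eLpNorm_two_sq {α G : Type*} [MeasurableSpace α] [NormedAddCommGroup G] (μ : Measure α)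
    (f : α → G) :
    eLpNorm f 2 μ ^ 2 = ∫⁻ x, ‖f x‖ₑ ^ 2 ∂μ := by
  rw [eLpNorm_eq_lintegral_rpow_enorm_toReal (by norm_num) (by norm_num), ← ENNReal.rpow_natCast,
    ← ENNReal.rpow_mul]
  norm_num

/-- The kernel is the density of a probability measure, so Jensen's inequality holds pointwise, and
Tonelli with translation invariance finishes. -/
lemma eLpNorm_normed_convolution_le (β : ContDiffBump (0 : E2)) {g : E2 → F}
    (hg : AEStronglyMeasurable g volume) :
    eLpNorm (β.normed volume ⋆[ContinuousLinearMap.lsmul ℝ ℝ, volume] g) 2 volume ≤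
      eLpNorm g 2 volume := by
  set η : E2 → ℝ := β.normed volume with hη
  have hηc : Continuous η := β.contDiff_normed (n := 0).continuous
  let μ : Measure E2 := volume.withDensity fun x => ENNReal.ofReal (η x)
  have hηm : Measurable fun x => ENNReal.ofReal (η x) := hηc.measurable.ennreal_ofReal
  have hμ : IsProbabilityMeasure μ := ⟨by
    rw [withDensity_apply _ MeasurableSet.univ, Measure.restrict_univ,
      ← ofReal_integral_eq_lintegral_ofReal β.integrable_normed
        (ae_of_all _ fun x => β.nonneg_normed x), β.integral_normed, ENNReal.ofReal_one]⟩
  have hpt : ∀ x, ‖(η ⋆[ContinuousLinearMap.lsmul ℝ ℝ, volume] g) x‖ₑ ^ 2 ≤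
      ∫⁻ t, ENNReal.ofReal (η t) * ‖g (x - t)‖ₑ ^ 2 := by
    intro x
    have hm : AEStronglyMeasurable (fun t => g (x - t)) volume :=
      hg.comp_quasiMeasurePreserving (quasiMeasurePreserving_sub_left volume x)
    have hac : μ ≪ volume := withDensity_absolutelyContinuous _ _
    have h1 : ‖(η ⋆[ContinuousLinearMap.lsmul ℝ ℝ, volume] g) x‖ₑ ≤ ∫⁻ t, ‖g (x - t)‖ₑ ∂μ := by
      rw [convolution_def]
      refine (enorm_integral_le_lintegral_enorm _).trans (le_of_eq ?_)
      rw [lintegral_withDensity_eq_lintegral_mul₀ hηm.aemeasurable hm.enorm]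
      refine lintegral_congr fun t => ?_
      simp [enorm_smul, Real.enorm_of_nonneg (β.nonneg_normed t), hη]
    calc _ ≤ (∫⁻ t, ‖g (x - t)‖ₑ ∂μ) ^ 2 := by gcongr
      _ ≤ ∫⁻ t, ‖g (x - t)‖ₑ ^ 2 ∂μ :=
        lintegral_sq_le_of_isProbability μ (hm.enorm.mono_ac hac)
      _ = _ := by
        rw [lintegral_withDensity_eq_lintegral_mul₀ hηm.aemeasurable (hm.enorm.pow_const 2)]
        rfl
  refine (ENNReal.pow_le_pow_left_iff two_ne_zero).1 ?_
  rw [eLpNorm_two_sq, eLpNorm_two_sq]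
  calc _ ≤ ∫⁻ x, ∫⁻ t, ENNReal.ofReal (η t) * ‖g (x - t)‖ₑ ^ 2 := lintegral_mono hpt
    _ = ∫⁻ t, ∫⁻ x, ENNReal.ofReal (η t) * ‖g (x - t)‖ₑ ^ 2 := by
      refine lintegral_lintegral_swap ?_
      refine AEMeasurable.mul (hηm.comp measurable_snd).aemeasurable ?_
      refine AEMeasurable.pow_const ?_ 2
      exact (hg.comp_quasiMeasurePreserving
        (quasiMeasurePreserving_sub_of_right_invariant volume volume)).enorm
    _ = ∫⁻ t, ENNReal.ofReal (η t) * ∫⁻ x, ‖g x‖ₑ ^ 2 := by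
      refine lintegral_congr fun t => ?_
      rw [lintegral_const_mul' _ _ ENNReal.ofReal_ne_top,
        lintegral_sub_right_eq_self (fun x => ‖g x‖ₑ ^ 2) t]
    _ = ∫⁻ x, ‖g x‖ₑ ^ 2 := by
      rw [lintegral_mul_const _ hηm]
      have := hμ.measure_univ
      rw [withDensity_apply _ MeasurableSet.univ, Measure.restrict_univ] at this
      rw [this, one_mul]

end Density

end NCVEM

namespace NCVEM

section Density

variable {F : Type*} [NormedAddCommGroup F] [NormedSpace ℝ F]

open scoped Convolution

/-- Mollification with the bump function `β`, followed by the dilation `x ↦ c + l (x - c)`. -/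
noncomputable def dilMollify (β : ContDiffBump (0 : E2)) (c : E2) (l : ℝ) (g : E2 → F)
    (x : E2) : F :=
  (β.normed volume ⋆[ContinuousLinearMap.lsmul ℝ ℝ, volume] g) (c + l • (x - c))

lemma contDiff_dilMollify [CompleteSpace F] (β : ContDiffBump (0 : E2)) (c : E2) (l : ℝ)
    {g : E2 → F} (hg : LocallyIntegrable g volume) : ContDiff ℝ ∞ (dilMollify β c l g) := by
  have h : ContDiff ℝ ∞ (β.normed volume ⋆[ContinuousLinearMap.lsmul ℝ ℝ, volume] g) :=
    β.hasCompactSupport_normed.contDiff_convolution_left _ β.contDiff_normed hg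
  exact h.comp (g := _) (f := fun x => c + l • (x - c)) (by fun_prop)

lemma dilMollify_add (β : ContDiffBump (0 : E2)) (c : E2) (l : ℝ)
    {g k : E2 → F} (hg : LocallyIntegrable g volume) (hk : LocallyIntegrable k volume) :
    dilMollify β c l (g + k) = dilMollify β c l g + dilMollify β c l k := by
  have hc : Continuous (β.normed (volume : Measure E2)) := β.contDiff_normed (n := 0).continuous
  ext x
  exact ((β.hasCompactSupport_normed.convolutionExists_left _ hc hg) _).distrib_add
    ((β.hasCompactSupport_normed.convolutionExists_left _ hc hk) _)

/-- The dilation contributes the Jacobian `l⁻² ≤ 4`, hence the factor `2`. The bound is uniform in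
`β`, `c` and `l`, which the density argument below requires. -/
lemma eLpNorm_dilMollify_le (β : ContDiffBump (0 : E2)) (c : E2) {l : ℝ} (hl : 1 / 2 ≤ l)
    {g : E2 → F} (hg : AEStronglyMeasurable g volume) :
    eLpNorm (dilMollify β c l g) 2 volume ≤ 2 * eLpNorm g 2 volume := by
  have hl0 : 0 < l := by linarith
  refine (ENNReal.pow_le_pow_left_iff two_ne_zero).1 ?_
  have h1 := (ENNReal.pow_le_pow_left_iff two_ne_zero).2 (eLpNorm_normed_convolution_le β hg)
  rw [mul_pow, eLpNorm_two_sq]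
  have h2 : ∀ x : E2, c + l • (x - c) = (c - l • c) + l • x := fun x => by module
  simp only [dilMollify, h2]
  rw [lintegral_comp_add_smul
    (fun y => ‖(β.normed volume ⋆[ContinuousLinearMap.lsmul ℝ ℝ, volume] g) y‖ₑ ^ 2) _ hl0.ne',
    ← eLpNorm_two_sq]
  gcongr
  have : (l ^ 2)⁻¹ ≤ 2 ^ 2 := by
    rw [inv_le_comm₀ (by positivity) (by positivity)]
    nlinarith
  calc ENNReal.ofReal ((l ^ 2)⁻¹) ≤ ENNReal.ofReal (2 ^ 2) := ENNReal.ofReal_le_ofReal this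
    _ = 2 ^ 2 := by rw [ENNReal.ofReal_pow (by norm_num), ENNReal.ofReal_ofNat]

/-- The operators are uniformly bounded on `L²` and converge uniformly on `D` for continuous
compactly supported functions, which are dense. -/
lemma tendsto_dilMollify [CompleteSpace F] (β : ℕ → ContDiffBump (0 : E2)) (c : E2) (l : ℕ → ℝ)
    (hβ : Tendsto (fun n => (β n).rOut) atTop (𝓝 0)) (hl : Tendsto l atTop (𝓝 1))
    {D : Set E2} (hD : Bornology.IsBounded D) (hDm : MeasurableSet D)
    {g : E2 → F} (hg : MemLp g 2 volume) :
    Tendsto (fun n => eLpNorm (dilMollify (β n) c (l n) g - g) 2 (volume.restrict D)) atTop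
      (𝓝 0) := by
  rw [ENNReal.tendsto_nhds_zero]
  intro δ hδ
  have hδ4 : δ / 4 ≠ 0 := (ENNReal.div_pos hδ.ne' (by norm_num)).ne'
  obtain ⟨k, hkc, hgk, hk, hkL⟩ := hg.exists_hasCompactSupport_eLpNorm_sub_le
    (by norm_num) (ε := δ / 4) hδ4
  have hku : UniformContinuous k := hkc.uniformContinuous_of_continuous hk
  have hDfin : volume D ≠ ⊤ := hD.measure_lt_top.ne
  -- a real bound for the uniform error
  obtain ⟨κ, hκ, hκδ⟩ : ∃ κ : ℝ, 0 < κ ∧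
      (volume.restrict D) univ ^ (2 : ENNReal).toReal⁻¹ * ENNReal.ofReal κ ≤ δ / 4 := by
    have : Tendsto (fun κ : ℝ => (volume.restrict D) univ ^ (2 : ENNReal).toReal⁻¹ *
        ENNReal.ofReal κ) (𝓝[>] 0) (𝓝 0) := by
      have h0 : Tendsto (fun κ : ℝ => ENNReal.ofReal κ) (𝓝[>] 0) (𝓝 0) := by
        have := (ENNReal.continuous_ofReal.tendsto (0 : ℝ)).mono_left
          (nhdsWithin_le_nhds (s := Ioi 0))
        simpa using this
      have := ENNReal.Tendsto.const_mul (a := (volume.restrict D) univ ^ (2 : ENNReal).toReal⁻¹) h0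
        (Or.inr (by
          rw [Measure.restrict_apply_univ]
          exact ENNReal.rpow_ne_top_of_nonneg (by simp) hDfin))
      simpa using this
    have h2 := (ENNReal.tendsto_nhds_zero.1 this (δ / 4) (pos_iff_ne_zero.2 hδ4)).and
      self_mem_nhdsWithin
    obtain ⟨κ, h3, h4⟩ := h2.exists
    exact ⟨κ, h4, h3⟩
  -- One modulus of continuity serves twice: for the mollification radius and for the displacement
  -- `|l - 1| ‖x - c‖` of the dilation, each costing `κ / 2`.
  obtain ⟨θ, hθ, hθk⟩ := Metric.uniformContinuous_iff.1 hku (κ / 2) (by positivity)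
  obtain ⟨R, hR⟩ := hD.exists_norm_le
  have hR' : ∀ x ∈ D, ‖x - c‖ < |R| + ‖c‖ + 1 := fun x hx => by
    have := norm_sub_le x c
    linarith [hR x hx, le_abs_self R]
  have hRpos : 0 < |R| + ‖c‖ + 1 := by positivity
  have e1 : ∀ᶠ n in atTop, (β n).rOut < θ := hβ.eventually_lt_const hθ
  have e2 : ∀ᶠ n in atTop, |l n - 1| < θ / (|R| + ‖c‖ + 1) := by
    have : Tendsto (fun n => |l n - 1|) atTop (𝓝 0) := by
      simpa using (hl.sub_const 1).abs
    exact this.eventually_lt_const (by positivity)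
  have e3 : ∀ᶠ n in atTop, 1 / 2 < l n := hl.eventually_const_lt (by norm_num)
  filter_upwards [e1, e2, e3] with n h1 h2 h3
  have hsm : AEStronglyMeasurable (g - k) volume := hg.1.sub hkL.1
  have hloc : LocallyIntegrable (g - k) volume :=
    (hg.sub hkL).locallyIntegrable (by norm_num)
  have hlock : LocallyIntegrable k volume := hkL.locallyIntegrable (by norm_num)
  have hsplit : dilMollify (β n) c (l n) g - g =
      dilMollify (β n) c (l n) (g - k) + ((dilMollify (β n) c (l n) k - k) - (g - k)) := by
    conv_lhs => rw [show g = (g - k) + k by simp, dilMollify_add _ _ _ hloc hlock]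
    abel
  have hmT : ∀ {q : E2 → F}, LocallyIntegrable q volume →
      AEStronglyMeasurable (dilMollify (β n) c (l n) q) (volume.restrict D) := fun hq =>
    (contDiff_dilMollify (β n) c (l n) hq).continuous.aestronglyMeasurable
  have b1 : eLpNorm (dilMollify (β n) c (l n) (g - k)) 2 (volume.restrict D) ≤ 2 * (δ / 4) :=
    (eLpNorm_restrict_le _ _ _ _).trans
      ((eLpNorm_dilMollify_le (β n) c h3.le hsm).trans (by gcongr))
  have b2 : eLpNorm (dilMollify (β n) c (l n) k - k) 2 (volume.restrict D) ≤ δ / 4 := by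
    refine (eLpNorm_le_of_ae_bound (C := κ) ?_).trans hκδ
    refine (ae_restrict_iff' hDm).2 (ae_of_all _ fun x hx => ?_)
    rw [Pi.sub_apply, ← dist_eq_norm]
    have d1 : dist (dilMollify (β n) c (l n) k x) (k (c + l n • (x - c))) ≤ κ / 2 :=
      (β n).dist_normed_convolution_le hk.aestronglyMeasurable fun y hy =>
        (hθk (lt_trans (Metric.mem_ball.1 hy) h1)).le
    have d2 : dist (k (c + l n • (x - c))) (k x) ≤ κ / 2 := by
      refine (hθk ?_).le
      rw [dist_eq_norm, show c + l n • (x - c) - x = (l n - 1) • (x - c) by module, norm_smul,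
        Real.norm_eq_abs]
      calc |l n - 1| * ‖x - c‖ ≤ |l n - 1| * (|R| + ‖c‖ + 1) := by
            gcongr; exact (hR' x hx).le
        _ < θ := by rwa [lt_div_iff₀ hRpos] at h2
    linarith [dist_triangle (dilMollify (β n) c (l n) k x) (k (c + l n • (x - c))) (k x)]
  have b3 : eLpNorm (g - k) 2 (volume.restrict D) ≤ δ / 4 :=
    (eLpNorm_restrict_le _ _ _ _).trans hgk
  rw [hsplit]
  calc _ ≤ eLpNorm (dilMollify (β n) c (l n) (g - k)) 2 (volume.restrict D) +
        eLpNorm ((dilMollify (β n) c (l n) k - k) - (g - k)) 2 (volume.restrict D) :=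
        eLpNorm_add_le (hmT hloc) (((hmT hlock).sub hkL.1.restrict).sub hsm.restrict) (by norm_num)
    _ ≤ eLpNorm (dilMollify (β n) c (l n) (g - k)) 2 (volume.restrict D) +
        (eLpNorm (dilMollify (β n) c (l n) k - k) 2 (volume.restrict D) +
          eLpNorm (g - k) 2 (volume.restrict D)) := by
        gcongr
        exact eLpNorm_sub_le ((hmT hlock).sub hkL.1.restrict) hsm.restrict (by norm_num)
    _ ≤ 2 * (δ / 4) + (δ / 4 + δ / 4) := by gcongr
    _ = 4 * (δ / 4) := by ring
    _ = δ := ENNReal.mul_div_cancel (by norm_num) (by norm_num)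

/-- The derivative of the convolution falls on the kernel. Since the kernel recentred at `c + l (x -
c)` has support in `D`, it is an admissible test function and the weak gradient takes the derivative
over; the chain rule adds the factor `l`. The jump of the extension by zero is never seen. -/
lemma gradient_dilMollify {D : Set E2} (hD : MeasurableSet D) {v : E2 → ℝ} {g : E2 → E2}
    (hv : MemLp v 2 (volume.restrict D)) (hg : HasWeakGrad D v g) (β : ContDiffBump (0 : E2))
    (c : E2) (l : ℝ) {x : E2}
    (hx : Metric.closedBall (c + l • (x - c)) β.rOut ⊆ D) :
    gradient (dilMollify β c l (D.indicator v)) x =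
      l • dilMollify β c l (D.indicator g) x := by
  set X := c + l • (x - c) with hX
  set η : E2 → ℝ := β.normed volume with hη
  have hηd : ContDiff ℝ ∞ η := β.contDiff_normed
  have hηc : HasCompactSupport η := β.hasCompactSupport_normed
  have hvL : MemLp (D.indicator v) 2 volume := (memLp_indicator_iff_restrict hD).2 hv
  have hgL : MemLp (D.indicator g) 2 volume := (memLp_indicator_iff_restrict hD).2 hg.1
  have hvloc : LocallyIntegrable (D.indicator v) volume := hvL.locallyIntegrable (by norm_num)
  have hgloc : LocallyIntegrable (D.indicator g) volume := hgL.locallyIntegrable (by norm_num)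
  refine ext_inner_right ℝ fun e => ?_
  rw [inner_gradient, inner_smul_left]
  -- the test function
  have hψd : ContDiff ℝ ∞ fun y => η (X - y) := hηd.comp (contDiff_const.sub contDiff_id)
  have hψs : tsupport (fun y => η (X - y)) ⊆ Metric.closedBall X β.rOut := by
    refine closure_minimal (fun y hy => ?_) Metric.isClosed_closedBall
    have : X - y ∈ Function.support η := hy
    rw [hη, β.support_normed_eq, Metric.mem_ball, dist_zero_right] at this
    rw [Metric.mem_closedBall, dist_comm, dist_eq_norm]
    exact this.le
  have hψc : HasCompactSupport fun y => η (X - y) :=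
    (isCompact_closedBall X β.rOut).of_isClosed_subset (isClosed_tsupport _) hψs
  have hψ' : ∀ y, fderiv ℝ (fun y => η (X - y)) y e = -fderiv ℝ η (X - y) e := by
    intro y
    have h1 : HasFDerivAt (fun y => X - y) (-(ContinuousLinearMap.id ℝ E2)) y :=
      (hasFDerivAt_id y).const_sub X
    have h2 := ((hηd.differentiable (by simp) (X - y)).hasFDerivAt.comp y h1).fderiv
    rw [Function.comp_def] at h2
    rw [h2]; simp
  have hweak := hg.2 _ hψd hψc (hψs.trans hx) e
  simp_rw [hψ'] at hweak
  -- the derivative of the mollification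
  have hconv := hηc.hasFDerivAt_convolution_left (ContinuousLinearMap.lsmul ℝ ℝ)
    (hηd.of_le (by simp)) hvloc X
  have hA : HasFDerivAt (fun x : E2 => c + l • (x - c)) (l • ContinuousLinearMap.id ℝ E2) x :=
    (((hasFDerivAt_id x).sub_const c).const_smul l).const_add c
  have hcomp : fderiv ℝ (dilMollify β c l (D.indicator v)) x e =
      l * ((fderiv ℝ η ⋆[(ContinuousLinearMap.lsmul ℝ ℝ).precompL E2, volume] D.indicator v) X)
        e := by
    have := (hconv.comp x hA).fderiv
    rw [Function.comp_def] at this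
    change fderiv ℝ (fun x => (η ⋆[ContinuousLinearMap.lsmul ℝ ℝ, volume] D.indicator v)
      (c + l • (x - c))) x e = _
    rw [this]; simp
  rw [hcomp]
  simp only [conj_trivial]
  congr 1
  have hex : ConvolutionExistsAt (fderiv ℝ η) (D.indicator v) X
      ((ContinuousLinearMap.lsmul ℝ ℝ).precompL E2) volume :=
    (hηc.fderiv ℝ).convolutionExists_left _ (hηd.continuous_fderiv (by simp)) hvloc X
  have hex' : ConvolutionExistsAt η (D.indicator g) X (ContinuousLinearMap.lsmul ℝ ℝ) volume :=
    hηc.convolutionExists_left _ hηd.continuous hgloc X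
  rw [convolution_def, ContinuousLinearMap.integral_apply hex]
  simp only [ContinuousLinearMap.precompL_apply, ContinuousLinearMap.lsmul_apply, smul_eq_mul]
  rw [← integral_sub_left_eq_self _ volume X]
  simp only [sub_sub_cancel]
  have hL : ∫ y, fderiv ℝ η (X - y) e * D.indicator v y =
      ∫ y in D, v y * fderiv ℝ η (X - y) e := by
    rw [← integral_indicator hD]
    congr 1; ext y
    by_cases hy : y ∈ D <;> simp [hy, mul_comm]
  rw [hL]
  have hR : inner ℝ (dilMollify β c l (D.indicator g) x) e =
      ∫ y in D, inner ℝ (g y) e * η (X - y) := by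
    change inner ℝ ((η ⋆[ContinuousLinearMap.lsmul ℝ ℝ, volume] D.indicator g) X) e = _
    rw [convolution_def, real_inner_comm, ← integral_inner hex',
      ← integral_sub_left_eq_self _ volume X, ← integral_indicator hD]
    congr 1; ext y
    by_cases hy : y ∈ D
    · simp [hy, inner_smul_right, real_inner_comm, mul_comm]
    · simp [hy]
  rw [hR]
  simp only [mul_neg, integral_neg, neg_inj] at hweak
  exact hweak

/-- Functions that are smooth up to the boundary are dense in `H¹` of a domain that is star-shaped
with respect to a ball. -/
lemma StarBall.exists_smooth_approx {K : Set E2} {c : E2} {r : ℝ} (hK : StarBall K c r)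
    {v : E2 → ℝ} (hv : MemH1 (interior K) v) :
    ∃ φ : ℕ → E2 → ℝ, (∀ n, ContDiff ℝ ∞ (φ n)) ∧
      Tendsto (fun n => h1NormSq (interior K) (φ n - v)) atTop (𝓝 0) := by
  set D := interior K with hDdef
  have hDo : IsOpen D := isOpen_interior
  have hDm : MeasurableSet D := hDo.measurableSet
  have hDb : Bornology.IsBounded D := hK.isBounded_interior
  set g := weakGrad D v with hgdef
  have hg : HasWeakGrad D v g := hv.hasWeakGrad
  have hvL : MemLp (D.indicator v) 2 volume := (memLp_indicator_iff_restrict hDm).2 hv.1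
  have hgL : MemLp (D.indicator g) 2 volume := (memLp_indicator_iff_restrict hDm).2 hg.1
  let ε : ℕ → ℝ := fun n => 1 / ((n : ℝ) + 2)
  have hε0 : ∀ n, 0 < ε n := fun n => by positivity
  have hε1 : ∀ n, ε n < 1 := fun n => by
    simp only [ε]; rw [div_lt_one (by positivity)]
    have : (0 : ℝ) ≤ n := Nat.cast_nonneg n
    linarith
  have hεt : Tendsto ε atTop (𝓝 0) :=
    tendsto_const_nhds.div_atTop (tendsto_atTop_add_const_right _ _ tendsto_natCast_atTop_atTop)
  -- The radius `ε r / 2` stays below the margin `(1 - l) r = ε r` provided by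
  -- `ball_homothety_subset`.
  let β : ℕ → ContDiffBump (0 : E2) := fun n =>
    ⟨ε n * r / 3, ε n * r / 2, by have := hK.pos; have := hε0 n; positivity, by
      have := mul_pos (hε0 n) hK.pos; linarith⟩
  have hβ : Tendsto (fun n => (β n).rOut) atTop (𝓝 0) := by
    have : Tendsto (fun n => ε n * r / 2) atTop (𝓝 (0 * r / 2)) := (hεt.mul_const r).div_const 2
    simpa using this
  let l : ℕ → ℝ := fun n => 1 - ε n
  have hl : Tendsto l atTop (𝓝 1) := by simpa using hεt.const_sub 1
  have hball : ∀ n, ∀ x ∈ D, Metric.closedBall (c + l n • (x - c)) (β n).rOut ⊆ D := by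
    intro n x hx
    refine (Metric.closedBall_subset_ball ?_).trans (hK.ball_homothety_subset (interior_subset hx)
      (l := l n) (by linarith [hε1 n]) (by linarith [hε0 n]))
    change ε n * r / 2 < (1 - (1 - ε n)) * r
    have := mul_pos (hε0 n) hK.pos
    linarith
  let φ : ℕ → E2 → ℝ := fun n => dilMollify (β n) c (l n) (D.indicator v)
  have hφ : ∀ n, ContDiff ℝ ∞ (φ n) := fun n =>
    contDiff_dilMollify _ _ _ (hvL.locallyIntegrable (by norm_num))
  have hind : ∀ {G : Type} [NormedAddCommGroup G] (q : E2 → G),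
      D.indicator q =ᵐ[volume.restrict D] q := fun q => indicator_ae_eq_restrict hDm
  refine ⟨φ, hφ, ?_⟩
  have t1 := tendsto_dilMollify β c l hβ hl hDb hDm hvL
  have t2 := tendsto_dilMollify β c l hβ hl hDb hDm hgL
  have s1 : Tendsto (fun n => l2Sq D (φ n - v)) atTop (𝓝 0) := by
    have := (((ENNReal.tendsto_toReal (by simp)).comp t1).pow 2)
    simp only [ENNReal.toReal_zero, ne_eq, OfNat.ofNat_ne_zero, not_false_eq_true, zero_pow] at this
    refine this.congr fun n => ?_
    rw [l2Sq_eq_toReal_eLpNorm_sq ((memH1_of_contDiff hDb (hφ n)).1.sub hv.1)]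
    have : φ n - D.indicator v =ᵐ[volume.restrict D] φ n - v := by
      filter_upwards [hind v] with x hx
      simp [hx]
    rw [← eLpNorm_congr_ae this]
    rfl
  have s2 : Tendsto (fun n => h1SemiSq D (φ n - v)) atTop (𝓝 0) := by
    have hT : Tendsto (fun n => l2Sq D (dilMollify (β n) c (l n) (D.indicator g) -
        D.indicator g)) atTop (𝓝 0) := by
      have := (((ENNReal.tendsto_toReal (by simp)).comp t2).pow 2)
      simp only [ENNReal.toReal_zero, ne_eq, OfNat.ofNat_ne_zero, not_false_eq_true, zero_pow]
        at this
      refine this.congr fun n => ?_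
      rw [l2Sq_eq_toReal_eLpNorm_sq]
      · rfl
      · exact (memLp_of_continuous_bounded hDb (contDiff_dilMollify _ _ _
          (hgL.locallyIntegrable (by norm_num))).continuous 2).sub (hgL.restrict D)
    have hup : Tendsto (fun n => 2 * (l n ^ 2 * l2Sq D (dilMollify (β n) c (l n) (D.indicator g) -
        D.indicator g) + ε n ^ 2 * l2Sq D g)) atTop (𝓝 0) := by
      have := (((hl.pow 2).mul hT).add ((hεt.pow 2).mul_const (l2Sq D g))).const_mul 2
      simpa using this
    refine squeeze_zero (fun n => h1SemiSq_nonneg _ _) (fun n => ?_) hup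
    have hTm : MemLp (dilMollify (β n) c (l n) (D.indicator g) - D.indicator g) 2
        (volume.restrict D) :=
      (memLp_of_continuous_bounded hDb (contDiff_dilMollify _ _ _
          (hgL.locallyIntegrable (by norm_num))).continuous 2).sub (hgL.restrict D)
    -- With `T` the dilated mollification, `l T g - g = l (T g - g) - ε g`, because `l - 1 = -ε`.
    have hae : weakGrad D (φ n - v) =ᵐ[volume.restrict D]
        l n • (dilMollify (β n) c (l n) (D.indicator g) - D.indicator g) - ε n • g := by
      filter_upwards [(memH1_of_contDiff hDb (hφ n)).weakGrad_sub hDo hv,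
        weakGrad_of_contDiff hDo hDb (hφ n), hind g, ae_restrict_mem hDm] with x h1 h2 h3 h4
      rw [h1, Pi.sub_apply, h2, gradient_dilMollify hDm hv.1 hg _ _ _ (hball n x h4)]
      simp only [Pi.sub_apply, Pi.smul_apply, h3]
      simp only [l, ← hgdef]
      module
    rw [h1SemiSq, l2Sq_congr hae]
    refine (l2Sq_sub_le (hTm.const_smul (l n)) (hg.1.const_smul (ε n))).trans (le_of_eq ?_)
    simp only [l2Sq, Pi.smul_apply, norm_smul, mul_pow, integral_const_mul, Real.norm_eq_abs,
      sq_abs]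
  simpa [h1NormSq] using s1.add s2

end Density

end NCVEM

namespace NCVEM

/-! ### The Poincaré inequality -/

section Poincare

lemma enorm_sub_sq_le_lintegral_fderiv {φ : E2 → ℝ} (hφ : ContDiff ℝ ∞ φ) (x y : E2) :
    ‖φ x - φ y‖ₑ ^ 2 ≤ ‖x - y‖ₑ ^ 2 *
      ∫⁻ t in Ioc (0 : ℝ) 1, ‖fderiv ℝ φ (y + t • (x - y))‖ₑ ^ 2 := by
  have hline : Continuous fun t : ℝ => y + t • (x - y) := by fun_prop
  have hcont : Continuous fun t : ℝ => fderiv ℝ φ (y + t • (x - y)) :=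
    (hφ.continuous_fderiv (by simp)).comp hline
  have hd : ∀ t : ℝ, HasDerivAt (fun t : ℝ => φ (y + t • (x - y)))
      (fderiv ℝ φ (y + t • (x - y)) (x - y)) t := by
    intro t
    have h1 : HasDerivAt (fun t : ℝ => y + t • (x - y)) (x - y) t := by
      simpa using ((hasDerivAt_id t).smul_const (x - y)).const_add y
    exact (hφ.differentiable (by simp) _).hasFDerivAt.comp_hasDerivAt t h1
  have hint : φ x - φ y = ∫ t in (0 : ℝ)..1, fderiv ℝ φ (y + t • (x - y)) (x - y) := by
    rw [intervalIntegral.integral_eq_sub_of_hasDerivAt (fun t _ => hd t)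
      ((hcont.clm_apply continuous_const).intervalIntegrable _ _)]
    simp
  have hP : IsProbabilityMeasure (volume.restrict (Ioc (0 : ℝ) 1)) := ⟨by simp⟩
  have hm : AEMeasurable (fun t : ℝ => ‖fderiv ℝ φ (y + t • (x - y))‖ₑ)
      (volume.restrict (Ioc (0 : ℝ) 1)) := hcont.aestronglyMeasurable.enorm
  have h1 : ‖φ x - φ y‖ₑ ≤ ‖x - y‖ₑ *
      ∫⁻ t in Ioc (0 : ℝ) 1, ‖fderiv ℝ φ (y + t • (x - y))‖ₑ := by
    rw [hint, intervalIntegral.integral_of_le zero_le_one, ← lintegral_const_mul'' _ hm]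
    refine (enorm_integral_le_lintegral_enorm _).trans (lintegral_mono fun t => ?_)
    rw [mul_comm]
    exact ContinuousLinearMap.le_opENorm _ _
  calc _ ≤ (‖x - y‖ₑ * ∫⁻ t in Ioc (0 : ℝ) 1, ‖fderiv ℝ φ (y + t • (x - y))‖ₑ) ^ 2 := by gcongr
    _ ≤ _ := by
      rw [mul_pow]
      gcongr
      exact lintegral_sq_le_of_isProbability _ hm

variable {K : Set E2} {c : E2} {r : ℝ}

lemma enorm_sub_le_diam (hK : IsCompact K) {x y : E2} (hx : x ∈ K) (hy : y ∈ K) :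
    ‖x - y‖ₑ ≤ ENNReal.ofReal (Metric.diam K) := by
  rw [← ofReal_norm, ← dist_eq_norm]
  exact ENNReal.ofReal_le_ofReal (Metric.dist_le_diam_of_mem hK.isBounded hx hy)

/-- One of the coefficients `t` and `1 - t` is at least `1 / 2`. Changing variables in the point
that carries it costs a Jacobian of at most `4`, so no singular kernel appears. -/
lemma lintegral_comp_segment_le {G : E2 → ENNReal} (hG : Measurable G) (A B : Set E2) {t : ℝ} :
    ∫⁻ x in A, ∫⁻ y in B, G (y + t • (x - y)) ≤ 4 * (volume A + volume B) * ∫⁻ z, G z := by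
  have hm : Measurable fun p : E2 × E2 => G (p.2 + t • (p.1 - p.2)) := by fun_prop
  have hsq : ∀ s : ℝ, 1 / 2 ≤ s → ENNReal.ofReal ((s ^ 2)⁻¹) ≤ 4 := fun s hs => by
    rw [show (4 : ENNReal) = ENNReal.ofReal 4 by simp]
    refine ENNReal.ofReal_le_ofReal ?_
    rw [inv_le_comm₀ (by positivity) (by positivity)]
    nlinarith
  rcases le_total (1 / 2) t with ht | ht
  · rw [lintegral_lintegral_swap hm.aemeasurable]
    calc _ ≤ ∫⁻ _ in B, 4 * ∫⁻ z, G z := by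
          refine lintegral_mono fun y => (setLIntegral_le_lintegral _ _).trans ?_
          have : ∀ x : E2, y + t • (x - y) = (y - t • y) + t • x := fun x => by module
          simp only [this]
          rw [lintegral_comp_add_smul G _ (by linarith)]
          gcongr
          exact hsq t ht
      _ = 4 * volume B * ∫⁻ z, G z := by simp; ring
      _ ≤ _ := by gcongr; simp
  · calc _ ≤ ∫⁻ _ in A, 4 * ∫⁻ z, G z := by
          refine lintegral_mono fun x => (setLIntegral_le_lintegral _ _).trans ?_
          have : ∀ y : E2, y + t • (x - y) = t • x + (1 - t) • y := fun y => by module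
          simp only [this]
          rw [lintegral_comp_add_smul G _ (by linarith)]
          gcongr
          exact hsq _ (by linarith)
      _ = 4 * volume A * ∫⁻ z, G z := by simp; ring
      _ ≤ _ := by gcongr; simp

/-- For `y` in the ball the segment from `y` to `x` stays in the interior. The fundamental theorem
of calculus along it, Cauchy–Schwarz and Tonelli reduce the claim to `lintegral_comp_segment_le`. -/
lemma StarBall.lintegral_enorm_sub_sq_le (hK : StarBall K c r) {φ : E2 → ℝ}
    (hφ : ContDiff ℝ ∞ φ) :
    ∫⁻ y in Metric.ball c r, ∫⁻ x in interior K, ‖φ x - φ y‖ₑ ^ 2 ≤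
      ENNReal.ofReal (Metric.diam K) ^ 2 * (4 * (volume (Metric.ball c r) + volume (interior K)) *
        ∫⁻ z in interior K, ‖fderiv ℝ φ z‖ₑ ^ 2) := by
  have hDm : MeasurableSet (interior K) := isOpen_interior.measurableSet
  set d := ENNReal.ofReal (Metric.diam K) ^ 2 with hd
  have hdt : d ≠ ⊤ := ENNReal.pow_ne_top ENNReal.ofReal_ne_top
  set G : E2 → ENNReal := (interior K).indicator fun z => ‖fderiv ℝ φ z‖ₑ ^ 2 with hGdef
  have hfm : Measurable fun z => ‖fderiv ℝ φ z‖ₑ ^ 2 :=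
    ((hφ.continuous_fderiv (by simp)).enorm.measurable).pow_const 2
  have hG : Measurable G := hfm.indicator hDm
  have hpt : ∀ y ∈ Metric.ball c r, ∀ x ∈ interior K, ‖φ x - φ y‖ₑ ^ 2 ≤
      d * ∫⁻ t in Ioc (0 : ℝ) 1, G (y + t • (x - y)) := by
    intro y hy x hx
    refine (enorm_sub_sq_le_lintegral_fderiv hφ x y).trans ?_
    gcongr ?_ * ?_
    · exact pow_le_pow_left' (enorm_sub_le_diam hK.isCompact (interior_subset hx)
        (interior_subset (hK.ball_subset hy))) 2
    · refine setLIntegral_mono' measurableSet_Ioc fun t ht => ?_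
      rw [hGdef, indicator_of_mem (hK.homothety_mem_interior_of_interior hx hy ht.1.le ht.2)]
  have hm3 : Measurable fun p : (E2 × E2) × ℝ => G (p.1.1 + p.2 • (p.1.2 - p.1.1)) := by fun_prop
  have hm3' : Measurable fun p : E2 × ℝ × E2 => G (p.1 + p.2.1 • (p.2.2 - p.1)) := by fun_prop
  have hm3'' : Measurable fun p : (E2 × ℝ) × E2 => G (p.1.1 + p.1.2 • (p.2 - p.1.1)) := by fun_prop
  calc _ ≤ ∫⁻ y in Metric.ball c r, ∫⁻ x in interior K,
        d * ∫⁻ t in Ioc (0 : ℝ) 1, G (y + t • (x - y)) :=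
        setLIntegral_mono' measurableSet_ball fun y hy => setLIntegral_mono' hDm fun x hx =>
          hpt y hy x hx
    _ = d * ∫⁻ y in Metric.ball c r, ∫⁻ x in interior K, ∫⁻ t in Ioc (0 : ℝ) 1,
        G (y + t • (x - y)) := by
      simp_rw [lintegral_const_mul' _ _ hdt]
    _ = d * ∫⁻ y in Metric.ball c r, ∫⁻ t in Ioc (0 : ℝ) 1, ∫⁻ x in interior K,
        G (y + t • (x - y)) := by
      congr 1
      refine lintegral_congr fun y => ?_
      refine lintegral_lintegral_swap (Measurable.aemeasurable ?_)
      exact hm3.comp (f := fun p : E2 × ℝ => ((y, p.1), p.2)) (by fun_prop)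
    _ = d * ∫⁻ t in Ioc (0 : ℝ) 1, ∫⁻ y in Metric.ball c r, ∫⁻ x in interior K,
        G (y + t • (x - y)) := by
      congr 1
      exact lintegral_lintegral_swap
        (Measurable.lintegral_prod_right' (ν := volume.restrict (interior K)) hm3'').aemeasurable
    _ ≤ d * ∫⁻ _ in Ioc (0 : ℝ) 1, 4 * (volume (Metric.ball c r) + volume (interior K)) *
        ∫⁻ z, G z := by
      gcongr with t
      -- The outer variable is now the point of the ball, so the roles of the two points are
      -- exchanged and the parameter becomes `1 - t`.
      have : ∀ x y : E2, y + t • (x - y) = x + (1 - t) • (y - x) := fun x y => by module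
      simp only [this]
      exact lintegral_comp_segment_le hG _ _
    _ = _ := by
      simp [hGdef, lintegral_indicator hDm]

/-- The constant is `φ y` for some `y` in the ball at which `∫ |φ x - φ y|² dx` does not exceed its
average over the ball. The ratio of areas produces `(diam K / r) ^ 2`. -/
lemma StarBall.exists_const_l2Sq_sub_le (hK : StarBall K c r) {φ : E2 → ℝ}
    (hφ : ContDiff ℝ ∞ φ) :
    ∃ m : ℝ, l2Sq (interior K) (φ - fun _ => m) ≤
      4 * Metric.diam K ^ 2 * (1 + (Metric.diam K / r) ^ 2) * h1SemiSq (interior K) φ := by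
  have hDo : IsOpen (interior K) := isOpen_interior
  have hDm : MeasurableSet (interior K) := hDo.measurableSet
  have hDb := hK.isBounded_interior
  have hr := hK.pos
  set h := Metric.diam K with hh
  have hh0 : 0 ≤ h := Metric.diam_nonneg
  set B := Metric.ball c r with hB
  have hB0 : volume B ≠ 0 := (Metric.measure_ball_pos volume c hr).ne'
  have hBt : volume B ≠ ⊤ := measure_ball_lt_top.ne
  have hvol : volume (interior K) ≤ ENNReal.ofReal ((h / r) ^ 2) * volume B := by
    have h1 : interior K ⊆ Metric.closedBall c h := fun x hx => Metric.mem_closedBall.2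
      (Metric.dist_le_diam_of_mem hK.isCompact.isBounded (interior_subset hx)
        (interior_subset (hK.ball_subset (Metric.mem_ball_self hr))))
    refine (measure_mono h1).trans (le_of_eq ?_)
    rw [hB, Measure.addHaar_closedBall _ _ hh0, Measure.addHaar_ball _ _ hr.le, ← mul_assoc,
      ← ENNReal.ofReal_mul (by positivity)]
    congr 2
    simp only [finrank_euclideanSpace, Fintype.card_fin]
    field_simp
  have hmeas : Measurable fun p : E2 × E2 => ‖φ p.2 - φ p.1‖ₑ ^ 2 := by
    have := hφ.continuous
    have : Continuous fun p : E2 × E2 => φ p.2 - φ p.1 := by fun_prop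
    exact this.enorm.measurable.pow_const 2
  obtain ⟨y, -, hy⟩ := exists_le_setLAverage (μ := volume) (s := B) hB0 hBt
    (f := fun y => ∫⁻ x in interior K, ‖φ x - φ y‖ₑ ^ 2)
    (Measurable.lintegral_prod_right' (ν := volume.restrict (interior K)) hmeas).aemeasurable
  rw [setLAverage_eq] at hy
  refine ⟨φ y, ?_⟩
  have key : ∫⁻ x in interior K, ‖φ x - φ y‖ₑ ^ 2 ≤
      ENNReal.ofReal (4 * h ^ 2 * (1 + (h / r) ^ 2)) *
        ∫⁻ z in interior K, ‖fderiv ℝ φ z‖ₑ ^ 2 := by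
    refine hy.trans ((ENNReal.div_le_div_right (hK.lintegral_enorm_sub_sq_le hφ) _).trans ?_)
    rw [ENNReal.div_le_iff hB0 hBt]
    calc _ ≤ ENNReal.ofReal h ^ 2 * (4 * (volume B + ENNReal.ofReal ((h / r) ^ 2) * volume B) *
          ∫⁻ z in interior K, ‖fderiv ℝ φ z‖ₑ ^ 2) := by gcongr
      _ = _ := by
        rw [ENNReal.ofReal_mul (by positivity), ENNReal.ofReal_mul (by norm_num),
          ENNReal.ofReal_add (by norm_num) (by positivity), ENNReal.ofReal_pow hh0]
        simp only [ENNReal.ofReal_ofNat, ENNReal.ofReal_one]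
        ring
  have e1 : ENNReal.ofReal (l2Sq (interior K) (φ - fun _ => φ y)) =
      ∫⁻ x in interior K, ‖φ x - φ y‖ₑ ^ 2 := by
    rw [l2Sq, ofReal_integral_eq_lintegral_ofReal (integrable_norm_sq
      (memLp_of_continuous_bounded hDb (hφ.continuous.sub continuous_const) 2))
      (ae_of_all _ fun _ => by positivity)]
    refine lintegral_congr fun x => ?_
    rw [ENNReal.ofReal_pow (norm_nonneg _), ofReal_norm, Pi.sub_apply]
  have e2 : ENNReal.ofReal (h1SemiSq (interior K) φ) =
      ∫⁻ x in interior K, ‖fderiv ℝ φ x‖ₑ ^ 2 := by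
    rw [h1SemiSq, l2Sq_congr (weakGrad_of_contDiff hDo hDb hφ), l2Sq,
      ofReal_integral_eq_lintegral_ofReal (integrable_norm_sq
      (memLp_of_continuous_bounded hDb (continuous_gradient hφ) 2))
      (ae_of_all _ fun _ => by positivity)]
    refine lintegral_congr fun x => ?_
    rw [norm_gradient, ENNReal.ofReal_pow (norm_nonneg _), ofReal_norm]
  rw [← e1, ← e2, ← ENNReal.ofReal_mul (by positivity)] at key
  exact (ENNReal.ofReal_le_ofReal_iff (mul_nonneg (by positivity) (h1SemiSq_nonneg _ _))).1 key

lemma l2Sq_le_l2Sq_sub_const {U : Set E2} (hU : Bornology.IsBounded U) {w : E2 → ℝ}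
    (hw : MemLp w 2 (volume.restrict U)) (h0 : ∫ x in U, w x = 0) (m : ℝ) :
    l2Sq U w ≤ l2Sq U (w - fun _ => m) := by
  have hfin : IsFiniteMeasure (volume.restrict U) :=
    ⟨by rw [Measure.restrict_apply_univ]; exact hU.measure_lt_top⟩
  have hwi : Integrable w (volume.restrict U) := hw.integrable (by norm_num)
  have hw2 := integrable_norm_sq hw
  have : l2Sq U (w - fun _ => m) = l2Sq U w + ∫ _ in U, m ^ 2 := by
    have e : ∀ x, ‖(w - fun _ => m : E2 → ℝ) x‖ ^ 2 = ‖w x‖ ^ 2 - 2 * m * w x + m ^ 2 := fun x => by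
      simp only [Pi.sub_apply, Real.norm_eq_abs, sq_abs]; ring
    simp only [l2Sq, e]
    have i1 : Integrable (fun x => ‖w x‖ ^ 2 - 2 * m * w x) (volume.restrict U) :=
      hw2.sub (hwi.const_mul _)
    rw [integral_add i1 (integrable_const _),
      integral_sub hw2 (hwi.const_mul _), integral_const_mul, h0]
    ring
  rw [this]
  have : 0 ≤ ∫ _ in U, m ^ 2 := integral_nonneg fun _ => by positivity
  linarith

/-- Smooth approximations of `w` need not have mean zero, so the estimate with a free constant is
used for them; that constant is then dropped because `w` itself has mean zero. Two triangle
inequalities turn the factor `4` into `16`. -/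
lemma StarBall.poincare (hK : StarBall K c r) {w : E2 → ℝ} (hw : MemH1 (interior K) w)
    (h0 : ∫ x in interior K, w x = 0) :
    l2Sq (interior K) w ≤
      16 * Metric.diam K ^ 2 * (1 + (Metric.diam K / r) ^ 2) * h1SemiSq (interior K) w := by
  obtain ⟨φ, hφ, hlim⟩ := hK.exists_smooth_approx hw
  have hDo : IsOpen (interior K) := isOpen_interior
  have hDb := hK.isBounded_interior
  set C := 4 * Metric.diam K ^ 2 * (1 + (Metric.diam K / r) ^ 2) with hC
  have hC0 : 0 ≤ C := by positivity
  have hbound : ∀ n, l2Sq (interior K) w ≤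
      (2 + 4 * C) * h1NormSq (interior K) (φ n - w) + 4 * C * h1SemiSq (interior K) w := by
    intro n
    obtain ⟨m, hm⟩ := hK.exists_const_l2Sq_sub_le (hφ n)
    have hφ1 := memH1_of_contDiff hDb (hφ n)
    have hcst : MemLp (fun _ : E2 => m) 2 (volume.restrict (interior K)) :=
      memLp_of_continuous_bounded hDb continuous_const 2
    have b1 := l2Sq_le_l2Sq_sub_const hDb hw.1 h0 m
    have b2 : l2Sq (interior K) (w - fun _ => m) ≤
        2 * (l2Sq (interior K) (φ n - fun _ => m) + l2Sq (interior K) (φ n - w)) := by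
      rw [show (w - fun _ => m) = (φ n - fun _ => m) - (φ n - w) by abel]
      exact l2Sq_sub_le (hφ1.1.sub hcst) (hφ1.1.sub hw.1)
    have b3 : h1SemiSq (interior K) (φ n) ≤
        2 * (h1SemiSq (interior K) w + h1SemiSq (interior K) (φ n - w)) := by
      rw [h1SemiSq_sub_comm hDo hφ1 hw]
      nth_rewrite 1 [show φ n = w - (w - φ n) by abel]
      exact h1SemiSq_sub_le hDo hw (hw.sub hφ1)
    have b4 := mul_le_mul_of_nonneg_left b3 hC0
    have b5 := mul_nonneg hC0 (l2Sq_nonneg (interior K) (φ n - w))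
    have b6 := h1SemiSq_nonneg (interior K) (φ n - w)
    simp only [h1NormSq]
    nlinarith
  have ht : Tendsto (fun n => (2 + 4 * C) * h1NormSq (interior K) (φ n - w) +
      4 * C * h1SemiSq (interior K) w) atTop (𝓝 (4 * C * h1SemiSq (interior K) w)) := by
    simpa using (hlim.const_mul (2 + 4 * C)).add_const (4 * C * h1SemiSq (interior K) w)
  have := ge_of_tendsto' ht hbound
  rw [hC] at this
  linarith

end Poincare

end NCVEM

namespace NCVEM

/-! ### Integration over triangles -/

section Triangle

/-- The determinant of two plane vectors. -/
def cross (p q : E2) : ℝ := p 0 * q 1 - p 1 * q 0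

/-- Cramer's rule, in a form that remains valid for dependent vectors. -/
lemma cross_decomp (p q g : E2) :
    cross p q • g = cross g q • p + cross p g • q := by
  ext i
  fin_cases i <;> simp [cross] <;> ring

/-- Affine parametrization of the plane through the triangle with the vertices `c`, `a`, `b`. -/
noncomputable def tri (c a b : E2) (p : ℝ × ℝ) : E2 := c + (p.1 • (a - c) + p.2 • (b - a))

/-- The open triangle with the apex `c` over the segment from `a` to `b`. -/
def openTri (c a b : E2) : Set E2 :=
  {x | ∃ s ∈ Ioo (0 : ℝ) 1, ∃ t ∈ Ioo (0 : ℝ) 1, x = c + s • (AffineMap.lineMap a b t - c)}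

lemma lineMap_sub_eq (a b c : E2) (t : ℝ) :
    AffineMap.lineMap a b t - c = (a - c) + t • (b - a) := by
  rw [AffineMap.lineMap_apply, vsub_eq_sub, vadd_eq_add]; abel

lemma image_tri (c a b : E2) :
    tri c a b '' regionBetween (fun _ => 0) id (Ioo (0 : ℝ) 1) = openTri c a b := by
  ext x
  constructor
  · rintro ⟨⟨s, τ⟩, ⟨hs, hτ⟩, rfl⟩
    simp only [id, mem_Ioo] at hs hτ
    refine ⟨s, hs, τ / s, ⟨div_pos hτ.1 hs.1, (div_lt_one hs.1).2 hτ.2⟩, ?_⟩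
    rw [lineMap_sub_eq, smul_add, smul_smul, mul_div_cancel₀ _ hs.1.ne']
    rfl
  · rintro ⟨s, hs, t, ht, rfl⟩
    refine ⟨(s, s * t), ⟨hs, ?_⟩, ?_⟩
    · exact ⟨mul_pos hs.1 ht.1, by simpa using mul_lt_mul_of_pos_left ht.2 hs.1⟩
    · rw [lineMap_sub_eq, smul_add, smul_smul]
      rfl

lemma tri_eq_comp (c a b : E2) : tri c a b = (c + ·) ∘
    (Matrix.toLpLin 2 2 !![(a - c) 0, (b - a) 0; (a - c) 1, (b - a) 1]) ∘
    (MeasurableEquiv.toLp 2 (Fin 2 → ℝ)) ∘ MeasurableEquiv.finTwoArrow.symm := by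
  ext p i
  fin_cases i <;> simp [tri, Matrix.toLpLin]

lemma map_tri {c a b : E2} (hJ : cross (a - c) (b - a) ≠ 0) :
    Measure.map (tri c a b) volume =
      ENNReal.ofReal |(cross (a - c) (b - a))⁻¹| • (volume : Measure E2) := by
  have hdet : LinearMap.det (Matrix.toLpLin 2 2 !![(a - c) 0, (b - a) 0; (a - c) 1, (b - a) 1]) =
      cross (a - c) (b - a) := by
    rw [LinearMap.det_toLpLin, Matrix.det_fin_two_of, cross]; ring
  have h1 : MeasurePreserving ((MeasurableEquiv.toLp 2 (Fin 2 → ℝ)) ∘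
      MeasurableEquiv.finTwoArrow.symm) (volume : Measure (ℝ × ℝ)) (volume : Measure E2) :=
    ((EuclideanSpace.volume_preserving_symm_measurableEquiv_toLp (Fin 2)).symm _).comp
      ((volume_preserving_finTwoArrow ℝ).symm _)
  have hLm : Measurable
      (Matrix.toLpLin 2 2 !![(a - c) 0, (b - a) 0; (a - c) 1, (b - a) 1] : E2 →ₗ[ℝ] E2) :=
    (LinearMap.continuous_of_finiteDimensional _).measurable
  rw [tri_eq_comp, ← Measure.map_map (measurable_const_add c) (hLm.comp h1.measurable),
    ← Measure.map_map hLm h1.measurable, h1.map_eq,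
    Measure.map_linearMap_addHaar_eq_smul_addHaar volume (by rwa [hdet]), hdet,
    Measure.map_smul, map_add_left_eq_self]

lemma tri_injective {c a b : E2} (hJ : cross (a - c) (b - a) ≠ 0) :
    Function.Injective (tri c a b) := by
  intro p q h
  have h' : (p.1 - q.1) • (a - c) + (p.2 - q.2) • (b - a) = 0 := by
    have := sub_eq_zero.2 h
    simp only [tri] at this
    rw [← this]; module
  have e0 := congrArg (fun v : E2 => v 0) h'
  have e1 := congrArg (fun v : E2 => v 1) h'
  simp only [PiLp.add_apply, PiLp.smul_apply, smul_eq_mul, PiLp.zero_apply] at e0 e1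
  have k1 : (p.1 - q.1) * cross (a - c) (b - a) = 0 := by
    rw [cross]
    linear_combination (b - a) 1 * e0 - (b - a) 0 * e1
  have k2 : (p.2 - q.2) * cross (a - c) (b - a) = 0 := by
    rw [cross]
    linear_combination (a - c) 0 * e1 - (a - c) 1 * e0
  refine Prod.ext ?_ ?_
  · exact sub_eq_zero.1 ((mul_eq_zero.1 k1).resolve_right hJ)
  · exact sub_eq_zero.1 ((mul_eq_zero.1 k2).resolve_right hJ)

lemma continuous_tri (c a b : E2) : Continuous (tri c a b) := by
  unfold tri; fun_prop

lemma measurableEmbedding_tri {c a b : E2} (hJ : cross (a - c) (b - a) ≠ 0) :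
    MeasurableEmbedding (tri c a b) :=
  (continuous_tri c a b).measurableEmbedding (tri_injective hJ)

lemma measurableSet_openTri {c a b : E2} (hJ : cross (a - c) (b - a) ≠ 0) :
    MeasurableSet (openTri c a b) := by
  rw [← image_tri]
  exact (measurableEmbedding_tri hJ).measurableSet_image.2
    (measurableSet_regionBetween measurable_const measurable_id measurableSet_Ioo)

lemma intervalIntegral_swap {F : ℝ → ℝ → ℝ} (hF : Continuous (Function.uncurry F)) :
    ∫ s in (0 : ℝ)..1, ∫ t in (0 : ℝ)..1, F s t = ∫ t in (0 : ℝ)..1, ∫ s in (0 : ℝ)..1, F s t := by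
  simp only [intervalIntegral.integral_of_le zero_le_one]
  refine integral_integral_swap ?_
  rw [Measure.prod_restrict]
  exact (hF.continuousOn.integrableOn_compact (isCompact_Icc.prod isCompact_Icc)).mono_set
    (prod_mono Ioc_subset_Icc_self Ioc_subset_Icc_self)

/-- Fubini on the triangle `0 < τ < s < 1`, followed by `τ = s t`: these are polar coordinates
adapted to the edge, with the weight `s` vanishing at the apex. -/
lemma integral_openTri {c a b : E2} (hJ : cross (a - c) (b - a) ≠ 0) {F : E2 → ℝ}
    (hF : Continuous F) :
    ∫ x in openTri c a b, F x = |cross (a - c) (b - a)| *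
      ∫ s in (0 : ℝ)..1, ∫ t in (0 : ℝ)..1, s * F (c + s • (AffineMap.lineMap a b t - c)) := by
  set R : Set (ℝ × ℝ) := regionBetween (fun _ => 0) id (Ioo (0 : ℝ) 1) with hR
  have hRm : MeasurableSet R :=
    measurableSet_regionBetween measurable_const measurable_id measurableSet_Ioo
  have hG : Continuous (F ∘ tri c a b) := hF.comp (continuous_tri c a b)
  have h1 : |cross (a - c) (b - a)|⁻¹ * ∫ x in openTri c a b, F x = ∫ p in R, F (tri c a b p) := by
    have := (measurableEmbedding_tri hJ).setIntegral_map (μ := volume) F (openTri c a b)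
    rw [map_tri hJ, Measure.restrict_smul, integral_smul_measure, ← image_tri,
      preimage_image_eq _ (tri_injective hJ), ENNReal.toReal_ofReal (abs_nonneg _), abs_inv,
      smul_eq_mul] at this
    rw [← image_tri]
    exact this
  have hRi : IntegrableOn (fun p => F (tri c a b p)) R := by
    refine (hG.continuousOn.integrableOn_compact ((isCompact_Icc (a := (0 : ℝ)) (b := 1)).prod
      (isCompact_Icc (a := (0 : ℝ)) (b := 1)))).mono_set ?_
    rintro ⟨s, τ⟩ ⟨hs, hτ⟩
    simp only [id, mem_Ioo] at hs hτ
    exact ⟨⟨hs.1.le, hs.2.le⟩, ⟨hτ.1.le, by simp only; linarith⟩⟩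
  have h2 : ∫ p in R, F (tri c a b p) =
      ∫ s in (0 : ℝ)..1, ∫ t in (0 : ℝ)..1, s * F (c + s • (AffineMap.lineMap a b t - c)) := by
    rw [← integral_indicator hRm, Measure.volume_eq_prod,
      integral_prod _ ((integrable_indicator_iff hRm).2 hRi),
      intervalIntegral.integral_of_le zero_le_one, integral_Ioc_eq_integral_Ioo,
      ← integral_indicator measurableSet_Ioo]
    congr 1; ext s
    by_cases hs : s ∈ Ioo (0 : ℝ) 1
    · rw [indicator_of_mem hs, intervalIntegral.integral_const_mul]
      have := intervalIntegral.smul_integral_comp_mul_left (a := 0) (b := 1)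
        (fun τ => F (tri c a b (s, τ))) s
      simp only [smul_eq_mul, mul_zero, mul_one] at this
      have e : ∀ t, F (c + s • (AffineMap.lineMap a b t - c)) = F (tri c a b (s, s * t)) := by
        intro t
        rw [lineMap_sub_eq, smul_add, smul_smul]; rfl
      simp only [e]
      rw [this, intervalIntegral.integral_of_le hs.1.le, integral_Ioc_eq_integral_Ioo,
        ← integral_indicator measurableSet_Ioo]
      congr 1; ext τ
      by_cases hτ : τ ∈ Ioo 0 s
      · rw [indicator_of_mem hτ, indicator_of_mem (show (s, τ) ∈ R from ⟨hs, hτ⟩)]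
      · rw [indicator_of_notMem hτ, indicator_of_notMem (fun h : (s, τ) ∈ R => hτ h.2)]
    · rw [indicator_of_notMem hs]
      have : ∀ τ, R.indicator (fun p => F (tri c a b p)) (s, τ) = 0 := fun τ =>
        indicator_of_notMem (fun h => hs h.1) _
      simp [this]
  rw [← h2, ← h1, mul_inv_cancel_left₀ (abs_pos.2 hJ).ne']

lemma hasDerivAt_comp_ray {φ : E2 → ℝ} (hφ : ContDiff ℝ ∞ φ) (c d : E2) (s : ℝ) :
    HasDerivAt (fun s : ℝ => φ (c + s • d)) (fderiv ℝ φ (c + s • d) d) s := by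
  have h1 : HasDerivAt (fun t : ℝ => c + t • d) d s := by
    simpa using ((hasDerivAt_id s).smul_const d).const_add c
  exact (hφ.differentiable (by simp) _).hasFDerivAt.comp_hasDerivAt s h1

lemma hasDerivAt_comp_lineMap {φ : E2 → ℝ} (hφ : ContDiff ℝ ∞ φ) (c a b : E2) (s t : ℝ) :
    HasDerivAt (fun t : ℝ => φ (c + s • (AffineMap.lineMap a b t - c)))
      (s * fderiv ℝ φ (c + s • (AffineMap.lineMap a b t - c)) (b - a)) t := by
  have e : ∀ t : ℝ, c + s • (AffineMap.lineMap a b t - c) =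
      (c + s • (a - c)) + t • (s • (b - a)) := fun t => by
    rw [lineMap_sub_eq]; module
  simp only [e]
  have := hasDerivAt_comp_ray hφ (c + s • (a - c)) (s • (b - a)) t
  rwa [map_smul, smul_eq_mul] at this

/-- Fundamental theorem of calculus for `s ^ 2 * φ (c + s • d) ^ 2`. The factor `s ^ 2` removes the
value at the apex and leaves in the derivative the weight `s` of `integral_openTri`. -/
lemma trace_ray_le {φ : E2 → ℝ} (hφ : ContDiff ℝ ∞ φ) (c d : E2) {h : ℝ} (hd : ‖d‖ ≤ h) :
    φ (c + d) ^ 2 ≤ ∫ s in (0 : ℝ)..1, s * (3 * φ (c + s • d) ^ 2 +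
      h ^ 2 * ‖gradient φ (c + s • d)‖ ^ 2) := by
  have hray : Continuous fun s : ℝ => c + s • d := by fun_prop
  have hφc : Continuous fun s : ℝ => φ (c + s • d) := hφ.continuous.comp hray
  have hgc : Continuous fun s : ℝ => gradient φ (c + s • d) := (continuous_gradient hφ).comp hray
  have hfc : Continuous fun s : ℝ => fderiv ℝ φ (c + s • d) d :=
    (continuous_fderiv_apply hφ d).comp hray
  have hder : ∀ s : ℝ, HasDerivAt (fun s : ℝ => s ^ 2 * φ (c + s • d) ^ 2)
      (2 * s * φ (c + s • d) ^ 2 +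
        s ^ 2 * (2 * φ (c + s • d) * fderiv ℝ φ (c + s • d) d)) s := by
    intro s
    have h1 := (hasDerivAt_pow 2 s).mul ((hasDerivAt_comp_ray hφ c d s).pow 2)
    refine h1.congr_deriv ?_
    simp
  have hint := intervalIntegral.integral_eq_sub_of_hasDerivAt (a := 0) (b := 1)
    (fun s _ => hder s) (Continuous.intervalIntegrable (by fun_prop) _ _)
  simp only [one_pow, one_smul, one_mul, ne_eq, OfNat.ofNat_ne_zero, not_false_eq_true, zero_pow,
    zero_mul, sub_zero] at hint
  rw [← hint]
  refine intervalIntegral.integral_mono_on zero_le_one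
    (Continuous.intervalIntegrable (by fun_prop) _ _)
    (Continuous.intervalIntegrable (by fun_prop) _ _) fun s hs => ?_
  have hb : |fderiv ℝ φ (c + s • d) d| ≤ h * ‖gradient φ (c + s • d)‖ := by
    rw [norm_gradient, ← Real.norm_eq_abs, mul_comm]
    exact (ContinuousLinearMap.le_opNorm _ _).trans (by gcongr)
  set q := φ (c + s • d)
  set D := fderiv ℝ φ (c + s • d) d
  set g := ‖gradient φ (c + s • d)‖
  have h1 : 2 * q * D ≤ q ^ 2 + h ^ 2 * g ^ 2 := by
    have : D ^ 2 ≤ (h * g) ^ 2 := sq_le_sq.2 (by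
      rw [abs_of_nonneg (le_trans (abs_nonneg _) hb)]; exact hb)
    nlinarith [sq_nonneg (q - D)]
  have h2 : s ^ 2 ≤ s := by nlinarith [hs.1, hs.2]
  have h3 : s ^ 2 * (2 * q * D) ≤ s * (q ^ 2 + h ^ 2 * g ^ 2) := by
    calc s ^ 2 * (2 * q * D) ≤ s ^ 2 * (q ^ 2 + h ^ 2 * g ^ 2) := by gcongr
      _ ≤ _ := by gcongr
  nlinarith [h3]

lemma integral_lineMap_sq_le {c a b : E2} (hJ : cross (a - c) (b - a) ≠ 0) {φ : E2 → ℝ}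
    (hφ : ContDiff ℝ ∞ φ) {h : ℝ} (hd : ∀ t ∈ Icc (0 : ℝ) 1, ‖AffineMap.lineMap a b t - c‖ ≤ h) :
    |cross (a - c) (b - a)| * ∫ t in (0 : ℝ)..1, φ (AffineMap.lineMap a b t) ^ 2 ≤
      ∫ x in openTri c a b, (3 * φ x ^ 2 + h ^ 2 * ‖gradient φ x‖ ^ 2) := by
  have hφc := hφ.continuous
  have hgc := continuous_gradient hφ
  have hlc : Continuous fun t : ℝ => (AffineMap.lineMap a b t : E2) :=
    AffineMap.lineMap_continuous
  have hpc : Continuous fun p : ℝ × ℝ => c + p.1 • (AffineMap.lineMap a b p.2 - c : E2) := by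
    have := hlc.comp continuous_snd (X := ℝ × ℝ)
    exact continuous_const.add (continuous_fst.smul (this.sub continuous_const))
  have hHc : Continuous fun x : E2 => 3 * φ x ^ 2 + h ^ 2 * ‖gradient φ x‖ ^ 2 := by fun_prop
  have hFc : Continuous (Function.uncurry fun s t : ℝ =>
      s * (3 * φ (c + s • (AffineMap.lineMap a b t - c)) ^ 2 +
        h ^ 2 * ‖gradient φ (c + s • (AffineMap.lineMap a b t - c))‖ ^ 2)) :=
    continuous_fst.mul (hHc.comp hpc)
  rw [integral_openTri hJ hHc, intervalIntegral_swap hFc]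
  refine mul_le_mul_of_nonneg_left ?_ (abs_nonneg _)
  refine intervalIntegral.integral_mono_on zero_le_one
    (Continuous.intervalIntegrable (by fun_prop) _ _) ?_ fun t ht => ?_
  · refine Continuous.intervalIntegrable ?_ _ _
    exact intervalIntegral.continuous_parametric_intervalIntegral_of_continuous'
      (f := fun t s => s * (3 * φ (c + s • (AffineMap.lineMap a b t - c)) ^ 2 +
        h ^ 2 * ‖gradient φ (c + s • (AffineMap.lineMap a b t - c))‖ ^ 2))
      (hFc.comp continuous_swap) 0 1
  · simpa using trace_ray_le hφ c (AffineMap.lineMap a b t - c) (hd t ht)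

/-- Green's formula on a triangle, with the two sides at the apex left as boundary terms. -/
lemma integral_openTri_fderiv {c a b : E2} (hJ : cross (a - c) (b - a) ≠ 0) {φ : E2 → ℝ}
    (hφ : ContDiff ℝ ∞ φ) (g : E2) :
    cross (a - c) (b - a) * ∫ x in openTri c a b, fderiv ℝ φ x g =
      |cross (a - c) (b - a)| * (cross g (b - a) * (∫ t in (0 : ℝ)..1, φ (AffineMap.lineMap a b t)) +
        (cross (b - c) g * ∫ s in (0 : ℝ)..1, φ (c + s • (b - c))) -
        cross (a - c) g * ∫ s in (0 : ℝ)..1, φ (c + s • (a - c))) := by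
  have hφc := hφ.continuous
  have hlc : Continuous fun t : ℝ => (AffineMap.lineMap a b t : E2) :=
    AffineMap.lineMap_continuous
  have hpc : Continuous fun p : ℝ × ℝ => c + p.1 • (AffineMap.lineMap a b p.2 - c : E2) := by
    have := hlc.comp continuous_snd (X := ℝ × ℝ)
    exact continuous_const.add (continuous_fst.smul (this.sub continuous_const))
  rw [integral_openTri hJ (continuous_fderiv_apply hφ g), mul_left_comm]
  congr 1
  set e : ℝ → E2 := fun t => AffineMap.lineMap a b t with he
  set q : ℝ → ℝ → ℝ := fun s t => φ (c + s • (e t - c)) with hq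
  set qs : ℝ → ℝ → ℝ := fun s t => fderiv ℝ φ (c + s • (e t - c)) (e t - c) with hqs
  set qt : ℝ → ℝ → ℝ := fun s t => s * fderiv ℝ φ (c + s • (e t - c)) (b - a) with hqt
  -- By Cramer's rule `g` is split into the radial direction `e t - c` and the edge direction `b -
  -- a`; `w t` is the coefficient of the latter before division by the determinant, which is
  -- independent of `t`.
  set w : ℝ → ℝ := fun t => cross (e t - c) g with hw
  have hwe : ∀ t, w t = cross (a - c) g + t * cross (b - a) g := fun t => by
    simp only [hw, he, lineMap_sub_eq, cross, PiLp.add_apply, PiLp.smul_apply, smul_eq_mul]; ring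
  have hqc : Continuous (Function.uncurry q) := hφc.comp hpc
  have hfc := hφ.continuous_fderiv (by simp)
  have hqsc : Continuous (Function.uncurry qs) :=
    (hfc.comp hpc).clm_apply ((hlc.comp continuous_snd).sub continuous_const)
  have hqtc : Continuous (Function.uncurry qt) :=
    continuous_fst.mul ((hfc.comp hpc).clm_apply continuous_const)
  have hwc : Continuous w := by rw [funext hwe]; fun_prop
  -- pointwise decomposition
  have hpt : ∀ s t, cross (a - c) (b - a) * (s * fderiv ℝ φ (c + s • (e t - c)) g) =
      cross g (b - a) * (s * qs s t) + w t * qt s t := by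
    intro s t
    have h1 := cross_decomp (e t - c) (b - a) g
    have h2 : cross (e t - c) (b - a) = cross (a - c) (b - a) := by
      simp only [he, lineMap_sub_eq, cross, PiLp.add_apply, PiLp.smul_apply, smul_eq_mul]; ring
    rw [h2] at h1
    have h3 := congrArg (fderiv ℝ φ (c + s • (e t - c))) h1
    simp only [map_add, map_smul, smul_eq_mul] at h3
    simp only [hqs, hqt, hw]
    linear_combination s * h3
  have hI : ∀ {f : ℝ → ℝ → ℝ}, Continuous (Function.uncurry f) → ∀ s,
      IntervalIntegrable (f s) volume 0 1 := fun hf s =>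
    (hf.comp (continuous_const.prodMk continuous_id) (X := ℝ)
      (f := fun t => (s, t))).intervalIntegrable _ _
  have hI' : ∀ {f : ℝ → ℝ → ℝ}, Continuous (Function.uncurry f) → ∀ t,
      IntervalIntegrable (fun s => f s t) volume 0 1 := fun hf t =>
    (hf.comp (continuous_id.prodMk continuous_const) (X := ℝ)
      (f := fun s => (s, t))).intervalIntegrable _ _
  have hO : ∀ {f : ℝ → ℝ → ℝ}, Continuous (Function.uncurry f) →
      IntervalIntegrable (fun s => ∫ t in (0 : ℝ)..1, f s t) volume 0 1 := fun hf =>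
    (intervalIntegral.continuous_parametric_intervalIntegral_of_continuous' hf 0 1).intervalIntegrable
      _ _
  have hsq : Continuous (Function.uncurry fun s t => s * qs s t) := continuous_fst.mul hqsc
  have hwq : Continuous (Function.uncurry fun s t => w t * qt s t) :=
    (hwc.comp continuous_snd).mul hqtc
  have hlhs : cross (a - c) (b - a) * ∫ s in (0 : ℝ)..1, ∫ t in (0 : ℝ)..1,
      s * fderiv ℝ φ (c + s • (e t - c)) g =
      cross g (b - a) * (∫ s in (0 : ℝ)..1, ∫ t in (0 : ℝ)..1, s * qs s t) +
        ∫ s in (0 : ℝ)..1, ∫ t in (0 : ℝ)..1, w t * qt s t := by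
    simp only [← intervalIntegral.integral_const_mul, hpt]
    rw [← intervalIntegral.integral_add]
    · congr 1; ext s
      rw [intervalIntegral.integral_add]
      · exact ((hI hsq s).const_mul _)
      · exact hI hwq s
    · exact hO (f := fun s t => cross g (b - a) * (s * qs s t)) (continuous_const.mul hsq)
    · exact hO hwq
  -- Integration by parts along the rays: the boundary term at the apex vanishes and the one on the
  -- edge remains.
  have h1 : ∫ s in (0 : ℝ)..1, ∫ t in (0 : ℝ)..1, s * qs s t =
      (∫ t in (0 : ℝ)..1, φ (e t)) - ∫ s in (0 : ℝ)..1, ∫ t in (0 : ℝ)..1, q s t := by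
    rw [intervalIntegral_swap hsq, intervalIntegral_swap hqc, ← intervalIntegral.integral_sub]
    · congr 1; ext t
      have hd : ∀ s, HasDerivAt (fun s => s * q s t) (1 * q s t + s * qs s t) s := fun s =>
        (hasDerivAt_id s).mul (hasDerivAt_comp_ray hφ c (e t - c) s)
      have := intervalIntegral.integral_eq_sub_of_hasDerivAt (a := 0) (b := 1)
        (fun s _ => hd s) (((hI' hqc t).const_mul 1).add (hI' hsq t))
      rw [intervalIntegral.integral_add ((hI' hqc t).const_mul 1) (hI' hsq t)] at this
      simp only [one_mul, zero_mul, sub_zero, hq, one_smul, add_sub_cancel] at this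
      simp only [hq]
      linarith
    · exact (hφc.comp hlc).intervalIntegrable _ _
    · exact hO (f := fun t s => q s t) (hqc.comp continuous_swap)
  -- Integration by parts parallel to the edge yields the two sides at the apex. Its remaining area
  -- integral cancels the one from `h1`, by antisymmetry of `cross`.
  have h2 : ∫ s in (0 : ℝ)..1, ∫ t in (0 : ℝ)..1, w t * qt s t =
      (cross (b - c) g * ∫ s in (0 : ℝ)..1, φ (c + s • (b - c))) -
        (cross (a - c) g * ∫ s in (0 : ℝ)..1, φ (c + s • (a - c))) -
        cross (b - a) g * ∫ s in (0 : ℝ)..1, ∫ t in (0 : ℝ)..1, q s t := by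
    simp only [← intervalIntegral.integral_const_mul]
    have c1 : ∀ d : E2, Continuous fun s : ℝ => φ (c + s • d) := fun d => by fun_prop
    rw [← intervalIntegral.integral_sub (((c1 _).intervalIntegrable _ _).const_mul _)
      (((c1 _).intervalIntegrable _ _).const_mul _), ← intervalIntegral.integral_sub]
    · congr 1; ext s
      have hd : ∀ t, HasDerivAt (fun t => w t * q s t)
          (cross (b - a) g * q s t + w t * qt s t) t := fun t => by
        have hw' : HasDerivAt w (cross (b - a) g) t := by
          rw [funext hwe]
          simpa using ((hasDerivAt_id t).mul_const (cross (b - a) g)).const_add (cross (a - c) g)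
        exact hw'.mul (hasDerivAt_comp_lineMap hφ c a b s t)
      have := intervalIntegral.integral_eq_sub_of_hasDerivAt (a := 0) (b := 1)
        (fun t _ => hd t) (((hI hqc s).const_mul _).add (hI hwq s))
      rw [intervalIntegral.integral_add ((hI hqc s).const_mul _) (hI hwq s)] at this
      simp only [hq, hw, he, AffineMap.lineMap_apply_one, AffineMap.lineMap_apply_zero] at this ⊢
      linarith
    · exact (((c1 _).const_smul (cross (b - c) g)).sub
        ((c1 _).const_smul (cross (a - c) g))).intervalIntegrable _ _
    · exact hO (f := fun s t => cross (b - a) g * q s t) (continuous_const.mul hqc)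
  have hanti : cross g (b - a) = -cross (b - a) g := by simp only [cross]; ring
  rw [hlhs, h1, h2, hanti]
  ring

end Triangle

end NCVEM

namespace NCVEM

/-! ### Edges of star-shaped sets and the trace inequality -/

namespace StarBall

variable {K : Set E2} {c : E2} {r : ℝ} {a b : E2}

lemma norm_sq_eq_coords (x : E2) : ‖x‖ ^ 2 = x 0 ^ 2 + x 1 ^ 2 := by
  rw [EuclideanSpace.norm_sq_eq, Fin.sum_univ_two]
  simp

/-- The right-hand side is `dist a b` times the distance of `c` from the line through the edge. Were
that distance below `r`, the foot `y` of the perpendicular would lie in the ball. Then either `y` is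
on the edge, or one endpoint lies strictly between `y` and the other endpoint; in both cases a point
of the edge would be interior. -/
lemma mul_dist_le_cross (hK : StarBall K c r) (hab : a ≠ b)
    (hE : segment ℝ a b ⊆ frontier K) : r * dist a b ≤ |cross (a - c) (b - a)| := by
  by_contra hlt
  push Not at hlt
  have hn : 0 < ‖b - a‖ := norm_pos_iff.2 (sub_ne_zero.2 hab.symm)
  rw [dist_comm, dist_eq_norm] at hlt
  have hn2 : 0 < ‖b - a‖ ^ 2 := by positivity
  set τ : ℝ := ((c - a) 0 * (b - a) 0 + (c - a) 1 * (b - a) 1) / ‖b - a‖ ^ 2 with hτ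
  set y : E2 := a + τ • (b - a) with hy
  have hτn : τ * ((b - a) 0 ^ 2 + (b - a) 1 ^ 2) =
      (c - a) 0 * (b - a) 0 + (c - a) 1 * (b - a) 1 := by
    rw [← norm_sq_eq_coords, hτ, div_mul_cancel₀ _ hn2.ne']
  have hyn : ‖y - c‖ ^ 2 * ‖b - a‖ ^ 2 = cross (a - c) (b - a) ^ 2 := by
    rw [norm_sq_eq_coords, norm_sq_eq_coords]
    simp only [hy, cross, PiLp.add_apply, PiLp.sub_apply, PiLp.smul_apply, smul_eq_mul] at hτn ⊢
    linear_combination (τ * ((b 0 - a 0) ^ 2 + (b 1 - a 1) ^ 2) -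
      ((c 0 - a 0) * (b 0 - a 0) + (c 1 - a 1) * (b 1 - a 1))) * hτn
  have hyb : y ∈ Metric.ball c r := by
    rw [Metric.mem_ball, dist_eq_norm]
    have h1 : (‖y - c‖ * ‖b - a‖) ^ 2 < (r * ‖b - a‖) ^ 2 := by
      rw [mul_pow, hyn, ← sq_abs]
      exact pow_lt_pow_left₀ hlt (abs_nonneg _) two_ne_zero
    have h2 := lt_of_pow_lt_pow_left₀ 2 (mul_nonneg hK.pos.le hn.le) h1
    exact lt_of_mul_lt_mul_right h2 hn.le
  have haK := hE (left_mem_segment ℝ a b)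
  have hbK := hE (right_mem_segment ℝ a b)
  rcases lt_or_ge τ 0 with h0 | h0
  · have := hK.homothety_mem_interior (hK.frontier_subset hbK) hyb (l := -τ / (1 - τ))
      (div_nonneg (by linarith) (by linarith)) ((div_lt_one (by linarith)).2 (by linarith))
    refine haK.2 ?_
    convert this using 1
    have h1 : b - y = (1 - τ) • (b - a) := by rw [hy]; module
    rw [h1, smul_smul, div_mul_cancel₀ _ (by linarith), hy]
    module
  · rcases le_or_gt τ 1 with h1 | h1
    · refine (hE ?_).2 (hK.ball_subset hyb)
      rw [segment_eq_image']
      exact ⟨τ, ⟨h0, h1⟩, rfl⟩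
    · have := hK.homothety_mem_interior (hK.frontier_subset haK) hyb (l := (τ - 1) / τ)
        (div_nonneg (by linarith) (by linarith)) ((div_lt_one (by linarith)).2 (by linarith))
      refine hbK.2 ?_
      convert this using 1
      have h2 : a - y = τ • (a - b) := by rw [hy]; module
      rw [h2, smul_smul, div_mul_cancel₀ _ (by linarith), hy]
      module

lemma cross_ne_zero (hK : StarBall K c r) (hab : a ≠ b)
    (hE : segment ℝ a b ⊆ frontier K) : cross (a - c) (b - a) ≠ 0 :=
  abs_pos.1 ((mul_pos hK.pos (dist_pos.2 hab)).trans_le (hK.mul_dist_le_cross hab hE))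

lemma lineMap_mem_segment {t : ℝ} (ht : t ∈ Icc (0 : ℝ) 1) :
    (AffineMap.lineMap a b t : E2) ∈ segment ℝ a b := by
  rw [segment_eq_image_lineMap]
  exact mem_image_of_mem _ ht

lemma openTri_subset (hK : StarBall K c r) (hE : segment ℝ a b ⊆ frontier K) :
    openTri c a b ⊆ interior K := by
  rintro x ⟨s, hs, t, ht, rfl⟩
  exact hK.homothety_mem_interior
    (hK.frontier_subset (hE (lineMap_mem_segment ⟨ht.1.le, ht.2.le⟩)))
    (Metric.mem_ball_self hK.pos) hs.1.le hs.2

/-- The triangle over the edge lies in `K` and has height at least `r`, so the weighted ray estimate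
transfers to the edge with the factor `r⁻¹`. -/
lemma edgeInt_sq_le_of_contDiff (hK : StarBall K c r) (hab : a ≠ b)
    (hE : segment ℝ a b ⊆ frontier K) {φ : E2 → ℝ} (hφ : ContDiff ℝ ∞ φ) :
    edgeInt a b (fun x => φ x ^ 2) ≤
      r⁻¹ * (3 * l2Sq (interior K) φ + Metric.diam K ^ 2 * h1SemiSq (interior K) φ) := by
  have hDb := hK.isBounded_interior
  have hr := hK.pos
  have hJ := hK.cross_ne_zero hab hE
  set h := Metric.diam K
  have hd : ∀ t ∈ Icc (0 : ℝ) 1, ‖AffineMap.lineMap a b t - c‖ ≤ h := fun t ht => by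
    rw [← dist_eq_norm]
    exact Metric.dist_le_diam_of_mem hK.isCompact.isBounded
      (hK.frontier_subset (hE (lineMap_mem_segment ht)))
      (interior_subset (hK.ball_subset (Metric.mem_ball_self hr)))
  have h1 := integral_lineMap_sq_le hJ hφ hd
  have hi1 := integrable_norm_sq (memLp_of_continuous_bounded hDb hφ.continuous 2)
  have hi2 := integrable_norm_sq (memLp_of_continuous_bounded hDb (continuous_gradient hφ) 2)
  have hi1' : IntegrableOn (fun x => φ x ^ 2) (interior K) := by
    simpa [IntegrableOn] using hi1
  have h2 : ∫ x in openTri c a b, (3 * φ x ^ 2 + h ^ 2 * ‖gradient φ x‖ ^ 2) ≤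
      3 * l2Sq (interior K) φ + h ^ 2 * h1SemiSq (interior K) φ := by
    rw [h1SemiSq, l2Sq_congr (weakGrad_of_contDiff isOpen_interior hDb hφ), l2Sq, l2Sq,
      ← integral_const_mul, ← integral_const_mul, ← integral_add (hi1.const_mul _)
      (hi2.const_mul _)]
    simp only [Real.norm_eq_abs, sq_abs]
    exact setIntegral_mono_set ((hi1'.const_mul 3).add (hi2.const_mul _))
      (ae_of_all _ fun x => by positivity) (hK.openTri_subset hE).eventuallyLE
  set I := ∫ t in (0 : ℝ)..1, φ (AffineMap.lineMap a b t) ^ 2 with hI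
  have hI0 : 0 ≤ I := intervalIntegral.integral_nonneg zero_le_one fun t _ => by positivity
  have h3 : r * dist a b * I ≤ |cross (a - c) (b - a)| * I :=
    mul_le_mul_of_nonneg_right (hK.mul_dist_le_cross hab hE) hI0
  rw [edgeInt, inv_mul_eq_div, le_div_iff₀ hr]
  change dist a b * I * r ≤ _
  linarith

end StarBall

/-! ### Traces -/

section Trace

variable {a b : E2}

/-- The restriction of `τ` to the segment from `a` to `b` is square integrable. -/
def MemEdge (a b : E2) (τ : E2 → ℝ) : Prop :=
  MemLp (fun t : ℝ => τ (AffineMap.lineMap a b t)) 2 (volume.restrict (Icc (0 : ℝ) 1))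

lemma edgeInt_eq (a b : E2) (g : E2 → ℝ) :
    edgeInt a b g = dist a b * ∫ t in Icc (0 : ℝ) 1, g (AffineMap.lineMap a b t) := by
  rw [edgeInt, intervalIntegral.integral_of_le zero_le_one, integral_Icc_eq_integral_Ioc]

lemma memEdge_of_continuous {φ : E2 → ℝ} (hφ : Continuous φ) : MemEdge a b φ := by
  have hc : Continuous fun t : ℝ => φ (AffineMap.lineMap a b t) :=
    hφ.comp AffineMap.lineMap_continuous
  obtain ⟨C, hC⟩ := (isCompact_Icc (a := (0 : ℝ)) (b := 1)).exists_bound_of_continuousOn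
    hc.continuousOn
  exact MemLp.of_bound hc.aestronglyMeasurable C
    ((ae_restrict_iff' measurableSet_Icc).2 (ae_of_all _ hC))

variable {σ τ : E2 → ℝ}

lemma MemEdge.sub (hσ : MemEdge a b σ) (hτ : MemEdge a b τ) : MemEdge a b (σ - τ) :=
  MemLp.sub hσ hτ

lemma MemEdge.integrable (hτ : MemEdge a b τ) :
    Integrable (fun t : ℝ => τ (AffineMap.lineMap a b t)) (volume.restrict (Icc (0 : ℝ) 1)) :=
  MemLp.integrable (by norm_num) hτ

lemma MemEdge.integrable_sq (hτ : MemEdge a b τ) :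
    Integrable (fun t : ℝ => τ (AffineMap.lineMap a b t) ^ 2)
      (volume.restrict (Icc (0 : ℝ) 1)) :=
  MemLp.integrable_sq hτ

lemma edgeInt_sub (hσ : MemEdge a b σ) (hτ : MemEdge a b τ) :
    edgeInt a b (fun x => σ x - τ x) = edgeInt a b σ - edgeInt a b τ := by
  rw [edgeInt_eq, edgeInt_eq, edgeInt_eq, integral_sub hσ.integrable hτ.integrable, mul_sub]

lemma edgeInt_sq_nonneg (a b : E2) (τ : E2 → ℝ) : 0 ≤ edgeInt a b (fun x => τ x ^ 2) := by
  rw [edgeInt_eq]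
  exact mul_nonneg dist_nonneg (integral_nonneg fun _ => by positivity)

lemma edgeInt_sq_sub_le (hσ : MemEdge a b σ) (hτ : MemEdge a b τ) :
    edgeInt a b (fun x => (σ x - τ x) ^ 2) ≤
      2 * (edgeInt a b (fun x => σ x ^ 2) + edgeInt a b (fun x => τ x ^ 2)) := by
  have h : ∫ t in Icc (0 : ℝ) 1, (σ (AffineMap.lineMap a b t) - τ (AffineMap.lineMap a b t)) ^ 2 ≤
      2 * ((∫ t in Icc (0 : ℝ) 1, σ (AffineMap.lineMap a b t) ^ 2) +
        ∫ t in Icc (0 : ℝ) 1, τ (AffineMap.lineMap a b t) ^ 2) := by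
    rw [← integral_add hσ.integrable_sq hτ.integrable_sq, ← integral_const_mul]
    refine integral_mono (hσ.sub hτ).integrable_sq
      ((hσ.integrable_sq.add hτ.integrable_sq).const_mul 2) fun t => ?_
    change (σ _ - τ _) ^ 2 ≤ 2 * (σ _ ^ 2 + τ _ ^ 2)
    nlinarith [sq_nonneg (σ (AffineMap.lineMap a b t) + τ (AffineMap.lineMap a b t))]
  have h2 := mul_le_mul_of_nonneg_left h (dist_nonneg (x := a) (y := b))
  simp only [edgeInt_eq]
  linarith

lemma edgeInt_sq_le_mul (hτ : MemEdge a b τ) :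
    edgeInt a b τ ^ 2 ≤ dist a b * edgeInt a b (fun x => τ x ^ 2) := by
  simp only [edgeInt_eq]
  set f : ℝ → ℝ := fun t => τ (AffineMap.lineMap a b t)
  have h1 : (∫ t in Icc (0 : ℝ) 1, f t) ^ 2 ≤ ∫ t in Icc (0 : ℝ) 1, f t ^ 2 := by
    set m := ∫ t in Icc (0 : ℝ) 1, f t with hm
    have h2 : 0 ≤ ∫ t in Icc (0 : ℝ) 1, (f t - m) ^ 2 := integral_nonneg fun _ => by positivity
    have e : ∀ t, (f t - m) ^ 2 = f t ^ 2 - 2 * m * f t + m ^ 2 := fun t => by ring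
    have i1 : Integrable (fun t => f t ^ 2 - 2 * m * f t) (volume.restrict (Icc (0 : ℝ) 1)) :=
      hτ.integrable_sq.sub (hτ.integrable.const_mul _)
    simp only [e] at h2
    rw [integral_add i1 (integrable_const _), integral_sub hτ.integrable_sq
      (hτ.integrable.const_mul _), integral_const_mul, ← hm] at h2
    simp at h2
    nlinarith
  rw [mul_pow, ← mul_assoc, ← sq]
  exact mul_le_mul_of_nonneg_left h1 (sq_nonneg _)

variable {U : Set E2} {v w : E2 → ℝ}

lemma weakGrad_zero (hU : IsOpen U) : weakGrad U 0 =ᵐ[volume.restrict U] 0 := by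
  refine HasWeakGrad.weakGrad_ae_eq hU ⟨MemLp.zero', fun φ _ _ _ e => by simp⟩

lemma h1NormSq_zero (hU : IsOpen U) : h1NormSq U 0 = 0 := by
  rw [h1NormSq, h1SemiSq, l2Sq_congr (weakGrad_zero hU)]
  simp [l2Sq]

lemma isTrace_of_contDiff (hU : IsOpen U) {φ : E2 → ℝ} (hφ : ContDiff ℝ ∞ φ) :
    IsTrace U a b φ φ := by
  refine ⟨memEdge_of_continuous hφ.continuous, fun _ => φ, fun _ => hφ, ?_, ?_⟩
  · simp [h1NormSq_zero hU]
  · simp [edgeInt]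

lemma IsTrace.sub (hUo : IsOpen U) (hUb : Bornology.IsBounded U) (hv : MemH1 U v)
    (hw : MemH1 U w) (h : IsTrace U a b v τ) (h' : IsTrace U a b w σ) :
    IsTrace U a b (v - w) (τ - σ) := by
  obtain ⟨hτ, φ, hφ, h1, h2⟩ := h
  obtain ⟨hσ, ψ, hψ, h3, h4⟩ := h'
  refine ⟨MemEdge.sub hτ hσ, fun n => φ n - ψ n, fun n => (hφ n).sub (hψ n), ?_, ?_⟩
  · refine squeeze_zero (fun n => h1NormSq_nonneg _ _) (fun n => ?_)
      (by simpa using (h1.add h3).const_mul 2)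
    rw [show φ n - ψ n - (v - w) = (φ n - v) - (ψ n - w) by abel]
    exact h1NormSq_sub_le hUo ((memH1_of_contDiff hUb (hφ n)).sub hv)
      ((memH1_of_contDiff hUb (hψ n)).sub hw)
  · refine squeeze_zero (fun n => edgeInt_sq_nonneg a b _) (fun n => ?_)
      (by simpa using (h2.add h4).const_mul 2)
    have e : ∀ x, (φ n - ψ n) x - (τ - σ) x = (φ n - τ) x - (ψ n - σ) x := fun x => by
      simp only [Pi.sub_apply]; ring
    simp only [e]
    exact edgeInt_sq_sub_le ((memEdge_of_continuous (hφ n).continuous).sub hτ)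
      ((memEdge_of_continuous (hψ n).continuous).sub hσ)

namespace StarBall

variable {K : Set E2} {c : E2} {r : ℝ}

/-- Limit of the smooth estimate along the sequence defining the trace. The factor `4` comes from
two triangle inequalities, one on the edge and one in the domain. -/
lemma edgeInt_sq_le (hK : StarBall K c r) (hab : a ≠ b) (hE : segment ℝ a b ⊆ frontier K)
    (hv : MemH1 (interior K) v) (hτ : IsTrace (interior K) a b v τ) :
    edgeInt a b (fun x => τ x ^ 2) ≤
      4 * r⁻¹ * (3 * l2Sq (interior K) v + Metric.diam K ^ 2 * h1SemiSq (interior K) v) := by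
  obtain ⟨hτm, φ, hφ, h1, h2⟩ := hτ
  have hDo : IsOpen (interior K) := isOpen_interior
  have hDb := hK.isBounded_interior
  have hr := inv_pos.2 hK.pos
  set h := Metric.diam K
  set C := 3 * l2Sq (interior K) v + h ^ 2 * h1SemiSq (interior K) v
  have hb : ∀ n, edgeInt a b (fun x => τ x ^ 2) ≤
      2 * edgeInt a b (fun x => (φ n x - τ x) ^ 2) +
        4 * r⁻¹ * (3 + h ^ 2) * h1NormSq (interior K) (φ n - v) + 4 * r⁻¹ * C := by
    intro n
    have hφ1 := memH1_of_contDiff hDb (hφ n)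
    have hφe : MemEdge a b (φ n) := memEdge_of_continuous (hφ n).continuous
    have b1 := edgeInt_sq_sub_le hφe (hφe.sub hτm)
    simp only [Pi.sub_apply, sub_sub_cancel] at b1
    have b2 := hK.edgeInt_sq_le_of_contDiff hab hE (hφ n)
    have b3 : h1SemiSq (interior K) (φ n) ≤
        2 * (h1SemiSq (interior K) v + h1SemiSq (interior K) (φ n - v)) := by
      rw [h1SemiSq_sub_comm hDo hφ1 hv]
      nth_rewrite 1 [show φ n = v - (v - φ n) by abel]
      exact h1SemiSq_sub_le hDo hv (hv.sub hφ1)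
    have b4 : l2Sq (interior K) (φ n) ≤
        2 * (l2Sq (interior K) v + l2Sq (interior K) (φ n - v)) := by
      rw [l2Sq_sub_comm]
      nth_rewrite 1 [show φ n = v - (v - φ n) by abel]
      exact l2Sq_sub_le hv.1 (hv.1.sub hφ1.1)
    have b5 : 3 * l2Sq (interior K) (φ n) + h ^ 2 * h1SemiSq (interior K) (φ n) ≤
        2 * C + 2 * (3 + h ^ 2) * h1NormSq (interior K) (φ n - v) := by
      have := mul_le_mul_of_nonneg_left b3 (sq_nonneg h)
      have n1 := mul_nonneg (sq_nonneg h) (l2Sq_nonneg (interior K) (φ n - v))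
      have n2 := h1SemiSq_nonneg (interior K) (φ n - v)
      simp only [h1NormSq, C]
      nlinarith
    have b6 := mul_le_mul_of_nonneg_left b5 hr.le
    nlinarith
  have ht : Tendsto (fun n => 2 * edgeInt a b (fun x => (φ n x - τ x) ^ 2) +
        4 * r⁻¹ * (3 + h ^ 2) * h1NormSq (interior K) (φ n - v) + 4 * r⁻¹ * C) atTop
      (𝓝 (4 * r⁻¹ * C)) := by
    simpa using ((h2.const_mul 2).add (h1.const_mul (4 * r⁻¹ * (3 + h ^ 2)))).add_const
      (4 * r⁻¹ * C)
  exact ge_of_tendsto' ht hb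

/-- The difference of two traces of `v` is a trace of zero, which the trace inequality forces to
vanish in `L²` of the edge. -/
lemma edgeInt_eq_of_isTrace (hK : StarBall K c r) (hab : a ≠ b)
    (hE : segment ℝ a b ⊆ frontier K) (hv : MemH1 (interior K) v)
    (hτ : IsTrace (interior K) a b v τ) (hσ : IsTrace (interior K) a b v σ) :
    edgeInt a b τ = edgeInt a b σ := by
  have h1 := hK.edgeInt_sq_le hab hE (hv.sub hv)
    (hτ.sub isOpen_interior hK.isBounded_interior hv hv hσ)
  have h0 := h1NormSq_zero (U := interior K) isOpen_interior
  have hz1 := l2Sq_nonneg (interior K) (0 : E2 → ℝ)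
  have hz2 := h1SemiSq_nonneg (interior K) (0 : E2 → ℝ)
  rw [h1NormSq] at h0
  rw [sub_self, show l2Sq (interior K) (0 : E2 → ℝ) = 0 by linarith,
    show h1SemiSq (interior K) (0 : E2 → ℝ) = 0 by linarith] at h1
  have h2 := edgeInt_sq_le_mul (MemEdge.sub hτ.1 hσ.1)
  have h3 : dist a b * edgeInt a b (fun x => (τ - σ) x ^ 2) ≤ dist a b * 0 :=
    mul_le_mul_of_nonneg_left (by linarith) dist_nonneg
  have h4 : edgeInt a b (τ - σ) = 0 := by
    have : edgeInt a b (τ - σ) ^ 2 ≤ 0 := by linarith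
    exact pow_eq_zero_iff two_ne_zero |>.1 (le_antisymm this (sq_nonneg _))
  have h5 := edgeInt_sub hτ.1 hσ.1
  change edgeInt a b (τ - σ) = _ at h5
  linarith

/-- By the trace inequality the restrictions of smooth approximations to the edge form a Cauchy
sequence in `L²(0, 1)`; the limit is the trace. -/
lemma exists_isTrace (hK : StarBall K c r) (hab : a ≠ b) (hE : segment ℝ a b ⊆ frontier K)
    (hv : MemH1 (interior K) v) : ∃ τ, IsTrace (interior K) a b v τ := by
  obtain ⟨φ, hφ, hlim⟩ := hK.exists_smooth_approx hv
  have hDo : IsOpen (interior K) := isOpen_interior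
  have hDb := hK.isBounded_interior
  have hr := inv_pos.2 hK.pos
  have hdist : 0 < dist a b := dist_pos.2 hab
  set μ := volume.restrict (Icc (0 : ℝ) 1) with hμ
  let f : ℕ → ℝ → ℝ := fun n t => φ n (AffineMap.lineMap a b t)
  have hf : ∀ n, MemLp (f n) 2 μ := fun n => memEdge_of_continuous (hφ n).continuous
  set C := (dist a b)⁻¹ * (r⁻¹ * (3 + Metric.diam K ^ 2) * 2) with hC
  have hC0 : 0 ≤ C := by positivity
  set e : ℕ → ℝ := fun n => h1NormSq (interior K) (φ n - v) with he
  have hdistsq : ∀ n m, dist ((hf n).toLp) ((hf m).toLp) ^ 2 ≤ C * (e n + e m) := by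
    intro n m
    have h1 : dist ((hf n).toLp) ((hf m).toLp) ^ 2 =
        ∫ t, ‖(f n - f m) t‖ ^ 2 ∂μ := by
      rw [dist_eq_norm, ← MemLp.toLp_sub, Lp.norm_toLp,
        integral_norm_sq_eq_toReal_eLpNorm_sq ((hf n).sub (hf m))]
    have h2 := hK.edgeInt_sq_le_of_contDiff hab hE ((hφ n).sub (hφ m))
    rw [edgeInt_eq] at h2
    have h3 : h1NormSq (interior K) (φ n - φ m) ≤ 2 * (e n + e m) := by
      rw [show φ n - φ m = (φ n - v) - (φ m - v) by abel]
      exact h1NormSq_sub_le hDo ((memH1_of_contDiff hDb (hφ n)).sub hv)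
        ((memH1_of_contDiff hDb (hφ m)).sub hv)
    have h4 : 3 * l2Sq (interior K) (φ n - φ m) +
        Metric.diam K ^ 2 * h1SemiSq (interior K) (φ n - φ m) ≤
        (3 + Metric.diam K ^ 2) * h1NormSq (interior K) (φ n - φ m) := by
      have n1 := mul_nonneg (sq_nonneg (Metric.diam K)) (l2Sq_nonneg (interior K) (φ n - φ m))
      have n2 := h1SemiSq_nonneg (interior K) (φ n - φ m)
      simp only [h1NormSq]
      nlinarith
    rw [h1, hC, mul_assoc, inv_mul_eq_div, le_div_iff₀ hdist, mul_comm _ (dist a b)]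
    simp only [Real.norm_eq_abs, sq_abs]
    refine h2.trans ?_
    rw [mul_assoc, mul_assoc]
    refine mul_le_mul_of_nonneg_left (h4.trans ?_) hr.le
    exact mul_le_mul_of_nonneg_left h3 (by positivity)
  have hcau : CauchySeq fun n => (hf n).toLp := by
    refine Metric.cauchySeq_iff.2 fun δ hδ => ?_
    have : ∀ᶠ n in atTop, (2 * C + 1) * e n < δ ^ 2 := by
      have := hlim.const_mul (2 * C + 1)
      rw [mul_zero] at this
      exact this.eventually_lt_const (by positivity)
    obtain ⟨N, hN⟩ := eventually_atTop.1 this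
    refine ⟨N, fun m hm n hn => ?_⟩
    have := hdistsq m n
    have p1 := hN m hm
    have p2 := hN n hn
    have q1 : 0 ≤ e m := h1NormSq_nonneg _ _
    have q2 : 0 ≤ e n := h1NormSq_nonneg _ _
    refine lt_of_pow_lt_pow_left₀ 2 hδ.le ?_
    nlinarith
  obtain ⟨L, hL⟩ := cauchySeq_tendsto_of_complete hcau
  have hinj : Function.Injective fun t : ℝ => (AffineMap.lineMap a b t : E2) :=
    AffineMap.lineMap_injective ℝ hab
  -- The limit is a function of the edge parameter; injectivity of the parametrization turns it into
  -- a function on the plane, with the irrelevant value `0` elsewhere.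
  let τ : E2 → ℝ := Function.extend (fun t : ℝ => (AffineMap.lineMap a b t : E2)) L 0
  have hτL : (fun t : ℝ => τ (AffineMap.lineMap a b t)) = L := by
    ext t
    exact hinj.extend_apply L 0 t
  refine ⟨τ, ?_, φ, hφ, hlim, ?_⟩
  · rw [hτL]; exact Lp.memLp L
  · have h1 : ∀ n, edgeInt a b (fun x => (φ n x - τ x) ^ 2) =
        dist a b * dist ((hf n).toLp) L ^ 2 := by
      intro n
      rw [edgeInt_eq]
      congr 1
      have : dist ((hf n).toLp) L = (eLpNorm (f n - ⇑L) 2 μ).toReal := by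
        have h2 : (hf n).toLp - L = ((hf n).sub (Lp.memLp L)).toLp := by
          rw [MemLp.toLp_sub (hf n) (Lp.memLp L), Lp.toLp_coeFn]
        rw [dist_eq_norm, h2, Lp.norm_toLp]
      rw [this, ← integral_norm_sq_eq_toReal_eLpNorm_sq ((hf n).sub (Lp.memLp L))]
      refine integral_congr_ae (ae_of_all _ fun t => ?_)
      have := congrFun hτL t
      simp [this, f]
    simp only [h1]
    have := ((tendsto_iff_dist_tendsto_zero.1 hL).pow 2).const_mul (dist a b)
    simpa using this

lemma isTrace_trace (hK : StarBall K c r) (hab : a ≠ b) (hE : segment ℝ a b ⊆ frontier K)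
    (hv : MemH1 (interior K) v) : IsTrace (interior K) a b v (trace (interior K) a b v) := by
  have h := hK.exists_isTrace hab hE hv
  rw [trace, dif_pos h]
  exact h.choose_spec

end StarBall

end Trace

end NCVEM

namespace NCVEM

/-! ### Decomposition of a star-shaped polygon into triangles -/

namespace StarBall

variable {K : Set E2} {c : E2} {r : ℝ} {a b : E2}

lemma cross_sub_eq (a b c : E2) : cross (a - c) (b - a) = cross (a - c) (b - c) := by
  simp only [cross, PiLp.sub_apply]; ring

/-- A boundary point in the cone over a boundary segment lies on that segment. -/
lemma mem_segment_of_cone (hK : StarBall K c r) (hE : segment ℝ a b ⊆ frontier K) {z : E2}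
    (hz : z ∈ frontier K) {x y : ℝ} (hx : 0 ≤ x) (hy : 0 < y)
    (h : z - c = x • (a - c) + y • (b - c)) : z ∈ segment ℝ a b := by
  have hxy : 0 < x + y := by linarith
  have hmem : c + (x + y)⁻¹ • (z - c) ∈ segment ℝ a b := by
    refine ⟨x / (x + y), y / (x + y), by positivity, by positivity, by field_simp, ?_⟩
    rw [h, smul_add, smul_smul, smul_smul, ← div_eq_inv_mul, ← div_eq_inv_mul]
    have : y / (x + y) = 1 - x / (x + y) := by field_simp; ring
    rw [this]; module
  have := hK.eq_one_of_frontier hz (inv_pos.2 hxy) (hE hmem)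
  rwa [this, one_smul, add_sub_cancel] at hmem

lemma volume_segment_center {v : E2} {w : E2} (h : cross (v - c) (w - c) ≠ 0) :
    volume (range fun t : ℝ => c + t • (v - c)) = 0 := by
  have hne : line[ℝ, c, v] ≠ ⊤ := by
    intro htop
    have hw : w ∈ line[ℝ, c, v] := by rw [htop]; trivial
    rw [mem_affineSpan_pair_iff_exists_lineMap_eq] at hw
    obtain ⟨t, rfl⟩ := hw
    refine h ?_
    rw [AffineMap.lineMap_apply, vsub_eq_sub, vadd_eq_add, add_sub_cancel_right]
    simp only [cross, PiLp.smul_apply, smul_eq_mul]; ring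
  refine measure_mono_null ?_ (Measure.addHaar_affineSubspace volume _ hne)
  rintro x ⟨t, rfl⟩
  change _ ∈ line[ℝ, c, v]
  rw [mem_affineSpan_pair_iff_exists_lineMap_eq]
  exact ⟨t, by rw [AffineMap.lineMap_apply, vsub_eq_sub, vadd_eq_add, add_comm]⟩

end StarBall

namespace Polygon

variable {P : Polygon} {c : E2} {r : ℝ}

lemma edge_subset_frontier (P : Polygon) (j : P.Idx) :
    segment ℝ (P.vert j) (P.vert (j + 1)) ⊆ frontier P.carrier := by
  rw [P.frontier_eq]
  exact subset_iUnion (fun j => segment ℝ (P.vert j) (P.vert (j + 1))) j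

lemma idx_ne_succ (P : Polygon) (j : P.Idx) : j ≠ j + 1 := by
  intro h
  have h1 : (1 : Fin (P.m + 3)) = 0 := by
    have : j + 0 = j + 1 := by rw [add_zero]; exact h
    exact (add_left_cancel this).symm
  exact absurd h1 (by simp)

lemma vert_ne (P : Polygon) (j : P.Idx) : P.vert j ≠ P.vert (j + 1) := fun h =>
  P.idx_ne_succ j (P.vert_injective h)

/-- Consecutive edges are traversed in the same sense around `c`. Otherwise the polygon would fold
back at the common vertex, and the far endpoint of one edge would lie in the cone over the other. By
`mem_segment_of_cone` it would lie on that other edge, but the two edges share only their common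
vertex. The sign of `cross p w / cross q w` decides which endpoint is caught. -/
lemma cross_mul_cross_pos (hK : StarBall P.carrier c r) (j : P.Idx) :
    0 < cross (P.vert j - c) (P.vert (j + 1) - c) *
      cross (P.vert (j + 1) - c) (P.vert (j + 1 + 1) - c) := by
  have n1 := hK.cross_ne_zero (P.vert_ne j) (P.edge_subset_frontier j)
  have n2 := hK.cross_ne_zero (P.vert_ne (j + 1)) (P.edge_subset_frontier (j + 1))
  rw [StarBall.cross_sub_eq] at n1 n2
  set p := P.vert j - c with hp
  set q := P.vert (j + 1) - c with hq
  set w := P.vert (j + 1 + 1) - c with hw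
  by_contra hle
  have hlt : cross p q * cross q w < 0 :=
    lt_of_le_of_ne (not_lt.1 hle) (mul_ne_zero n1 n2)
  have hinter := P.edge_inter_next j
  have hratio : 0 < -(cross p q / cross q w) := by
    have : cross p q / cross q w = cross p q * cross q w / (cross q w) ^ 2 := by
      field_simp
    rw [this, neg_pos]
    exact div_neg_of_neg_of_pos hlt (by positivity)
  rcases le_or_gt 0 (cross p w / cross q w) with h | h
  · have hdec := cross_decomp q w p
    have e : P.vert j - c = (cross p w / cross q w) • q + (-(cross p q / cross q w)) • w := by
      have h2 : cross q p = -cross p q := by simp only [cross]; ring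
      rw [h2] at hdec
      have := congrArg (fun v => (cross q w)⁻¹ • v) hdec
      simp only [inv_smul_smul₀ n2] at this
      refine this.trans ?_
      rw [smul_add, smul_smul, smul_smul]
      congr 2 <;> ring
    have := hK.mem_segment_of_cone (P.edge_subset_frontier (j + 1))
      (P.edge_subset_frontier j (left_mem_segment ℝ _ _)) h hratio e
    have h3 : P.vert j ∈ ({P.vert (j + 1)} : Set E2) := by
      rw [← hinter]; exact ⟨left_mem_segment ℝ _ _, this⟩
    exact P.vert_ne j h3
  · have hdec := cross_decomp p q w
    have e : P.vert (j + 1 + 1) - c =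
        (-(cross q w / cross p q)) • p + (cross p w / cross p q) • q := by
      have h2 : cross w q = -cross q w := by simp only [cross]; ring
      rw [h2] at hdec
      have := congrArg (fun v => (cross p q)⁻¹ • v) hdec
      simp only [inv_smul_smul₀ n1] at this
      refine this.trans ?_
      rw [smul_add, smul_smul, smul_smul]
      congr 2 <;> ring
    have hx : 0 ≤ -(cross q w / cross p q) := by
      have := inv_pos.2 hratio
      rw [← neg_inv, inv_div] at this
      exact this.le
    have hy : 0 < cross p w / cross p q := by
      have h4 : cross p w / cross p q = cross p w / cross q w * (cross q w / cross p q) := by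
        field_simp
      rw [h4]
      have h5 : cross q w / cross p q < 0 := by
        have := inv_pos.2 hratio
        rw [← neg_inv, inv_div] at this
        linarith
      exact mul_pos_of_neg_of_neg h h5
    have := hK.mem_segment_of_cone (P.edge_subset_frontier j)
      (P.edge_subset_frontier (j + 1) (right_mem_segment ℝ _ _)) hx hy e
    have h3 : P.vert (j + 1 + 1) ∈ ({P.vert (j + 1)} : Set E2) := by
      rw [← hinter]; exact ⟨this, right_mem_segment ℝ _ _⟩
    exact P.vert_ne (j + 1) h3.symm

lemma cross_zero_mul_cross_pos (hK : StarBall P.carrier c r) (j : P.Idx) :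
    0 < cross (P.vert 0 - c) (P.vert (0 + 1) - c) *
      cross (P.vert j - c) (P.vert (j + 1) - c) := by
  induction j using Fin.induction with
  | zero =>
    have n1 := hK.cross_ne_zero (P.vert_ne 0) (P.edge_subset_frontier 0)
    rw [StarBall.cross_sub_eq] at n1
    exact mul_self_pos.2 n1
  | succ i ih =>
    have h := cross_mul_cross_pos hK i.castSucc
    rw [Fin.coeSucc_eq_succ] at h ih
    set x := cross (P.vert 0 - c) (P.vert (0 + 1) - c)
    set y := cross (P.vert i.castSucc - c) (P.vert i.succ - c)
    set z := cross (P.vert i.succ - c) (P.vert (i.succ + 1) - c)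
    have h1 : 0 < (x * y) * (y * z) := mul_pos ih h
    have h2 : (x * y) * (y * z) = (x * z) * y ^ 2 := by ring
    rw [h2] at h1
    exact pos_of_mul_pos_left h1 (sq_nonneg y)

/-- The triangle over the edge `j` with apex `c`. -/
def triangle (P : Polygon) (c : E2) (j : P.Idx) : Set E2 := openTri c (P.vert j) (P.vert (j + 1))

lemma eq_of_mem_edges (P : Polygon) {j k : P.Idx} {t : ℝ} (ht : t ∈ Ioo (0 : ℝ) 1)
    (h : (AffineMap.lineMap (P.vert j) (P.vert (j + 1)) t : E2) ∈
      segment ℝ (P.vert k) (P.vert (k + 1))) : k = j := by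
  have hinj := AffineMap.lineMap_injective ℝ (P.vert_ne j)
  have hmem : (AffineMap.lineMap (P.vert j) (P.vert (j + 1)) t : E2) ∈
      segment ℝ (P.vert j) (P.vert (j + 1)) :=
    StarBall.lineMap_mem_segment ⟨ht.1.le, ht.2.le⟩
  by_contra hne
  by_cases h1 : k = j + 1
  · subst h1
    have : (AffineMap.lineMap (P.vert j) (P.vert (j + 1)) t : E2) ∈
        ({P.vert (j + 1)} : Set E2) := by
      rw [← P.edge_inter_next j]; exact ⟨hmem, h⟩
    exact ht.2.ne (hinj (this.trans (AffineMap.lineMap_apply_one _ _).symm))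
  · by_cases h2 : j = k + 1
    · subst h2
      have : (AffineMap.lineMap (P.vert (k + 1)) (P.vert (k + 1 + 1)) t : E2) ∈
          ({P.vert (k + 1)} : Set E2) := by
        rw [← P.edge_inter_next k]; exact ⟨h, hmem⟩
      exact ht.1.ne' (hinj (this.trans (AffineMap.lineMap_apply_zero _ _).symm))
    · exact (P.edge_disjoint j k hne h1 h2).le_bot ⟨hmem, h⟩

/-- A common point would put boundary points of both edges on one ray from `c`. They coincide by
`eq_one_of_frontier`, and a relative interior point of an edge lies on no other edge. -/
lemma pairwise_disjoint_triangle (hK : StarBall P.carrier c r) :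
    Pairwise (Function.onFun Disjoint (P.triangle c)) := by
  intro j k hjk
  rw [Function.onFun, Set.disjoint_left]
  rintro x ⟨s, hs, t, ht, rfl⟩ ⟨s', hs', t', ht', h⟩
  have hz := P.edge_subset_frontier j (StarBall.lineMap_mem_segment ⟨ht.1.le, ht.2.le⟩)
  have hz' := P.edge_subset_frontier k (StarBall.lineMap_mem_segment ⟨ht'.1.le, ht'.2.le⟩)
  set z : E2 := AffineMap.lineMap (P.vert j) (P.vert (j + 1)) t with hzdef
  set z' : E2 := AffineMap.lineMap (P.vert k) (P.vert (k + 1)) t' with hzdef'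
  have e : z' = c + (s'⁻¹ * s) • (z - c) := by
    have h1 : s • (z - c) = s' • (z' - c) := add_left_cancel h
    rw [mul_smul, h1, inv_smul_smul₀ hs'.1.ne', add_sub_cancel]
  have h1 := hK.eq_one_of_frontier hz (mul_pos (inv_pos.2 hs'.1) hs.1) (e ▸ hz')
  rw [h1, one_smul, add_sub_cancel] at e
  refine hjk (P.eq_of_mem_edges (j := j) (k := k) ht ?_).symm
  rw [← hzdef, ← e]
  exact StarBall.lineMap_mem_segment ⟨ht'.1.le, ht'.2.le⟩

lemma dom_ae_eq (hK : StarBall P.carrier c r) :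
    (⋃ j, P.triangle c j : Set E2) =ᵐ[volume] P.dom := by
  -- Away from the lines through `c` and the vertices, the ray from `c` through a point leaves the
  -- polygon at a relative interior point of some edge.
  set N : Set E2 := {c} ∪ ⋃ j, range fun t : ℝ => c + t • (P.vert j - c) with hN
  have hN0 : volume N = 0 := by
    rw [hN, measure_union_null_iff, measure_iUnion_null_iff]
    refine ⟨measure_singleton c, fun j => ?_⟩
    have n1 := hK.cross_ne_zero (P.vert_ne j) (P.edge_subset_frontier j)
    rw [StarBall.cross_sub_eq] at n1
    exact StarBall.volume_segment_center n1
  rw [eventuallyEq_set]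
  filter_upwards [measure_eq_zero_iff_ae_notMem.1 hN0] with x hx
  constructor
  · intro h
    obtain ⟨j, hj⟩ := mem_iUnion.1 h
    exact hK.openTri_subset (P.edge_subset_frontier j) hj
  · intro h
    have hray : ∀ j, ∀ t : ℝ, x ≠ c + t • (P.vert j - c) := fun j t ht =>
      hx (Or.inr (mem_iUnion.2 ⟨j, t, ht.symm⟩))
    obtain ⟨z, hz, s, hs0, hs1, rfl⟩ := hK.exists_frontier h fun hc => hx (Or.inl hc)
    rw [P.frontier_eq] at hz
    obtain ⟨j, hj⟩ := mem_iUnion.1 hz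
    rw [segment_eq_image_lineMap] at hj
    obtain ⟨t, ht, rfl⟩ := hj
    refine mem_iUnion.2 ⟨j, s, ⟨hs0, hs1⟩, t, ⟨ht.1.lt_of_ne ?_, ht.2.lt_of_ne ?_⟩, rfl⟩
    · rintro rfl
      exact hray j s (by rw [AffineMap.lineMap_apply_zero])
    · rintro rfl
      exact hray (j + 1) s (by rw [AffineMap.lineMap_apply_one])

lemma integral_dom (hK : StarBall P.carrier c r) {F : E2 → ℝ} (hF : IntegrableOn F P.dom) :
    ∫ x in P.dom, F x = ∑ j, ∫ x in P.triangle c j, F x := by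
  have hm : ∀ j, MeasurableSet (P.triangle c j) := fun j =>
    measurableSet_openTri (hK.cross_ne_zero (P.vert_ne j) (P.edge_subset_frontier j))
  rw [← setIntegral_congr_set (dom_ae_eq hK), integral_iUnion_fintype hm
    (pairwise_disjoint_triangle hK)
    fun j => hF.mono_set (hK.openTri_subset (P.edge_subset_frontier j))]

/-- Green's formula for a constant vector field on a star-shaped polygon. -/
lemma exists_green (hK : StarBall P.carrier c r) (g : E2) :
    ∃ κ : P.Idx → ℝ, ∀ φ : E2 → ℝ, ContDiff ℝ ∞ φ →
      ∫ x in P.dom, fderiv ℝ φ x g = ∑ j, κ j * P.eInt j φ := by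
  set J : P.Idx → ℝ := fun j => cross (P.vert j - c) (P.vert (j + 1) - P.vert j) with hJ
  have hJ0 : ∀ j, J j ≠ 0 := fun j => hK.cross_ne_zero (P.vert_ne j) (P.edge_subset_frontier j)
  -- The common orientation sign of all triangles. Without it the contributions of the inner sides
  -- would not cancel.
  set ε : ℝ := |J 0| / J 0 with hε
  have hsign : ∀ j, |J j| / J j = ε := by
    intro j
    have h := cross_zero_mul_cross_pos hK j
    rw [← StarBall.cross_sub_eq, ← StarBall.cross_sub_eq] at h
    change 0 < J 0 * J j at h
    rcases pos_and_pos_or_neg_and_neg_of_mul_pos h with ⟨h0, hj⟩ | ⟨h0, hj⟩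
    · rw [hε, abs_of_pos h0, abs_of_pos hj, div_self h0.ne', div_self hj.ne']
    · rw [hε, abs_of_neg h0, abs_of_neg hj, neg_div, neg_div, div_self h0.ne, div_self hj.ne]
  refine ⟨fun j => ε * cross g (P.vert (j + 1) - P.vert j) / P.len j, fun φ hφ => ?_⟩
  have hint : IntegrableOn (fun x => fderiv ℝ φ x g) P.dom :=
    memLp_one_iff_integrable.1
      (memLp_of_continuous_bounded hK.isBounded_interior (continuous_fderiv_apply hφ g) 1)
  rw [integral_dom hK hint]
  -- `W j` is the contribution of the inner side from `c` to `vert j`. Neighbouring triangles carry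
  -- it with opposite signs, so it disappears from the cyclic sum.
  set W : P.Idx → ℝ := fun j =>
    cross (P.vert j - c) g * ∫ s in (0 : ℝ)..1, φ (c + s • (P.vert j - c)) with hW
  have hterm : ∀ j, ∫ x in P.triangle c j, fderiv ℝ φ x g =
      ε * cross g (P.vert (j + 1) - P.vert j) / P.len j * P.eInt j φ +
        ε * (W (j + 1) - W j) := by
    intro j
    have h := integral_openTri_fderiv (hJ0 j) hφ g
    have hlen : P.len j ≠ 0 := (dist_pos.2 (P.vert_ne j)).ne'
    rw [← hsign j, eInt, edgeInt]
    change J j * ∫ x in P.triangle c j, fderiv ℝ φ x g = |J j| * _ at h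
    change _ = _ * (P.len j * _) + _
    rw [mul_comm, ← eq_div_iff (hJ0 j)] at h
    rw [h]
    simp only [hW]
    field_simp
    ring
  have hshift : ∑ j, W (j + 1) = ∑ j, W j := Equiv.sum_comp (Equiv.addRight (1 : P.Idx)) W
  rw [Finset.sum_congr rfl fun j _ => hterm j, Finset.sum_add_distrib, ← Finset.mul_sum,
    Finset.sum_sub_distrib, hshift, sub_self, mul_zero,
    add_zero]

end Polygon

/-! ### The local virtual element space -/

lemma integrable_inner {U : Set E2} {f g : E2 → E2} (hf : MemLp f 2 (volume.restrict U))
    (hg : MemLp g 2 (volume.restrict U)) :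
    Integrable (fun x => inner ℝ (f x) (g x)) (volume.restrict U) := by
  refine Integrable.mono' (hf.norm.integrable_mul hg.norm) (hf.1.inner hg.1)
    (ae_of_all _ fun x => ?_)
  exact norm_inner_le_norm _ _

section Local

variable {P : Polygon} {c : E2} {r : ℝ} {v : E2 → ℝ} {p : E2 → ℝ}

lemma weakGrad_affine {U : Set E2} (hUo : IsOpen U) (hU : Bornology.IsBounded U) {d : ℝ} {g : E2}
    (h : ∀ x, p x = d + inner ℝ g x) : weakGrad U p =ᵐ[volume.restrict U] fun _ => g := by
  filter_upwards [weakGrad_of_contDiff hUo hU (IsAffine.contDiff ⟨d, g, h⟩)] with x hx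
  rw [hx, gradient_affine h]

/-- An affine function has vanishing Laplacian and constant normal derivatives on the edges; in the
weak form this is Green's formula for its constant gradient. -/
lemma MemVhHat.sub_affine (hK : StarBall P.carrier c r) (hv : MemVhHat P v) (hp : IsAffine p) :
    MemVhHat P (v - p) := by
  obtain ⟨hv1, q, κ, hq, hG⟩ := hv
  have hDb : Bornology.IsBounded P.dom := hK.isBounded_interior
  have hDo : IsOpen P.dom := isOpen_interior
  have hp1 : MemH1 P.dom p := memH1_of_contDiff hDb hp.contDiff
  obtain ⟨d, g, hdg⟩ := hp
  obtain ⟨κ', hκ'⟩ := P.exists_green hK g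
  refine ⟨hv1.sub hp1, q, fun j => κ j - κ' j, hq, fun φ hφ => ?_⟩
  have hae : ∀ᵐ x ∂volume.restrict P.dom, fderiv ℝ φ x (weakGrad P.dom (v - p) x) =
      fderiv ℝ φ x (weakGrad P.dom v x) - fderiv ℝ φ x g := by
    filter_upwards [hv1.weakGrad_sub hDo hp1, weakGrad_affine hDo hDb hdg] with x h1 h2
    rw [h1, Pi.sub_apply, h2, map_sub]
  have hgr : MemLp (gradient φ) 2 (volume.restrict P.dom) :=
    memLp_of_continuous_bounded hDb (continuous_gradient hφ) 2
  have i1 : Integrable (fun x => fderiv ℝ φ x (weakGrad P.dom v x)) (volume.restrict P.dom) := by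
    simp only [← inner_gradient]
    exact integrable_inner hgr hv1.memLp_weakGrad
  have i2 : Integrable (fun x => fderiv ℝ φ x g) (volume.restrict P.dom) :=
    memLp_one_iff_integrable.1 (memLp_of_continuous_bounded hDb (continuous_fderiv_apply hφ g) 1)
  rw [integral_congr_ae hae, integral_sub i1 i2, hG φ hφ, hκ' φ hφ]
  simp only [sub_mul, Finset.sum_sub_distrib]
  ring

lemma eInt_trace_sub_affine (hK : StarBall P.carrier c r) (hv : MemH1 P.dom v) (hp : IsAffine p)
    (j : P.Idx) :
    P.eInt j (trace P.dom (P.vert j) (P.vert (j + 1)) (v - p)) =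
      P.eInt j (trace P.dom (P.vert j) (P.vert (j + 1)) v) - P.eInt j p := by
  have hDb : Bornology.IsBounded P.dom := hK.isBounded_interior
  have hDo : IsOpen P.dom := isOpen_interior
  have hp1 : MemH1 P.dom p := memH1_of_contDiff hDb hp.contDiff
  have hab := P.vert_ne j
  have hE := P.edge_subset_frontier j
  have t1 := hK.isTrace_trace hab hE hv
  have t2 : IsTrace P.dom (P.vert j) (P.vert (j + 1)) p p := isTrace_of_contDiff hDo hp.contDiff
  have t3 := hK.isTrace_trace hab hE (hv.sub hp1)
  have h := hK.edgeInt_eq_of_isTrace hab hE (hv.sub hp1) t3 (t1.sub hDo hDb hv hp1 t2)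
  exact h.trans (edgeInt_sub t1.1 t2.1)

/-- The Ritz projection of `v - p` is `q - p`, so the difference `v - q` in the orthogonality
condition does not change. This makes the stabilization bound applicable to `v - Π₁ v`. -/
lemma MemVhLoc.sub_affine (hK : StarBall P.carrier c r) (hv : MemVhLoc P v) (hp : IsAffine p) :
    MemVhLoc P (v - p) := by
  obtain ⟨hv1, q, ⟨hq, horth, hmean⟩, hqv⟩ := hv
  have hDb : Bornology.IsBounded P.dom := hK.isBounded_interior
  have hDo : IsOpen P.dom := isOpen_interior
  have hp1 : MemH1 P.dom p := memH1_of_contDiff hDb hp.contDiff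
  have hq1 : MemH1 P.dom q := memH1_of_contDiff hDb hq.contDiff
  refine ⟨hv1.sub_affine hK hp, q - p, ⟨hq.sub hp, fun χ hχ => ?_, ?_⟩, fun p' hp' => ?_⟩
  · rw [← horth χ hχ]
    refine integral_congr_ae ?_
    filter_upwards [hv1.1.weakGrad_sub hDo hp1, hq1.weakGrad_sub hDo hp1] with x h1 h2
    rw [h1, h2]
    simp only [Pi.sub_apply, sub_sub_sub_cancel_right]
  · have h1 : ∀ j, P.eInt j (q - p) = P.eInt j q - P.eInt j p := fun j =>
      edgeInt_sub (memEdge_of_continuous hq.contDiff.continuous)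
        (memEdge_of_continuous hp.contDiff.continuous)
    simp only [h1, eInt_trace_sub_affine hK hv1.1 hp, Finset.sum_sub_distrib, hmean]
  · simp only [Pi.sub_apply, sub_sub_sub_cancel_right]
    exact hqv p' hp'

end Local

/-! ### The projection onto affine functions -/

section Projection

variable {P : Polygon} {v : E2 → ℝ} {p q q' : E2 → ℝ}

lemma Polygon.isBounded_dom (P : Polygon) : Bornology.IsBounded P.dom :=
  P.isCompact.isBounded.subset interior_subset

lemma Polygon.isOpen_dom (P : Polygon) : IsOpen P.dom := isOpen_interior

lemma IsAffine.memLp (hp : IsAffine p) (P : Polygon) : MemLp p 2 (volume.restrict P.dom) :=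
  memLp_of_continuous_bounded P.isBounded_dom hp.contDiff.continuous 2

lemma IsAffine.memH1 (hp : IsAffine p) (P : Polygon) : MemH1 P.dom p :=
  memH1_of_contDiff P.isBounded_dom hp.contDiff

lemma IsAffine.eq_zero_of_ae (hp : IsAffine p) (h : p =ᵐ[volume.restrict P.dom] 0) : p = 0 := by
  have hcont := hp.contDiff.continuous
  have heq : EqOn p 0 P.dom := Measure.eqOn_open_of_ae_eq h P.isOpen_dom hcont.continuousOn
    continuousOn_const
  obtain ⟨x₀, hx₀⟩ : P.dom.Nonempty := P.interior_nonempty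
  obtain ⟨d, g, hdg⟩ := hp
  have hev : p =ᶠ[𝓝 x₀] 0 := heq.eventuallyEq_of_mem (P.isOpen_dom.mem_nhds hx₀)
  have hg : g = 0 := by
    rw [← gradient_affine hdg x₀, hev.gradient.eq_of_nhds]
    simp [gradient]
  subst hg
  have hd : d = 0 := by simpa [hdg] using heq hx₀
  ext x
  simp [hdg, hd]

/-- Orthogonal projection in `L²` onto the finite-dimensional image of the parameters `(d, g)`. -/
lemma exists_isL2Proj (hv : MemLp v 2 (volume.restrict P.dom)) : ∃ q, IsL2Proj P v q := by
  set μ := volume.restrict P.dom with hμ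
  have hm : ∀ y : ℝ × E2, MemLp (fun x => y.1 + inner ℝ y.2 x) 2 μ := fun y =>
    IsAffine.memLp ⟨y.1, y.2, fun _ => rfl⟩ P
  let A : ℝ × E2 →ₗ[ℝ] Lp ℝ 2 μ :=
    { toFun := fun y => (hm y).toLp
      map_add' := fun y z => by
        rw [← MemLp.toLp_add]
        congr 1; ext x
        simp [inner_add_left]; ring
      map_smul' := fun s y => by
        rw [RingHom.id_apply, ← MemLp.toLp_const_smul]
        congr 1; ext x
        simp [inner_smul_left]; ring }
  set S := LinearMap.range A with hS
  obtain ⟨y, hy⟩ : (S.starProjection hv.toLp : Lp ℝ 2 μ) ∈ S := Submodule.starProjection_apply_mem _ _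
  refine ⟨fun x => y.1 + inner ℝ y.2 x, ⟨y.1, y.2, fun _ => rfl⟩, ?_⟩
  rintro p ⟨d, g, hdg⟩
  have horth : inner ℝ (hv.toLp - S.starProjection hv.toLp) (A (d, g)) = 0 :=
    Submodule.starProjection_inner_eq_zero _ _ ⟨_, rfl⟩
  rw [← hy, L2.inner_def] at horth
  rw [← horth]
  refine integral_congr_ae ?_
  filter_upwards [Lp.coeFn_sub hv.toLp (A y), hv.coeFn_toLp, (hm y).coeFn_toLp,
    (hm (d, g)).coeFn_toLp] with x h1 h2 h3 h4
  have h3' : (A y : Lp ℝ 2 μ) x = y.1 + inner ℝ y.2 x := h3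
  have h4' : (A (d, g) : Lp ℝ 2 μ) x = d + inner ℝ g x := h4
  rw [h1, Pi.sub_apply, h2, h3', h4', hdg x]
  simp [mul_comm]

lemma IsL2Proj.unique (hv : MemLp v 2 (volume.restrict P.dom)) (h : IsL2Proj P v q)
    (h' : IsL2Proj P v q') : q = q' := by
  have hd := h.1.sub h'.1
  have i : ∀ {p}, IsAffine p → Integrable (fun x => (v x - p x) * (q - q') x)
      (volume.restrict P.dom) := fun hp => (hv.sub (hp.memLp P)).integrable_mul (hd.memLp P)
  have h1 := h.2 _ hd
  have h2 := h'.2 _ hd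
  have h3 : l2Sq P.dom (q - q') = 0 := by
    have : ∀ x, ‖(q - q') x‖ ^ 2 = (v x - q' x) * (q - q') x - (v x - q x) * (q - q') x := by
      intro x
      rw [Real.norm_eq_abs, sq_abs]
      simp only [Pi.sub_apply]; ring
    simp only [l2Sq, this]
    rw [integral_sub (i h'.1) (i h.1), h1, h2, sub_zero]
  rw [l2Sq_eq_zero (hd.memLp P)] at h3
  exact sub_eq_zero.1 (hd.eq_zero_of_ae h3)

lemma isL2Proj_Pi1 (hv : MemLp v 2 (volume.restrict P.dom)) : IsL2Proj P v (Pi1 P v) := by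
  have h := exists_isL2Proj hv
  rw [Pi1, dif_pos h]
  exact h.choose_spec

lemma IsL2Proj.Pi1_eq (hv : MemLp v 2 (volume.restrict P.dom)) (h : IsL2Proj P v q) :
    Pi1 P v = q :=
  (isL2Proj_Pi1 hv).unique hv h

lemma Pi1_sub_Pi1 (hv : MemLp v 2 (volume.restrict P.dom)) : Pi1 P (v - Pi1 P v) = 0 := by
  have h := isL2Proj_Pi1 hv
  refine IsL2Proj.Pi1_eq (hv.sub (h.1.memLp P)) ⟨isAffine_const 0, fun p hp => ?_⟩
  simpa using h.2 p hp

lemma integral_sub_Pi1 (hv : MemLp v 2 (volume.restrict P.dom)) :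
    ∫ x in P.dom, (v - Pi1 P v) x = 0 := by
  simpa using (isL2Proj_Pi1 hv).2 _ (isAffine_const 1)

end Projection

end NCVEM

namespace NCVEM

/-! ### Regular cells -/

section Cell

lemma Polygon.h_pos (P : Polygon) : 0 < P.h := by
  have hs := P.isCompact.isClosed.frontier_subset
  refine Metric.diam_pos ⟨_, hs (P.edge_subset_frontier 0 (left_mem_segment ℝ _ _)), _,
    hs (P.edge_subset_frontier 0 (right_mem_segment ℝ _ _)), P.vert_ne 0⟩ P.isCompact.isBounded

lemma Polygon.Regular.exists_starBall {P : Polygon} {ρ : ℝ} (hρ : 0 < ρ) (hP : P.Regular ρ) :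
    ∃ c, StarBall P.carrier c (ρ * P.h) := by
  obtain ⟨⟨c, r, hr, hs⟩, -⟩ := hP
  have hpos : 0 < ρ * P.h := mul_pos hρ P.h_pos
  exact ⟨c, P.isCompact, P.interior_nonempty.mono interior_subset, hpos,
    fun y hy => hs y (Metric.ball_subset_ball hr hy)⟩

/-- The constant in the scaled Poincaré inequality. -/
noncomputable def poincareConst (ρ : ℝ) : ℝ := 16 * (1 + (ρ⁻¹) ^ 2)

lemma poincareConst_pos (ρ : ℝ) : 0 < poincareConst ρ := by unfold poincareConst; positivity

variable {P : Polygon} {ρ : ℝ} {c : E2}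

lemma StarBall.l2Sq_le_of_integral_eq_zero (hρ : 0 < ρ) (hK : StarBall P.carrier c (ρ * P.h))
    {w : E2 → ℝ} (hw : MemH1 P.dom w) (h0 : ∫ x in P.dom, w x = 0) :
    l2Sq P.dom w ≤ poincareConst ρ * P.h ^ 2 * h1SemiSq P.dom w := by
  have h := hK.poincare hw h0
  have hh := P.h_pos
  have e : 16 * Metric.diam P.carrier ^ 2 * (1 + (Metric.diam P.carrier / (ρ * P.h)) ^ 2) =
      poincareConst ρ * P.h ^ 2 := by
    change 16 * P.h ^ 2 * (1 + (P.h / (ρ * P.h)) ^ 2) = _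
    unfold poincareConst
    field_simp
  rw [e] at h
  exact h

lemma StarBall.l2Sq_sub_Pi1_le (hρ : 0 < ρ) (hK : StarBall P.carrier c (ρ * P.h)) {v : E2 → ℝ}
    (hv : MemH1 P.dom v) :
    l2Sq P.dom (v - Pi1 P v) ≤ poincareConst ρ * P.h ^ 2 * h1SemiSq P.dom (v - Pi1 P v) :=
  hK.l2Sq_le_of_integral_eq_zero hρ (hv.sub ((isL2Proj_Pi1 hv.1).1.memH1 P))
    (integral_sub_Pi1 hv.1)

variable {u v : E2 → ℝ}

lemma h1SemiSq_sub_Pi1_le (hu : MemH1 P.dom u) (hv : MemH1 P.dom v) :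
    h1SemiSq P.dom (v - Pi1 P v) ≤
      2 * (h1SemiSq P.dom (u - v) + h1SemiSq P.dom (u - Pi1 P v)) := by
  have hq := (isL2Proj_Pi1 hv.1).1.memH1 P
  rw [show v - Pi1 P v = (u - Pi1 P v) - (u - v) by abel, add_comm (h1SemiSq P.dom (u - v))]
  exact h1SemiSq_sub_le P.isOpen_dom (hu.sub hq) (hu.sub hv)

/-- In `u - Π₁ v = (u - v) + (v - Π₁ v)` the last part has mean zero, so Poincaré replaces its `L²`
norm by the seminorm, and `h ≤ 1` disposes of the power of `h`. -/
lemma StarBall.l2Sq_sub_Pi1_le' (hρ : 0 < ρ) (hK : StarBall P.carrier c (ρ * P.h))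
    (hh : P.h ≤ 1) (hu : MemH1 P.dom u) (hv : MemH1 P.dom v) :
    l2Sq P.dom (u - Pi1 P v) ≤ (2 + 4 * poincareConst ρ) *
      (h1NormSq P.dom (u - v) + h1SemiSq P.dom (u - Pi1 P v)) := by
  have hq := (isL2Proj_Pi1 hv.1).1.memH1 P
  have h1 : l2Sq P.dom (u - Pi1 P v) ≤ 2 * (l2Sq P.dom (u - v) + l2Sq P.dom (v - Pi1 P v)) := by
    rw [show u - Pi1 P v = (u - v) + (v - Pi1 P v) by abel]
    exact l2Sq_add_le (hu.1.sub hv.1) (hv.1.sub hq.1)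
  have h2 := hK.l2Sq_sub_Pi1_le hρ hv
  have h3 := h1SemiSq_sub_Pi1_le hu hv
  have hC := poincareConst_pos ρ
  have n1 := h1SemiSq_nonneg P.dom (v - Pi1 P v)
  have n2 := h1SemiSq_nonneg P.dom (u - v)
  have n3 := h1SemiSq_nonneg P.dom (u - Pi1 P v)
  have n4 := l2Sq_nonneg P.dom (u - v)
  have hh2 : P.h ^ 2 ≤ 1 := pow_le_one₀ P.h_pos.le hh
  have h4 : poincareConst ρ * P.h ^ 2 * h1SemiSq P.dom (v - Pi1 P v) ≤
      poincareConst ρ * (2 * (h1SemiSq P.dom (u - v) + h1SemiSq P.dom (u - Pi1 P v))) := by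
    calc _ ≤ poincareConst ρ * 1 * h1SemiSq P.dom (v - Pi1 P v) := by gcongr
      _ ≤ _ := by rw [mul_one]; gcongr
  have n5 := mul_nonneg hC.le n4
  simp only [h1NormSq]
  nlinarith

/-! ### The stabilization -/

lemma aForm_le {co : Coeffs} {U : Set E2} {a₀ a₁ : ℝ} (ha₀ : 0 < a₀)
    (he : co.Elliptic U a₀ a₁) (hv : MemH1 U v) : co.aForm U v v ≤ a₁ * h1SemiSq U v := by
  rw [Coeffs.aForm, h1SemiSq, l2Sq, ← integral_const_mul]
  refine integral_mono_of_nonneg ?_ ((integrable_norm_sq hv.memLp_weakGrad).const_mul a₁) ?_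
  · filter_upwards [he] with x hx
    exact le_trans (by positivity) (hx.2 _).1
  · filter_upwards [he] with x hx
    exact (hx.2 _).2

lemma Coeffs.Elliptic.mono {co : Coeffs} {U W : Set E2} {a₀ a₁ : ℝ} (hWU : W ⊆ U)
    (h : co.Elliptic U a₀ a₁) : co.Elliptic W a₀ a₁ :=
  ae_restrict_of_ae_restrict_of_subset hWU h

lemma Coeffs.BoundedBy.mono {co : Coeffs} {U W : Set E2} {M : ℝ} (hWU : W ⊆ U)
    (h : co.BoundedBy U M) : co.BoundedBy W M :=
  ae_restrict_of_ae_restrict_of_subset hWU h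

/-- `v - Π₁ v` is a member of `V_h(P)` in the kernel of `Π₁`, where `S` is bounded by `Cs` times the
energy and the energy by `a₁` times the squared seminorm. -/
lemma zetaSq_le {co : Coeffs} {r a₀ a₁ Cs : ℝ} (ha₀ : 0 < a₀) (ha₁ : 0 < a₁) (hCs : 0 < Cs)
    (hK : StarBall P.carrier c r) (he : co.Elliptic P.dom a₀ a₁)
    {S : LinearMap.BilinForm ℝ (E2 → ℝ)} (hS : co.IsStabilization P Cs S)
    (hu : MemH1 P.dom u) (hv : MemVhLoc P v) :
    zetaSq P S v ≤ 2 * Cs * a₁ *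
      (h1SemiSq P.dom (u - v) + h1SemiSq P.dom (u - Pi1 P v)) := by
  have hv1 : MemH1 P.dom v := hv.1.1
  have hq := (isL2Proj_Pi1 hv1.1).1
  have h1 := (hS.2.2 _ (hv.sub_affine hK hq) (Pi1_sub_Pi1 hv1.1)).2
  have h2 := aForm_le ha₀ he (hv1.sub (hq.memH1 P))
  have h3 := h1SemiSq_sub_Pi1_le hu hv1
  calc zetaSq P S v ≤ Cs * (a₁ * (2 * (h1SemiSq P.dom (u - v) + h1SemiSq P.dom (u - Pi1 P v)))) :=
        h1.trans (by gcongr; exact h2.trans (by gcongr))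
    _ = _ := by ring

/-! ### The inconsistency term -/

/-- Pythagoras: `F - Π₀ F` is orthogonal to constants. -/
lemma l2Sq_sub_Pi0_le {F : E2 → E2} (hF : MemLp F 2 (volume.restrict P.dom)) (m : E2) :
    l2Sq P.dom (fun x => F x - Pi0 P F) ≤ l2Sq P.dom (fun x => F x - m) := by
  have hfin : IsFiniteMeasure (volume.restrict P.dom) :=
    ⟨by rw [Measure.restrict_apply_univ]; exact P.isBounded_dom.measure_lt_top⟩
  set n := Pi0 P F with hn
  have hFi : Integrable F (volume.restrict P.dom) := hF.integrable (by norm_num)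
  have hw : MemLp (fun x => F x - n) 2 (volume.restrict P.dom) := hF.sub (memLp_const n)
  have hw0 : ∫ x in P.dom, (F x - n) = 0 := by
    have := integral_sub_average (volume.restrict P.dom) F
    exact this
  have e : ∀ x, ‖F x - m‖ ^ 2 = ‖F x - n‖ ^ 2 + 2 * inner ℝ (n - m) (F x - n) + ‖n - m‖ ^ 2 := by
    intro x
    rw [show F x - m = (n - m) + (F x - n) by abel, norm_add_sq_real]
    ring
  have i2 : Integrable (fun x => 2 * inner ℝ (n - m) (F x - n)) (volume.restrict P.dom) :=
    ((hw.integrable (by norm_num)).const_inner (n - m)).const_mul 2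
  have i1 := integrable_norm_sq hw
  have i3 : Integrable (fun x => ‖F x - n‖ ^ 2 + 2 * inner ℝ (n - m) (F x - n))
    (volume.restrict P.dom) := i1.add i2
  simp only [l2Sq, e]
  rw [integral_add i3 (integrable_const _), integral_add i1 i2,
    integral_const_mul, integral_inner (hw.integrable (by norm_num)), hw0, inner_zero_right]
  have : 0 ≤ ∫ _ in P.dom, ‖n - m‖ ^ 2 := integral_nonneg fun _ => by positivity
  linarith

variable {co : Coeffs} {M : ℝ}

/-- The coefficients are continuous on the cell. -/
def ContCoeffs (co : Coeffs) (U : Set E2) : Prop :=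
  ContinuousOn co.A U ∧ ContinuousOn co.b U ∧ ContinuousOn co.γ U

/-- Continuity on the cell provides measurability of the coefficients; their size enters through
`M`. -/
lemma memLp_A {U : Set E2} (hU : IsOpen U) (hc : ContCoeffs co U) (hb : co.BoundedBy U M)
    {g : E2 → E2} (hg : MemLp g 2 (volume.restrict U)) :
    MemLp (fun x => co.A x (g x)) 2 (volume.restrict U) := by
  refine MemLp.of_le_mul (c := M) hg ?_ ?_
  · exact (ContinuousLinearMap.id ℝ (E2 →L[ℝ] E2)).aestronglyMeasurable_comp₂
      (hc.1.aestronglyMeasurable hU.measurableSet) hg.1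
  · filter_upwards [hb] with x hx
    exact ContinuousLinearMap.le_of_opNorm_le _ hx.1 _

lemma memLp_b {U : Set E2} (hU : IsOpen U) (hc : ContCoeffs co U) (hb : co.BoundedBy U M)
    {v : E2 → ℝ} (hv : MemLp v 2 (volume.restrict U)) :
    MemLp (fun x => v x • co.b x) 2 (volume.restrict U) := by
  refine MemLp.of_le_mul (c := M) hv ?_ ?_
  · exact hv.1.smul (hc.2.1.aestronglyMeasurable hU.measurableSet)
  · filter_upwards [hb] with x hx
    rw [norm_smul, mul_comm]
    gcongr
    exact hx.2.1

lemma memLp_γ {U : Set E2} (hU : IsOpen U) (hc : ContCoeffs co U) (hb : co.BoundedBy U M)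
    {v : E2 → ℝ} (hv : MemLp v 2 (volume.restrict U)) :
    MemLp (fun x => co.γ x * v x) 2 (volume.restrict U) := by
  refine MemLp.of_le_mul (c := M) hv ?_ ?_
  · exact (hc.2.2.aestronglyMeasurable hU.measurableSet).mul hv.1
  · filter_upwards [hb] with x hx
    rw [norm_mul]
    gcongr
    exact hx.2.2

lemma memLp_flux {U W : Set E2} (hW : IsOpen W) (hWU : W ⊆ U) (hc : ContCoeffs co W)
    (hb : co.BoundedBy W M) (hv : MemH1 U v) : MemLp (co.flux U v) 2 (volume.restrict W) :=
  (memLp_A hW hc hb (hv.memLp_weakGrad.mono_measure (Measure.restrict_mono hWU le_rfl))).add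
    (memLp_b hW hc hb (hv.1.mono_measure (Measure.restrict_mono hWU le_rfl)))

/-- The mean of the discrete flux is replaced by the mean of the exact flux, and the difference of
the two fluxes is the flux of `u - Π₁ v`. -/
lemma lambdaSq_le {Ω : Set E2} (hρ : 0 < ρ) (hK : StarBall P.carrier c (ρ * P.h)) (hh : P.h ≤ 1)
    (hPΩ : P.dom ⊆ Ω) (hc : ContCoeffs co P.dom) (hb : co.BoundedBy P.dom M)
    (hu : MemH1 Ω u) (hv : MemH1 P.dom v) :
    lambdaSq co P v ≤ (2 + 4 * M ^ 2 * (3 + 4 * poincareConst ρ)) *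
      (h1NormSq P.dom (u - v) + h1SemiSq P.dom (u - Pi1 P v) + approxSq P (co.flux Ω u)) := by
  have hDo := P.isOpen_dom
  have hu1 := hu.mono hPΩ
  have hq := (isL2Proj_Pi1 hv.1).1.memH1 P
  have hw := hu1.sub hq
  set F := co.flux Ω u with hF
  set G := co.flux P.dom (Pi1 P v) with hG
  have hFm : MemLp F 2 (volume.restrict P.dom) := memLp_flux hDo hPΩ hc hb hu
  have hGm : MemLp G 2 (volume.restrict P.dom) := memLp_flux hDo subset_rfl hc hb hq
  have hfin : IsFiniteMeasure (volume.restrict P.dom) :=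
    ⟨by rw [Measure.restrict_apply_univ]; exact P.isBounded_dom.measure_lt_top⟩
  have h1 : lambdaSq co P v ≤ l2Sq P.dom (fun x => G x - Pi0 P F) := l2Sq_sub_Pi0_le hGm _
  have h2 : l2Sq P.dom (fun x => G x - Pi0 P F) ≤
      2 * (approxSq P F + l2Sq P.dom (F - G)) := by
    have e : (fun x => G x - Pi0 P F) = (fun x => F x - Pi0 P F) - (F - G) := by
      ext1 x; simp only [Pi.sub_apply]; abel
    rw [e]
    exact l2Sq_sub_le (hFm.sub (memLp_const _)) (hFm.sub hGm)
  have h3 : l2Sq P.dom (F - G) ≤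
      2 * M ^ 2 * (h1SemiSq P.dom (u - Pi1 P v) + l2Sq P.dom (u - Pi1 P v)) := by
    have hae : F - G =ᵐ[volume.restrict P.dom] (fun x => co.A x (weakGrad P.dom (u - Pi1 P v) x)) +
        fun x => (u - Pi1 P v) x • co.b x := by
      filter_upwards [hu.weakGrad_mono hDo hPΩ, hu1.weakGrad_sub hDo hq] with x e1 e2
      simp only [hF, hG, Coeffs.flux, Pi.sub_apply, Pi.add_apply, e2, e1, map_sub, sub_smul]
      abel
    rw [l2Sq_congr hae]
    refine (l2Sq_add_le (memLp_A hDo hc hb hw.memLp_weakGrad) (memLp_b hDo hc hb hw.1)).trans ?_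
    have b1 : l2Sq P.dom (fun x => co.A x (weakGrad P.dom (u - Pi1 P v) x)) ≤
        M ^ 2 * l2Sq P.dom (weakGrad P.dom (u - Pi1 P v)) := by
      refine l2Sq_le_of_ae_le hw.memLp_weakGrad ?_
      filter_upwards [hb] with x hx
      rw [← mul_pow]
      exact pow_le_pow_left₀ (norm_nonneg _) (ContinuousLinearMap.le_of_opNorm_le _ hx.1 _) 2
    have b2 : l2Sq P.dom (fun x => (u - Pi1 P v) x • co.b x) ≤
        M ^ 2 * l2Sq P.dom (u - Pi1 P v) := by
      refine l2Sq_le_of_ae_le hw.1 ?_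
      filter_upwards [hb] with x hx
      rw [norm_smul, mul_comm, mul_pow]
      gcongr
      exact hx.2.1
    rw [h1SemiSq]
    linarith
  have h4 := hK.l2Sq_sub_Pi1_le' hρ hh hu1 hv
  have hC := poincareConst_pos ρ
  have n1 := h1NormSq_nonneg P.dom (u - v)
  have n2 := h1SemiSq_nonneg P.dom (u - Pi1 P v)
  have n3 : 0 ≤ approxSq P F := l2Sq_nonneg _ _
  set X := h1NormSq P.dom (u - v) + h1SemiSq P.dom (u - Pi1 P v) with hX
  have h5 : h1SemiSq P.dom (u - Pi1 P v) + l2Sq P.dom (u - Pi1 P v) ≤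
      (3 + 4 * poincareConst ρ) * X := by nlinarith
  have h6 := mul_le_mul_of_nonneg_left h5 (show 0 ≤ 2 * M ^ 2 by positivity)
  have n4 : 0 ≤ X := by linarith
  have n5 : 0 ≤ M ^ 2 * (3 + 4 * poincareConst ρ) * approxSq P F := by positivity
  nlinarith

end Cell

end NCVEM

namespace NCVEM

/-! ### Bubble functions -/

section Bubble

/-- A fixed smooth bump function on the unit ball. -/
noncomputable def refBump : ContDiffBump (0 : E2) := ⟨1 / 2, 3 / 4, by norm_num, by norm_num⟩

lemma exists_refBump_bound : ∃ L : ℝ, 0 < L ∧ ∀ x, ‖fderiv ℝ refBump x‖ ≤ L := by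
  have hc : Continuous (fderiv ℝ refBump) := (refBump.contDiff (n := 1)).continuous_fderiv (by simp)
  obtain ⟨L, hL⟩ := (refBump.hasCompactSupport.fderiv ℝ).exists_bound_of_continuous hc
  exact ⟨max L 1, by positivity, fun x => (hL x).trans (le_max_left _ _)⟩

/-- A bound for the gradient of `refBump`. -/
noncomputable def bumpConst : ℝ := exists_refBump_bound.choose

lemma bumpConst_pos : 0 < bumpConst := exists_refBump_bound.choose_spec.1

lemma norm_fderiv_refBump_le (x : E2) : ‖fderiv ℝ refBump x‖ ≤ bumpConst :=
  exists_refBump_bound.choose_spec.2 x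

/-- The bubble function on the ball `B(c, r)`. -/
noncomputable def bubble (c : E2) (r : ℝ) (x : E2) : ℝ := refBump (r⁻¹ • (x - c))

variable {c : E2} {r : ℝ}

lemma contDiff_bubble (c : E2) (r : ℝ) : ContDiff ℝ ∞ (bubble c r) :=
  refBump.contDiff.comp (f := fun x => r⁻¹ • (x - c)) (by fun_prop)

lemma bubble_nonneg (x : E2) : 0 ≤ bubble c r x := refBump.nonneg

lemma bubble_le_one (x : E2) : bubble c r x ≤ 1 := refBump.le_one

lemma norm_inv_smul_sub (hr : 0 < r) (x : E2) : ‖r⁻¹ • (x - c)‖ = dist x c / r := by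
  rw [norm_smul, norm_inv, Real.norm_of_nonneg hr.le, dist_eq_norm, inv_mul_eq_div]

lemma bubble_eq_one (hr : 0 < r) {x : E2} (hx : dist x c ≤ r / 2) : bubble c r x = 1 := by
  refine refBump.one_of_mem_closedBall ?_
  rw [mem_closedBall_zero_iff, norm_inv_smul_sub hr]
  change _ ≤ (1 / 2 : ℝ)
  rw [div_le_iff₀ hr]
  linarith

lemma tsupport_bubble_subset (hr : 0 < r) :
    tsupport (bubble c r) ⊆ Metric.closedBall c (3 / 4 * r) := by
  refine closure_minimal (fun x hx => ?_) Metric.isClosed_closedBall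
  have h1 : r⁻¹ • (x - c) ∈ Function.support refBump := hx
  rw [refBump.support_eq, mem_ball_zero_iff, norm_inv_smul_sub hr] at h1
  have h2 : dist x c / r < 3 / 4 := h1
  rw [div_lt_iff₀ hr] at h2
  exact Metric.mem_closedBall.2 h2.le

lemma norm_fderiv_bubble_le (hr : 0 < r) (x : E2) :
    ‖fderiv ℝ (bubble c r) x‖ ≤ bumpConst / r := by
  have h1 : HasFDerivAt (fun x : E2 => r⁻¹ • (x - c)) (r⁻¹ • ContinuousLinearMap.id ℝ E2) x :=
    ((hasFDerivAt_id x).sub_const c).const_smul r⁻¹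
  have h2 : HasFDerivAt refBump (fderiv ℝ refBump (r⁻¹ • (x - c))) (r⁻¹ • (x - c)) :=
    ((refBump.contDiff (n := 1)).differentiable (by simp) _).hasFDerivAt
  have h3 := (h2.comp x h1).fderiv
  rw [show bubble c r = refBump ∘ fun x => r⁻¹ • (x - c) from rfl, h3]
  refine (ContinuousLinearMap.opNorm_comp_le _ _).trans ?_
  have h4 : ‖r⁻¹ • ContinuousLinearMap.id ℝ E2‖ ≤ r⁻¹ := by
    rw [norm_smul, norm_inv, Real.norm_of_nonneg hr.le]
    exact mul_le_of_le_one_right (inv_pos.2 hr).le ContinuousLinearMap.norm_id_le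
  rw [div_eq_mul_inv]
  exact mul_le_mul (norm_fderiv_refBump_le _) h4 (norm_nonneg _) bumpConst_pos.le

end Bubble

/-! ### Young inequalities and norm equivalence for affine functions -/

section Affine

variable {P : Polygon} {ρ : ℝ} {c : E2} {p : E2 → ℝ}

lemma inner_mul_le_young {U : Set E2} {f g : E2 → E2} (hf : MemLp f 2 (volume.restrict U))
    (hg : MemLp g 2 (volume.restrict U)) {δ : ℝ} (hδ : 0 < δ) :
    ∫ x in U, inner ℝ (f x) (g x) ≤ δ / 2 * l2Sq U g + (2 * δ)⁻¹ * l2Sq U f := by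
  rw [l2Sq, l2Sq, ← integral_const_mul, ← integral_const_mul,
    ← integral_add ((integrable_norm_sq hg).const_mul _) ((integrable_norm_sq hf).const_mul _)]
  refine integral_mono (integrable_inner hf hg)
    (((integrable_norm_sq hg).const_mul _).add ((integrable_norm_sq hf).const_mul _)) fun x => ?_
  refine (real_inner_le_norm _ _).trans ?_
  have h : 0 ≤ (δ * ‖g x‖ - ‖f x‖) ^ 2 / (2 * δ) := by positivity
  have e : (δ * ‖g x‖ - ‖f x‖) ^ 2 / (2 * δ) =
      δ / 2 * ‖g x‖ ^ 2 + (2 * δ)⁻¹ * ‖f x‖ ^ 2 - ‖f x‖ * ‖g x‖ := by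
    field_simp; ring
  rw [e] at h
  linarith

lemma mul_le_young {U : Set E2} {f g : E2 → ℝ} (hf : MemLp f 2 (volume.restrict U))
    (hg : MemLp g 2 (volume.restrict U)) {δ : ℝ} (hδ : 0 < δ) :
    ∫ x in U, f x * g x ≤ δ / 2 * l2Sq U g + (2 * δ)⁻¹ * l2Sq U f := by
  rw [l2Sq, l2Sq, ← integral_const_mul, ← integral_const_mul,
    ← integral_add ((integrable_norm_sq hg).const_mul _) ((integrable_norm_sq hf).const_mul _)]
  refine integral_mono (hf.integrable_mul hg)
    (((integrable_norm_sq hg).const_mul _).add ((integrable_norm_sq hf).const_mul _)) fun x => ?_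
  have h : 0 ≤ (δ * g x - f x) ^ 2 / (2 * δ) := by positivity
  have e : (δ * g x - f x) ^ 2 / (2 * δ) =
      δ / 2 * ‖g x‖ ^ 2 + (2 * δ)⁻¹ * ‖f x‖ ^ 2 - f x * g x := by
    rw [Real.norm_eq_abs, Real.norm_eq_abs, sq_abs, sq_abs]
    field_simp; ring
  rw [e] at h
  change f x * g x ≤ δ / 2 * ‖g x‖ ^ 2 + (2 * δ)⁻¹ * ‖f x‖ ^ 2
  linarith

/-- An affine function is large on a ball of radius `r / 8` near the centre. -/
lemma exists_ball_affine_ge {r : ℝ} (hr : 0 < r) (c g : E2) (α : ℝ) :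
    ∃ z : E2, dist z c ≤ r / 4 ∧ ∀ x ∈ Metric.ball z (r / 8),
      |α| + ‖g‖ * (r / 8) ≤ |α + inner ℝ g (x - c)| := by
  obtain ⟨e, he, hge⟩ : ∃ e : E2, ‖e‖ ≤ 1 ∧ inner ℝ g e = ‖g‖ := by
    rcases eq_or_ne g 0 with rfl | hg
    · exact ⟨0, by simp, by simp⟩
    · have : ‖g‖ ≠ 0 := norm_ne_zero_iff.2 hg
      refine ⟨‖g‖⁻¹ • g, ?_, ?_⟩
      · rw [norm_smul, norm_inv, norm_norm, inv_mul_cancel₀ this]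
      · rw [inner_smul_right, real_inner_self_eq_norm_sq]
        field_simp
  obtain ⟨s, hs, hα⟩ : ∃ s : ℝ, |s| = 1 ∧ s * α = |α| := by
    rcases le_total 0 α with h | h
    · exact ⟨1, by simp, by rw [abs_of_nonneg h, one_mul]⟩
    · exact ⟨-1, by simp, by rw [abs_of_nonpos h]; ring⟩
  have hss : s * s = 1 := by rw [← abs_mul_abs_self, hs, one_mul]
  -- The shift goes where the linear part has the sign `s` of `α`, so the two terms add up. At the
  -- new centre the linear part has size `‖g‖ r / 4`, and it varies by at most `‖g‖ r / 8` on the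
  -- ball.
  refine ⟨c + (s * (r / 4)) • e, ?_, fun x hx => ?_⟩
  · rw [dist_eq_norm, add_sub_cancel_left, norm_smul, Real.norm_eq_abs, abs_mul, hs, one_mul,
      abs_of_pos (by positivity)]
    exact mul_le_of_le_one_right (by positivity) he
  · rw [Metric.mem_ball, dist_eq_norm] at hx
    set y := x - (c + (s * (r / 4)) • e) with hy
    have h1 : x - c = (s * (r / 4)) • e + y := by rw [hy]; abel
    have h2 : |inner ℝ g y| ≤ ‖g‖ * (r / 8) :=
      (abs_real_inner_le_norm _ _).trans (by gcongr)
    rw [h1, inner_add_right, inner_smul_right, hge]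
    have h3 : s * (α + (s * (r / 4) * ‖g‖ + inner ℝ g y)) =
        |α| + r / 4 * ‖g‖ + s * inner ℝ g y := by
      linear_combination hα + (r / 4 * ‖g‖) * hss
    have h4 : |s * inner ℝ g y| ≤ ‖g‖ * (r / 8) := by rwa [abs_mul, hs, one_mul]
    calc |α| + ‖g‖ * (r / 8) ≤ |α| + r / 4 * ‖g‖ + s * inner ℝ g y := by
          linarith [(abs_le.1 h4).1]
      _ ≤ |s * (α + (s * (r / 4) * ‖g‖ + inner ℝ g y))| := by rw [h3]; exact le_abs_self _
      _ = _ := by rw [abs_mul, hs, one_mul]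

/-- Norm equivalence for affine functions on a regular cell. -/
lemma StarBall.affine_bounds (hρ : 0 < ρ) (hK : StarBall P.carrier c (ρ * P.h))
    {d : ℝ} {g : E2} (hp : ∀ x, p x = d + inner ℝ g x) :
    l2Sq P.dom p ≤ (8 / ρ) ^ 4 * ∫ x in P.dom, bubble c (ρ * P.h) x * p x ^ 2 ∧
      ∫ _ in P.dom, ‖g‖ ^ 2 ≤ (8 / ρ) ^ 4 * (P.h ^ 2)⁻¹ * l2Sq P.dom p := by
  have hh := P.h_pos
  have hr := hK.pos
  set h := P.h with hhdef
  set r := ρ * h with hrdef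
  -- This is the ratio of `h` to the radius `r / 8` of the small ball `B`. On `B` the function is at
  -- least `N` in modulus and on the whole cell at most `κ N`.
  set κ := 8 / ρ with hκ
  have hκ0 : 0 < κ := by positivity
  have hpa : IsAffine p := ⟨d, g, hp⟩
  have hDm : MeasurableSet P.dom := P.isOpen_dom.measurableSet
  have hDfin : volume P.dom ≠ ⊤ := P.isBounded_dom.measure_lt_top.ne
  have hfin : IsFiniteMeasure (volume.restrict P.dom) :=
    ⟨by rw [Measure.restrict_apply_univ]; exact P.isBounded_dom.measure_lt_top⟩
  set α := d + inner ℝ g c with hα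
  have hpα : ∀ x, p x = α + inner ℝ g (x - c) := fun x => by
    rw [hp x, hα, inner_sub_right]; ring
  obtain ⟨z, hz, hball⟩ := exists_ball_affine_ge hr c g α
  set B := Metric.ball z (r / 8) with hB
  set N := |α| + ‖g‖ * (r / 8) with hN
  have hN0 : 0 ≤ N := by positivity
  have hBc : ∀ x ∈ B, dist x c ≤ r / 2 := fun x hx => by
    have := Metric.mem_ball.1 hx
    linarith [dist_triangle x z c]
  have hBD : B ⊆ P.dom := fun x hx => hK.ball_subset (Metric.mem_ball.2 (by
    linarith [hBc x hx]))
  have hcD : c ∈ P.dom := hK.ball_subset (Metric.mem_ball_self hr)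
  have hdist : ∀ x ∈ P.dom, dist x c ≤ h := fun x hx =>
    Metric.dist_le_diam_of_mem P.isCompact.isBounded (interior_subset hx) (interior_subset hcD)
  have hκr : κ * (r / 8) = h := by rw [hκ, hrdef]; field_simp
  -- `r ≤ 2 h`, hence `1 ≤ κ`
  have hκ1 : 1 ≤ κ := by
    have e1 : ‖(EuclideanSpace.single 0 1 : E2)‖ = 1 := by simp
    have hx : c + (r / 2) • (EuclideanSpace.single 0 1 : E2) ∈ P.dom := by
      refine hK.ball_subset (Metric.mem_ball.2 ?_)
      rw [dist_eq_norm, add_sub_cancel_left, norm_smul, e1, Real.norm_of_nonneg (by positivity)]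
      linarith
    have := hdist _ hx
    rw [dist_eq_norm, add_sub_cancel_left, norm_smul, e1,
      Real.norm_of_nonneg (by positivity), mul_one] at this
    by_contra hlt
    push Not at hlt
    have : κ * (r / 8) < 1 * (r / 8) := mul_lt_mul_of_pos_right hlt (by positivity)
    linarith
  have hsup : ∀ x ∈ P.dom, p x ^ 2 ≤ (κ * N) ^ 2 := by
    intro x hx
    rw [← sq_abs]
    refine pow_le_pow_left₀ (abs_nonneg _) ?_ 2
    calc |p x| ≤ |α| + |inner ℝ g (x - c)| := by rw [hpα]; exact abs_add_le _ _
      _ ≤ |α| + ‖g‖ * h := by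
        gcongr
        refine (abs_real_inner_le_norm _ _).trans ?_
        gcongr
        rw [← dist_eq_norm]; exact hdist x hx
      _ ≤ κ * |α| + ‖g‖ * h := by
        gcongr
        exact le_mul_of_one_le_left (abs_nonneg _) hκ1
      _ = κ * N := by rw [hN, ← hκr]; ring
  have hvol : volume.real P.dom ≤ κ ^ 2 * volume.real B := by
    have h1 : P.dom ⊆ Metric.closedBall c h := fun x hx => Metric.mem_closedBall.2 (hdist x hx)
    have h2 : volume.real (Metric.closedBall c h) = κ ^ 2 * volume.real B := by
      simp only [Measure.real]
      rw [hB, Measure.addHaar_closedBall _ _ hh.le,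
        Measure.addHaar_ball volume z (r := r / 8) (by positivity),
        ENNReal.toReal_mul, ENNReal.toReal_mul, ENNReal.toReal_ofReal (by positivity),
        ENNReal.toReal_ofReal (by positivity), ← mul_assoc]
      simp only [finrank_euclideanSpace, Fintype.card_fin]
      rw [← mul_pow, hκr]
    rw [← h2]
    exact measureReal_mono h1 measure_closedBall_lt_top.ne
  have hi1 : IntegrableOn (fun x => p x ^ 2) P.dom := (hpa.memLp P).integrable_sq
  have hi2 : IntegrableOn (fun x => bubble c r x * p x ^ 2) P.dom := by
    refine Integrable.mono' hi1 (((contDiff_bubble c r).continuous.mul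
      (hpa.contDiff.continuous.pow 2)).aestronglyMeasurable) (ae_of_all _ fun x => ?_)
    rw [Real.norm_of_nonneg (mul_nonneg (bubble_nonneg x) (sq_nonneg _))]
    exact mul_le_of_le_one_left (sq_nonneg _) (bubble_le_one x)
  have hlow : volume.real B * N ^ 2 ≤ ∫ x in P.dom, bubble c r x * p x ^ 2 := by
    calc volume.real B * N ^ 2 = ∫ _ in B, N ^ 2 := by
          rw [setIntegral_const, smul_eq_mul]
      _ ≤ ∫ x in B, bubble c r x * p x ^ 2 := by
          refine setIntegral_mono_on (integrableOn_const measure_ball_lt_top.ne)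
            (hi2.mono_set hBD) measurableSet_ball fun x hx => ?_
          rw [bubble_eq_one hr (hBc x hx), one_mul, hpα, ← sq_abs (α + _)]
          exact pow_le_pow_left₀ hN0 (hball x hx) 2
      _ ≤ _ := setIntegral_mono_set hi2
          (ae_of_all _ fun x => mul_nonneg (bubble_nonneg x) (sq_nonneg _)) hBD.eventuallyLE
  have hbub : ∫ x in P.dom, bubble c r x * p x ^ 2 ≤ l2Sq P.dom p := by
    refine setIntegral_mono_on hi2 (by simpa [IntegrableOn] using integrable_norm_sq (hpa.memLp P))
      hDm fun x _ => ?_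
    rw [Real.norm_eq_abs, sq_abs]
    exact mul_le_of_le_one_left (sq_nonneg _) (bubble_le_one x)
  have hB0 : 0 ≤ volume.real B := measureReal_nonneg
  constructor
  -- The power `κ ^ 4` consists of `κ ^ 2` from the values and `κ ^ 2` from the ratio of areas.
  · calc l2Sq P.dom p ≤ ∫ _ in P.dom, (κ * N) ^ 2 := by
          refine setIntegral_mono_on (integrable_norm_sq (hpa.memLp P)) (integrable_const _) hDm
            fun x hx => ?_
          rw [Real.norm_eq_abs, sq_abs]
          exact hsup x hx
      _ = volume.real P.dom * (κ * N) ^ 2 := by rw [setIntegral_const, smul_eq_mul]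
      _ ≤ κ ^ 2 * volume.real B * (κ * N) ^ 2 := by gcongr
      _ = κ ^ 4 * (volume.real B * N ^ 2) := by ring
      _ ≤ _ := by gcongr
  · have hgN : ‖g‖ ^ 2 ≤ κ ^ 2 * (h ^ 2)⁻¹ * N ^ 2 := by
      have h1 : ‖g‖ * h ≤ κ * N := by
        rw [← hκr, hN]
        nlinarith [abs_nonneg α, mul_nonneg hκ0.le (abs_nonneg α)]
      have h2 : (‖g‖ * h) ^ 2 ≤ (κ * N) ^ 2 := pow_le_pow_left₀ (by positivity) h1 2
      rw [mul_comm (κ ^ 2), mul_assoc, inv_mul_eq_div, le_div_iff₀ (by positivity)]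
      nlinarith
    calc ∫ _ in P.dom, ‖g‖ ^ 2 = volume.real P.dom * ‖g‖ ^ 2 := by
          rw [setIntegral_const, smul_eq_mul]
      _ ≤ κ ^ 2 * volume.real B * (κ ^ 2 * (h ^ 2)⁻¹ * N ^ 2) := by gcongr
      _ = κ ^ 4 * (h ^ 2)⁻¹ * (volume.real B * N ^ 2) := by ring
      _ ≤ _ := by gcongr; exact hlow.trans hbub

end Affine

/-! ### The volume residual -/

section Residual

variable {P : Polygon} {ρ : ℝ} {c : E2} {p : E2 → ℝ}

/-- The constant in the inverse estimate for bubble functions times affine functions. -/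
noncomputable def inverseConst (ρ : ℝ) : ℝ := 2 * ((bumpConst / ρ) ^ 2 + (8 / ρ) ^ 4)

lemma inverseConst_pos {ρ : ℝ} (hρ : 0 < ρ) : 0 < inverseConst ρ := by
  unfold inverseConst; positivity

/-- By the product rule the gradient is `p ∇ψ + ψ g`. The bubble has gradient of order `(ρ h)⁻¹`,
and the constant gradient `g` of `p` is bounded through `affine_bounds`. -/
lemma StarBall.l2Sq_gradient_bubble_le (hρ : 0 < ρ) (hK : StarBall P.carrier c (ρ * P.h))
    (hp : IsAffine p) :
    l2Sq P.dom (gradient (bubble c (ρ * P.h) * p)) ≤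
      inverseConst ρ * (P.h ^ 2)⁻¹ * l2Sq P.dom p := by
  obtain ⟨d, g, hdg⟩ := id hp
  have hh := P.h_pos
  have hfin : IsFiniteMeasure (volume.restrict P.dom) :=
    ⟨by rw [Measure.restrict_apply_univ]; exact P.isBounded_dom.measure_lt_top⟩
  have h2 := (hK.affine_bounds hρ hdg).2
  set L := bumpConst / (ρ * P.h) with hL
  have hpt : ∀ x, ‖gradient (bubble c (ρ * P.h) * p) x‖ ^ 2 ≤
      2 * (L ^ 2 * ‖p x‖ ^ 2 + ‖g‖ ^ 2) := by
    intro x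
    have d1 := (contDiff_bubble c (ρ * P.h)).differentiable (by simp) x
    have d2 := hp.contDiff.differentiable (by simp) x
    have e : fderiv ℝ (bubble c (ρ * P.h) * p) x =
        bubble c (ρ * P.h) x • fderiv ℝ p x + p x • fderiv ℝ (bubble c (ρ * P.h)) x :=
      fderiv_mul d1 d2
    rw [norm_gradient, e]
    refine (norm_add_sq_le _ _).trans ?_
    rw [add_comm]
    have b1 : ‖p x • fderiv ℝ (bubble c (ρ * P.h)) x‖ ^ 2 ≤ L ^ 2 * ‖p x‖ ^ 2 := by
      rw [norm_smul, mul_comm, mul_pow]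
      gcongr
      exact norm_fderiv_bubble_le hK.pos x
    have b2 : ‖bubble c (ρ * P.h) x • fderiv ℝ p x‖ ^ 2 ≤ ‖g‖ ^ 2 := by
      rw [norm_smul, ← norm_gradient, gradient_affine hdg, Real.norm_of_nonneg (bubble_nonneg x)]
      refine pow_le_pow_left₀ (mul_nonneg (bubble_nonneg x) (norm_nonneg _)) ?_ 2
      exact mul_le_of_le_one_left (norm_nonneg _) (bubble_le_one x)
    gcongr
  have i1 := integrable_norm_sq (hp.memLp P)
  have h1 : l2Sq P.dom (gradient (bubble c (ρ * P.h) * p)) ≤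
      2 * (L ^ 2 * l2Sq P.dom p + ∫ _ in P.dom, ‖g‖ ^ 2) := by
    rw [l2Sq, l2Sq, ← integral_const_mul, ← integral_add (i1.const_mul _) (integrable_const _),
      ← integral_const_mul]
    exact integral_mono_of_nonneg (ae_of_all _ fun _ => by positivity)
      (((i1.const_mul _).add (integrable_const _)).const_mul 2) (ae_of_all _ hpt)
  refine h1.trans ?_
  have e : L ^ 2 = (bumpConst / ρ) ^ 2 * (P.h ^ 2)⁻¹ := by
    rw [hL]; field_simp
  rw [e, inverseConst]
  nlinarith

lemma memH10_of_contDiff {U : Set E2} (hUo : IsOpen U) (hUb : Bornology.IsBounded U)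
    {φ : E2 → ℝ} (hφ : ContDiff ℝ ∞ φ) (hc : HasCompactSupport φ) (hs : tsupport φ ⊆ U) :
    MemH10 U φ :=
  ⟨memH1_of_contDiff hUb hφ, fun _ => φ, fun _ => ⟨hφ, hc, hs⟩, by simp [h1NormSq_zero hUo]⟩

variable {co : Coeffs} {M : ℝ} {Ω : Set E2} {f u : E2 → ℝ}

/-- The weak equation tested with a function supported in a cell. -/
lemma integral_flux_gradient (hΩo : IsOpen Ω) (hΩb : Bornology.IsBounded Ω) (hPΩ : P.dom ⊆ Ω)
    (hco : ContCoeffs co P.dom) (hb : co.BoundedBy P.dom M) (hf : MemLp f 2 (volume.restrict Ω))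
    (hu : co.IsWeakSolution Ω f u) {w : E2 → ℝ} (hw : ContDiff ℝ ∞ w) (hc : HasCompactSupport w)
    (hs : tsupport w ⊆ P.dom) :
    ∫ x in P.dom, inner ℝ (co.flux Ω u x) (gradient w x) =
      ∫ x in P.dom, (f x - co.γ x * u x) * w x := by
  have hDo := P.isOpen_dom
  have hΩm := hΩo.measurableSet
  have hu1 : MemH1 P.dom u := hu.1.1.mono hPΩ
  have hle : volume.restrict P.dom ≤ volume.restrict Ω := Measure.restrict_mono hPΩ le_rfl
  have hgu : MemLp (weakGrad Ω u) 2 (volume.restrict P.dom) :=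
    hu.1.1.memLp_weakGrad.mono_measure hle
  have hwm : MemLp w 2 (volume.restrict P.dom) :=
    memLp_of_continuous_bounded P.isBounded_dom hw.continuous 2
  have hgw : MemLp (gradient w) 2 (volume.restrict P.dom) :=
    memLp_of_continuous_bounded P.isBounded_dom (continuous_gradient hw) 2
  have heq := hu.2 w (memH10_of_contDiff hΩo hΩb hw hc (hs.trans hPΩ))
  have z : ∀ x, x ∉ P.dom → w x = 0 := fun x hx =>
    image_eq_zero_of_notMem_tsupport fun hh => hx (hs hh)
  have z' : ∀ x, x ∉ P.dom → gradient w x = 0 := fun x hx => by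
    rw [gradient, fderiv_of_notMem_tsupport ℝ fun hh => hx (hs hh), map_zero]
  have hgr := weakGrad_of_contDiff hΩo hΩb hw
  have hA : co.aForm Ω u w = ∫ x in P.dom, inner ℝ (co.A x (weakGrad Ω u x)) (gradient w x) := by
    rw [Coeffs.aForm, integral_congr_ae (hgr.mono fun x hx => by rw [hx])]
    exact setIntegral_eq_of_subset_of_forall_sdiff_eq_zero hΩm hPΩ fun x hx => by
      rw [z' x hx.2, inner_zero_right]
  have hB : co.bForm Ω u w = ∫ x in P.dom, inner ℝ (u x • co.b x) (gradient w x) := by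
    rw [Coeffs.bForm, integral_congr_ae (hgr.mono fun x hx => by rw [hx])]
    simp only [inner_smul_left, conj_trivial]
    exact setIntegral_eq_of_subset_of_forall_sdiff_eq_zero hΩm hPΩ fun x hx => by
      rw [z' x hx.2, inner_zero_right, mul_zero]
  have hC : co.cForm Ω u w = ∫ x in P.dom, co.γ x * u x * w x :=
    setIntegral_eq_of_subset_of_forall_sdiff_eq_zero hΩm hPΩ fun x hx => by
      rw [z x hx.2, mul_zero]
  have hF : ∫ x in Ω, f x * w x = ∫ x in P.dom, f x * w x :=
    setIntegral_eq_of_subset_of_forall_sdiff_eq_zero hΩm hPΩ fun x hx => by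
      rw [z x hx.2, mul_zero]
  rw [Coeffs.BForm, hA, hB, hC, hF] at heq
  have i1 := integrable_inner (memLp_A hDo hco hb hgu) hgw
  have i2 := integrable_inner (memLp_b hDo hco hb hu1.1) hgw
  have i3 : Integrable (fun x => co.γ x * u x * w x) (volume.restrict P.dom) :=
    (memLp_γ hDo hco hb hu1.1).integrable_mul hwm
  have i4 : Integrable (fun x => f x * w x) (volume.restrict P.dom) :=
    (hf.mono_measure hle).integrable_mul hwm
  simp only [Coeffs.flux, inner_add_left, sub_mul]
  rw [integral_add i1 i2, integral_sub i4 i3]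
  linarith

/-- The bubble argument: `‖p‖²` is bounded by a multiple of `∫ ψ p² = ∫ (p - g) w + ∫ g w` with `w =
ψ p`. The first integral is oscillation. The weak equation turns the second into `∫ (σ - Π₀ σ) ·
∇w`, and the inverse estimate bounds `∇w`. -/
lemma StarBall.sq_mul_l2Sq_Pi1_le (hρ : 0 < ρ) (hK : StarBall P.carrier c (ρ * P.h))
    (hΩo : IsOpen Ω) (hΩb : Bornology.IsBounded Ω) (hPΩ : P.dom ⊆ Ω)
    (hco : ContCoeffs co P.dom) (hb : co.BoundedBy P.dom M) (hf : MemLp f 2 (volume.restrict Ω))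
    (hu : co.IsWeakSolution Ω f u) :
    P.h ^ 2 * l2Sq P.dom (Pi1 P fun x => f x - co.γ x * u x) ≤
      2 * ((8 / ρ) ^ 4) ^ 2 * (1 + inverseConst ρ) *
        (approxSq P (co.flux Ω u) + oscSq P fun x => f x - co.γ x * u x) := by
  have hDo := P.isOpen_dom
  have hh := P.h_pos
  have hle : volume.restrict P.dom ≤ volume.restrict Ω := Measure.restrict_mono hPΩ le_rfl
  have hfin : IsFiniteMeasure (volume.restrict P.dom) :=
    ⟨by rw [Measure.restrict_apply_univ]; exact P.isBounded_dom.measure_lt_top⟩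
  have hu1 : MemH1 P.dom u := hu.1.1.mono hPΩ
  set g : E2 → ℝ := fun x => f x - co.γ x * u x with hg
  have hgm : MemLp g 2 (volume.restrict P.dom) :=
    (hf.mono_measure hle).sub (memLp_γ hDo hco hb hu1.1)
  set p := Pi1 P g with hp
  have hpa : IsAffine p := (isL2Proj_Pi1 hgm).1
  have hpm := hpa.memLp P
  set ψ := bubble c (ρ * P.h) with hψ
  set w : E2 → ℝ := ψ * p with hw
  have hwd : ContDiff ℝ ∞ w := (contDiff_bubble c _).mul hpa.contDiff
  have hts : tsupport w ⊆ Metric.closedBall c (3 / 4 * (ρ * P.h)) :=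
    (tsupport_mul_subset_left).trans (tsupport_bubble_subset hK.pos)
  have hwc : HasCompactSupport w :=
    (isCompact_closedBall _ _).of_isClosed_subset (isClosed_tsupport _) hts
  have hws : tsupport w ⊆ P.dom := hts.trans ((Metric.closedBall_subset_ball (by
    have := hK.pos; linarith)).trans hK.ball_subset)
  have hwm : MemLp w 2 (volume.restrict P.dom) :=
    memLp_of_continuous_bounded P.isBounded_dom hwd.continuous 2
  have hgw : MemLp (gradient w) 2 (volume.restrict P.dom) :=
    memLp_of_continuous_bounded P.isBounded_dom (continuous_gradient hwd) 2
  set F := co.flux Ω u with hF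
  have hFm : MemLp F 2 (volume.restrict P.dom) := memLp_flux hDo hPΩ hco hb hu.1.1
  set m := Pi0 P F with hm
  have hFm' : MemLp (fun x => F x - m) 2 (volume.restrict P.dom) := hFm.sub (memLp_const m)
  set Ca := (8 / ρ) ^ 4 with hCa
  have hCa0 : 0 < Ca := by positivity
  set Cb := inverseConst ρ with hCb
  have hCb0 : 0 < Cb := inverseConst_pos hρ
  -- lower bound
  have h1 : l2Sq P.dom p ≤ Ca * ∫ x in P.dom, ψ x * p x ^ 2 := by
    obtain ⟨d, e, hde⟩ := hpa
    exact (hK.affine_bounds hρ hde).1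
  -- residual equation
  have hmean : ∫ x in P.dom, inner ℝ m (gradient w x) = 0 := by
    have := (hasWeakGrad_gradient P.isBounded_dom (contDiff_const (c := (1 : ℝ)))).2 w hwd hwc hws m
    have h0 : gradient (fun _ : E2 => (1 : ℝ)) = 0 := by
      ext1 x
      exact gradient_affine (p := fun _ => 1) (c := 1) (g := 0) (by simp) x
    simp only [one_mul, h0, Pi.zero_apply, inner_zero_left, zero_mul, integral_zero,
      neg_zero] at this
    rw [← this]
    congr 1; ext x
    rw [real_inner_comm, inner_gradient]
  have hres : ∫ x in P.dom, g x * w x = ∫ x in P.dom, inner ℝ (F x - m) (gradient w x) := by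
    rw [← integral_flux_gradient hΩo hΩb hPΩ hco hb hf hu hwd hwc hws]
    simp only [inner_sub_left]
    rw [integral_sub (integrable_inner hFm hgw) (integrable_inner (memLp_const m) hgw), hmean,
      sub_zero]
  have hsplit : ∫ x in P.dom, ψ x * p x ^ 2 =
      (∫ x in P.dom, (p x - g x) * w x) + ∫ x in P.dom, inner ℝ (F x - m) (gradient w x) := by
    have i1 : Integrable (fun x => (p x - g x) * w x) (volume.restrict P.dom) :=
      (hpm.sub hgm).integrable_mul hwm
    have i2 : Integrable (fun x => g x * w x) (volume.restrict P.dom) := hgm.integrable_mul hwm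
    rw [← hres, ← integral_add i1 i2]
    congr 1; ext x
    simp only [hw, Pi.mul_apply]
    ring
  have hw2 : l2Sq P.dom w ≤ 1 * l2Sq P.dom p := by
    refine l2Sq_le_of_ae_le hpm (ae_of_all _ fun x => ?_)
    rw [one_mul, hw, Pi.mul_apply, norm_mul, Real.norm_of_nonneg (bubble_nonneg x)]
    exact pow_le_pow_left₀ (mul_nonneg (bubble_nonneg x) (norm_nonneg _))
      (mul_le_of_le_one_left (norm_nonneg _) (bubble_le_one x)) 2
  have hw3 : l2Sq P.dom (gradient w) ≤ Cb * (P.h ^ 2)⁻¹ * l2Sq P.dom p :=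
    hK.l2Sq_gradient_bubble_le hρ hpa
  -- Both Young parameters are chosen to produce `(4 Ca)⁻¹ ‖p‖²`. After multiplication by `Ca` the
  -- two together give `‖p‖² / 2`, which is absorbed on the left.
  have y1 := mul_le_young (hpm.sub hgm) hwm (δ := (2 * Ca)⁻¹) (by positivity)
  have y2 := inner_mul_le_young hFm' hgw (δ := P.h ^ 2 / (2 * Ca * Cb)) (by positivity)
  have e1 : l2Sq P.dom (p - g) = l2Sq P.dom (g - p) := l2Sq_sub_comm
  have eosc : oscSq P g = P.h ^ 2 * l2Sq P.dom (g - p) := by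
    simp only [oscSq, l2Sq, norm_mul, mul_pow, integral_const_mul, Real.norm_eq_abs, sq_abs,
      Pi.sub_apply, ← hp]
  have eapp : approxSq P F = l2Sq P.dom (fun x => F x - m) := rfl
  set X := l2Sq P.dom p with hX
  have hX0 : 0 ≤ X := l2Sq_nonneg _ _
  set Y := l2Sq P.dom (g - p)
  have hY0 : 0 ≤ Y := l2Sq_nonneg _ _
  set Z := l2Sq P.dom (fun x => F x - m)
  have hZ0 : 0 ≤ Z := l2Sq_nonneg _ _
  rw [e1] at y1
  have y1' : ∫ x in P.dom, (p x - g x) * w x ≤ (4 * Ca)⁻¹ * X + Ca * Y := by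
    refine y1.trans ?_
    have : (2 * Ca)⁻¹ / 2 * l2Sq P.dom w ≤ (2 * Ca)⁻¹ / 2 * (1 * X) := by gcongr
    refine (add_le_add_left this _).trans (le_of_eq ?_)
    field_simp; ring
  have y2' : ∫ x in P.dom, inner ℝ (F x - m) (gradient w x) ≤
      (4 * Ca)⁻¹ * X + Ca * Cb * (P.h ^ 2)⁻¹ * Z := by
    refine y2.trans ?_
    have : P.h ^ 2 / (2 * Ca * Cb) / 2 * l2Sq P.dom (gradient w) ≤
        P.h ^ 2 / (2 * Ca * Cb) / 2 * (Cb * (P.h ^ 2)⁻¹ * X) := by gcongr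
    refine (add_le_add_left this _).trans (le_of_eq ?_)
    field_simp; ring
  have hfinal : X ≤ 2 * Ca ^ 2 * (Y + Cb * (P.h ^ 2)⁻¹ * Z) := by
    have h2 : X ≤ Ca * (((4 * Ca)⁻¹ * X + Ca * Y) + ((4 * Ca)⁻¹ * X +
        Ca * Cb * (P.h ^ 2)⁻¹ * Z)) := by
      refine h1.trans ?_
      rw [hsplit]
      gcongr
    have e2 : Ca * (((4 * Ca)⁻¹ * X + Ca * Y) + ((4 * Ca)⁻¹ * X + Ca * Cb * (P.h ^ 2)⁻¹ * Z)) =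
        X / 2 + Ca ^ 2 * (Y + Cb * (P.h ^ 2)⁻¹ * Z) := by
      field_simp; ring
    rw [e2] at h2
    linarith
  rw [eosc, eapp]
  calc P.h ^ 2 * X ≤ P.h ^ 2 * (2 * Ca ^ 2 * (Y + Cb * (P.h ^ 2)⁻¹ * Z)) := by gcongr
    _ = 2 * Ca ^ 2 * (P.h ^ 2 * Y + Cb * Z) := by field_simp
    _ ≤ 2 * Ca ^ 2 * ((1 + Cb) * (Z + P.h ^ 2 * Y)) := by
      gcongr
      have : 0 ≤ P.h ^ 2 * Y := by positivity
      nlinarith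
    _ = _ := by ring

/-- Splits `f - γ Π₁ u_h` into `g - Π₁ g`, `Π₁ g` and `γ (u - Π₁ u_h)` with `g = f - γ u`. These are
bounded by the oscillation, the bubble argument and Poincaré with `h ≤ 1`, respectively. -/
lemma etaSq_le {uh : E2 → ℝ} (hρ : 0 < ρ) (hK : StarBall P.carrier c (ρ * P.h)) (hh : P.h ≤ 1)
    (hΩo : IsOpen Ω) (hΩb : Bornology.IsBounded Ω) (hPΩ : P.dom ⊆ Ω)
    (hco : ContCoeffs co P.dom) (hb : co.BoundedBy P.dom M) (hf : MemLp f 2 (volume.restrict Ω))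
    (hu : co.IsWeakSolution Ω f u) (hv : MemH1 P.dom uh) :
    etaSq co P f uh ≤ (4 + 8 * ((8 / ρ) ^ 4) ^ 2 * (1 + inverseConst ρ) +
        2 * M ^ 2 * (2 + 4 * poincareConst ρ)) *
      (h1NormSq P.dom (u - uh) + h1SemiSq P.dom (u - Pi1 P uh) + approxSq P (co.flux Ω u) +
        oscSq P fun x => f x - co.γ x * u x) := by
  have hDo := P.isOpen_dom
  have hh0 := P.h_pos
  have hle : volume.restrict P.dom ≤ volume.restrict Ω := Measure.restrict_mono hPΩ le_rfl
  have hu1 : MemH1 P.dom u := hu.1.1.mono hPΩ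
  have hq := (isL2Proj_Pi1 hv.1).1.memH1 P
  have h1 := hK.sq_mul_l2Sq_Pi1_le hρ hΩo hΩb hPΩ hco hb hf hu
  set g : E2 → ℝ := fun x => f x - co.γ x * u x with hg
  have hgm : MemLp g 2 (volume.restrict P.dom) :=
    (hf.mono_measure hle).sub (memLp_γ hDo hco hb hu1.1)
  have hpm := (isL2Proj_Pi1 hgm).1.memLp P
  set p := Pi1 P g with hp
  have hwm := hu1.1.sub hq.1
  have hγ := memLp_γ hDo hco hb hwm
  have e : (fun x => f x - co.γ x * Pi1 P uh x) =
      ((g - p) + p) + fun x => co.γ x * (u - Pi1 P uh) x := by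
    ext x; simp only [Pi.add_apply, Pi.sub_apply, hg]; ring
  have h2 : l2Sq P.dom (fun x => f x - co.γ x * Pi1 P uh x) ≤
      4 * l2Sq P.dom (g - p) + 4 * l2Sq P.dom p +
        2 * (M ^ 2 * l2Sq P.dom (u - Pi1 P uh)) := by
    rw [e]
    have b1 := l2Sq_add_le ((hgm.sub hpm).add hpm) hγ
    have b2 := l2Sq_add_le (hgm.sub hpm) hpm
    have b3 : l2Sq P.dom (fun x => co.γ x * (u - Pi1 P uh) x) ≤
        M ^ 2 * l2Sq P.dom (u - Pi1 P uh) := by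
      refine l2Sq_le_of_ae_le hwm ?_
      filter_upwards [hb] with x hx
      rw [norm_mul, mul_pow]
      gcongr
      exact hx.2.2
    linarith
  have eosc : oscSq P g = P.h ^ 2 * l2Sq P.dom (g - p) := by
    simp only [oscSq, l2Sq, norm_mul, mul_pow, integral_const_mul, Real.norm_eq_abs, sq_abs,
      Pi.sub_apply, ← hp]
  have h3 := hK.l2Sq_sub_Pi1_le' hρ hh hu1 hv
  have hh2 : P.h ^ 2 ≤ 1 := pow_le_one₀ hh0.le hh
  have hC := poincareConst_pos ρ
  have hI := inverseConst_pos hρ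
  set X := h1NormSq P.dom (u - uh) + h1SemiSq P.dom (u - Pi1 P uh) with hX
  have hX0 : 0 ≤ X := add_nonneg (h1NormSq_nonneg _ _) (h1SemiSq_nonneg _ _)
  set A := approxSq P (co.flux Ω u)
  have hA0 : 0 ≤ A := l2Sq_nonneg _ _
  set O := oscSq P g
  have hO0 : 0 ≤ O := l2Sq_nonneg _ _
  set K1 := ((8 / ρ) ^ 4) ^ 2 * (1 + inverseConst ρ) with hK1
  have hK10 : 0 ≤ K1 := by positivity
  set K2 := M ^ 2 * (2 + 4 * poincareConst ρ) with hK2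
  have hK20 : 0 ≤ K2 := by positivity
  have h4 : P.h ^ 2 * (M ^ 2 * l2Sq P.dom (u - Pi1 P uh)) ≤ K2 * X := by
    calc _ ≤ 1 * (M ^ 2 * ((2 + 4 * poincareConst ρ) * X)) := by
          gcongr
          exact mul_nonneg (sq_nonneg _) (l2Sq_nonneg _ _)
      _ = _ := by rw [hK2]; ring
  have h5 : P.h ^ 2 * l2Sq P.dom p ≤ 2 * K1 * (A + O) := by
    refine h1.trans (le_of_eq ?_); rw [hK1]; ring
  calc etaSq co P f uh ≤ P.h ^ 2 * (4 * l2Sq P.dom (g - p) + 4 * l2Sq P.dom p +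
        2 * (M ^ 2 * l2Sq P.dom (u - Pi1 P uh))) := by
        unfold etaSq; gcongr
    _ = 4 * O + 4 * (P.h ^ 2 * l2Sq P.dom p) +
        2 * (P.h ^ 2 * (M ^ 2 * l2Sq P.dom (u - Pi1 P uh))) := by rw [eosc]; ring
    _ ≤ 4 * O + 4 * (2 * K1 * (A + O)) + 2 * (K2 * X) := by gcongr
    _ ≤ (4 + 8 * K1 + 2 * K2) * (X + A + O) := by
      have := mul_nonneg hK10 hX0
      have := mul_nonneg hK20 hA0
      have := mul_nonneg hK20 hO0
      nlinarith
    _ = _ := by rw [hK1, hK2]; ring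

end Residual

end NCVEM

namespace NCVEM

/-! ### Geometry of the mesh -/

/-- A Lipschitz domain has no slits: moving slightly down from a boundary point reaches points
strictly below the graph, which have neighbourhoods disjoint from `Ω`. Hence the interiors of the
cells, which only cover the closure of `Ω`, lie in `Ω`. -/
lemma IsPolygonalLipschitzDomain.interior_closure_subset {Ω : Set E2}
    (hΩ : IsPolygonalLipschitzDomain Ω) : interior (closure Ω) ⊆ Ω := by
  intro x hx
  by_contra hxΩ
  obtain ⟨hΩo, -, -, hloc, -⟩ := hΩ
  have hxf : x ∈ frontier Ω := ⟨interior_subset hx, fun h => hxΩ (interior_subset h)⟩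
  obtain ⟨R, K, φ, r, hφ, hr, hball⟩ := hloc x hxf
  have hle : R x 1 ≤ φ (R x 0) := by
    by_contra h
    exact hxΩ ((hball x (Metric.mem_ball_self hr)).2 (not_le.1 h))
  set e : E2 := R.symm (EuclideanSpace.single 1 1) with he
  have hlim : Tendsto (fun δ : ℝ => x - δ • e) (𝓝[>] 0) (𝓝 x) := by
    have : Continuous fun δ : ℝ => x - δ • e := by fun_prop
    simpa using (this.tendsto 0).mono_left nhdsWithin_le_nhds
  have hev := (hlim.eventually_mem (isOpen_interior.mem_nhds hx)).and
    (hlim.eventually_mem (Metric.ball_mem_nhds x hr))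
  obtain ⟨δ, ⟨h1, h2⟩, hδ⟩ := (hev.and self_mem_nhdsWithin).exists
  have hR : R (x - δ • e) = R x - δ • EuclideanSpace.single 1 1 := by simp [he]
  have hlow : R (x - δ • e) 1 < φ (R (x - δ • e) 0) := by
    rw [hR]
    have : 0 < δ := hδ
    simpa using by linarith
  have hopen : IsOpen {z : E2 | R z 1 < φ (R z 0)} :=
    isOpen_lt (by fun_prop) (hφ.continuous.comp (by fun_prop))
  have hy := mem_closure_iff.1 (interior_subset h1) _ (hopen.inter Metric.isOpen_ball) ⟨hlow, h2⟩
  obtain ⟨z, ⟨hz1, hz2⟩, hz3⟩ := hy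
  exact lt_asymm hz1 ((hball z hz2).1 hz3)

namespace Mesh

variable {Ω : Set E2} (T : Mesh Ω)

lemma carrier_subset (i : Fin T.N) : (T.cell i).carrier ⊆ closure Ω :=
  T.cover ▸ subset_iUnion (fun i => (T.cell i).carrier) i

lemma dom_subset (hΩ : IsPolygonalLipschitzDomain Ω) (i : Fin T.N) : (T.cell i).dom ⊆ Ω :=
  (interior_mono (T.carrier_subset i)).trans hΩ.interior_closure_subset

lemma disjoint_dom {i k : Fin T.N} (h : i ≠ k) : Disjoint (T.cell i).dom (T.cell k).dom := by
  rw [Set.disjoint_left]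
  intro x hi hk
  have hf : x ∈ frontier (T.cell i).carrier := by
    rcases T.admissible i k h x ⟨interior_subset hi, interior_subset hk⟩ with
      ⟨j, l, -, hx⟩ | ⟨j, l, hx, -⟩
    · exact (T.cell i).edge_subset_frontier j hx
    · exact hx ▸ (T.cell i).edge_subset_frontier j (left_mem_segment ℝ _ _)
  exact hf.2 hi

variable {T}

lemma mem_patch {i k : Fin T.N} {j : (T.cell i).Idx} :
    k ∈ T.patch i j ↔ ∃ l, (T.cell k).edge l = (T.cell i).edge j := by
  simp [patch]

lemma self_mem_patch (i : Fin T.N) (j : (T.cell i).Idx) : i ∈ T.patch i j := mem_patch.2 ⟨j, rfl⟩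

lemma segment_subset_frontier {i k : Fin T.N} {j : (T.cell i).Idx} (hk : k ∈ T.patch i j) :
    segment ℝ ((T.cell i).vert j) ((T.cell i).vert (j + 1)) ⊆ frontier (T.cell k).carrier := by
  obtain ⟨l, hl⟩ := mem_patch.1 hk
  have h := (T.cell k).edge_subset_frontier l
  change (T.cell k).edge l ⊆ _ at h
  rwa [hl] at h

lemma dist_eq_of_segment_eq {a b a' b' : E2} (h : segment ℝ a b = segment ℝ a' b') :
    dist a b = dist a' b' := by
  rw [← convexHull_pair, ← convexHull_pair] at h
  have := congrArg Metric.diam h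
  rwa [convexHull_diam, convexHull_diam, Metric.diam_pair, Metric.diam_pair] at this

lemma mul_h_le_len {ρ : ℝ} (hT : ∀ i, (T.cell i).Regular ρ) {i k : Fin T.N} {j : (T.cell i).Idx}
    (hk : k ∈ T.patch i j) : ρ * (T.cell k).h ≤ (T.cell i).len j := by
  obtain ⟨l, hl⟩ := mem_patch.1 hk
  have := (hT k).2 l
  rwa [Polygon.len, dist_eq_of_segment_eq hl] at this

end Mesh

/-- Two star-shaped sets with centres on the same side of a common edge overlap. -/
lemma StarBall.exists_mem_of_same_side {K K' : Set E2} {c c' a b : E2} {r r' : ℝ}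
    (hK : StarBall K c r) (hK' : StarBall K' c' r') (hE : segment ℝ a b ⊆ frontier K)
    (hE' : segment ℝ a b ⊆ frontier K')
    (h : 0 < cross (a - c) (b - a) * cross (a - c') (b - a)) :
    ∃ x, x ∈ interior K ∧ x ∈ interior K' := by
  set m : E2 := AffineMap.lineMap a b (1 / 2 : ℝ) with hm
  set J := cross (a - c) (b - a) with hJ
  set J' := cross (a - c') (b - a) with hJ'
  have hJ0 : J' ≠ 0 := by rintro h0; simp [h0] at h
  set α := J / J' with hα
  have hα0 : 0 < α := by
    have : α = J * J' / J' ^ 2 := by rw [hα]; field_simp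
    rw [this]; positivity
  set β := - cross (c' - m) (c - m) / J' with hβ
  -- Seen from the midpoint `m`, the first centre is a positive multiple of the second plus a shift
  -- along the edge; `α > 0` expresses that both lie on the same side.
  have hdec : c - m = α • (c' - m) + β • (b - a) := by
    have h1 := cross_decomp (c' - m) (b - a) (c - m)
    have e1 : cross (c' - m) (b - a) = -J' := by
      simp [hJ', cross, hm, AffineMap.lineMap_apply]; ring
    have e2 : cross (c - m) (b - a) = -J := by
      simp [hJ, cross, hm, AffineMap.lineMap_apply]; ring
    rw [e1, e2] at h1
    have h2 := congrArg (fun y => (-J')⁻¹ • y) h1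
    simp only [smul_add, smul_smul] at h2
    rw [inv_mul_cancel₀ (neg_ne_zero.2 hJ0), one_smul] at h2
    rw [h2]
    congr 2
    · rw [hα]; field_simp
    · rw [hβ]; field_simp
  -- The common point is `m + ε (c - m)`. This `ε` makes `ε α` and `ε |β|` at most `1 / 4`, so the
  -- edge parameter of the point in the second triangle deviates from `1 / 2` by at most `1 / 3` and
  -- stays in `(0, 1)`.
  set ε := (4 * (1 + α + |β|))⁻¹ with hε
  have hD : 0 < 4 * (1 + α + |β|) := by positivity
  have hε0 : 0 < ε := by positivity
  have hε1 : ε * (4 * (1 + α + |β|)) = 1 := inv_mul_cancel₀ hD.ne'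
  have hεβ0 : 0 ≤ ε * |β| := by positivity
  have hεα0 : 0 < ε * α := by positivity
  have hεα : ε * α ≤ 1 / 4 := by nlinarith
  have hεβ : ε * |β| ≤ 1 / 4 := by nlinarith
  have hε4 : ε ≤ 1 / 4 := by nlinarith
  have habs : |ε * β| ≤ 1 / 4 := by rwa [abs_mul, abs_of_pos hε0]
  have hs : 0 < 1 - ε * α := by linarith
  refine ⟨m + ε • (c - m), hK.openTri_subset hE ⟨1 - ε, ⟨by linarith, by linarith⟩, 1 / 2,
    ⟨by norm_num, by norm_num⟩, ?_⟩, hK'.openTri_subset hE' ⟨1 - ε * α, ⟨hs, by linarith⟩,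
      1 / 2 + ε * β / (1 - ε * α), ?_, ?_⟩⟩
  · rw [← hm]; module
  · have h3 : |ε * β / (1 - ε * α)| ≤ 1 / 3 := by
      rw [abs_div, abs_of_pos hs, div_le_iff₀ hs]
      linarith
    have := abs_le.1 h3
    constructor <;> linarith [this.1, this.2]
  · rw [hdec, lineMap_sub_eq]
    have hm' : m = a + (1 / 2 : ℝ) • (b - a) := by
      rw [hm, AffineMap.lineMap_apply, vsub_eq_sub, vadd_eq_add, add_comm]
    have e : (1 - ε * α) • ((1 / 2 + ε * β / (1 - ε * α)) • (b - a)) =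
        ((1 - ε * α) / 2 + ε * β) • (b - a) := by
      rw [smul_smul]; congr 1; field_simp
    rw [smul_add (1 - ε * α), e, hm']
    module

namespace Mesh

variable {Ω : Set E2} {T : Mesh Ω}

/-- Three cells at one edge have three centres off its line, so two of them are on the same side.
The corresponding cells would overlap, although distinct cells have disjoint interiors. -/
lemma card_erase_patch_le {ρ : ℝ} (hρ : 0 < ρ) (hT : ∀ i, (T.cell i).Regular ρ) (i : Fin T.N)
    (j : (T.cell i).Idx) : ((T.patch i j).erase i).card ≤ 1 := by
  rw [Finset.card_le_one]
  intro k hk l hl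
  rw [Finset.mem_erase] at hk hl
  by_contra hkl
  choose c hc using fun k => (hT k).exists_starBall hρ
  have hab := (T.cell i).vert_ne j
  set a := (T.cell i).vert j
  set b := (T.cell i).vert (j + 1)
  have key : ∀ p ∈ T.patch i j, ∀ q ∈ T.patch i j, p ≠ q →
      cross (a - c p) (b - a) * cross (a - c q) (b - a) ≤ 0 := by
    intro p hp q hq hpq
    by_contra hlt
    obtain ⟨x, hx, hx'⟩ := (hc p).exists_mem_of_same_side (hc q) (segment_subset_frontier hp)
      (segment_subset_frontier hq) (not_le.1 hlt)
    exact Set.disjoint_left.1 (T.disjoint_dom hpq) hx hx'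
  have hne : ∀ p ∈ T.patch i j, cross (a - c p) (b - a) ≠ 0 := fun p hp =>
    (hc p).cross_ne_zero hab (segment_subset_frontier hp)
  have hi := self_mem_patch i j
  have h1 := (key i hi k hk.2 hk.1.symm).lt_of_ne (mul_ne_zero (hne i hi) (hne k hk.2))
  have h2 := (key i hi l hl.2 hl.1.symm).lt_of_ne (mul_ne_zero (hne i hi) (hne l hl.2))
  have h3 := key k hk.2 l hl.2 hkl
  have h4 := mul_pos_of_neg_of_neg h1 h2
  have h5 := pow_pos (abs_pos.2 (hne i hi)) 2
  rw [sq_abs] at h5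
  nlinarith

/-- An edge without a neighbouring cell lies on the boundary. -/
lemma notMem_of_erase_patch_eq_empty (hΩo : IsOpen Ω) {i : Fin T.N} {j : (T.cell i).Idx}
    (h : (T.patch i j).erase i = ∅) {x : E2} (hx : x ∈ (T.cell i).edge j) : x ∉ Ω := by
  have hab := (T.cell i).vert_ne j
  have hopen : ∀ t ∈ Ioo (0 : ℝ) 1,
      (AffineMap.lineMap ((T.cell i).vert j) ((T.cell i).vert (j + 1)) t : E2) ∈ Ωᶜ := by
    intro t ht hxΩ
    set y : E2 := AffineMap.lineMap ((T.cell i).vert j) ((T.cell i).vert (j + 1)) t with hy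
    have hyf : y ∈ frontier (T.cell i).carrier := (T.cell i).edge_subset_frontier j
      (StarBall.lineMap_mem_segment ⟨ht.1.le, ht.2.le⟩)
    set F := ⋃ k : {k : Fin T.N // k ≠ i}, (T.cell k).carrier with hF
    have hFc : IsClosed F := isClosed_iUnion_of_finite fun k => (T.cell k).isCompact.isClosed
    have hsub : Ω ∩ (T.cell i).carrierᶜ ⊆ F := by
      rintro z ⟨hz, hzi⟩
      have := subset_closure hz
      rw [← T.cover] at this
      obtain ⟨k, hk⟩ := mem_iUnion.1 this
      refine mem_iUnion.2 ⟨⟨k, ?_⟩, hk⟩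
      rintro rfl
      exact hzi hk
    -- Near a point `y` of `Ω` on the boundary of the cell there are points of `Ω` outside the cell.
    -- The other cells cover these, and their finite union is closed.
    have hyF : y ∈ F := by
      refine closure_minimal hsub hFc ?_
      refine hΩo.inter_closure ⟨hxΩ, ?_⟩
      rw [frontier_eq_closure_inter_closure] at hyf
      exact hyf.2
    obtain ⟨⟨k, hk⟩, hyk⟩ := mem_iUnion.1 hyF
    rcases T.admissible i k hk.symm y ⟨(T.cell i).isCompact.isClosed.frontier_subset hyf, hyk⟩ with
      ⟨j', l, hjl, hyj⟩ | ⟨j', l, hyj, -⟩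
    · have hj : j' = j := (T.cell i).eq_of_mem_edges ht hyj
      subst hj
      have : k ∈ (T.patch i j').erase i := Finset.mem_erase.2 ⟨hk, mem_patch.2 ⟨l, hjl.symm⟩⟩
      rw [h] at this
      simp at this
    · have hj : j' = j := by
        refine (T.cell i).eq_of_mem_edges ht ?_
        rw [← hy, hyj]
        exact left_mem_segment ℝ _ _
      subst hj
      have h0 : (AffineMap.lineMap ((T.cell i).vert j') ((T.cell i).vert (j' + 1)) t : E2) =
          AffineMap.lineMap ((T.cell i).vert j') ((T.cell i).vert (j' + 1)) (0 : ℝ) := by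
        rw [← hy, hyj, AffineMap.lineMap_apply_zero]
      exact ht.1.ne' (AffineMap.lineMap_injective ℝ hab h0)
  have hcl : IsClosed ((fun t : ℝ => (AffineMap.lineMap ((T.cell i).vert j)
      ((T.cell i).vert (j + 1)) t : E2)) ⁻¹' Ωᶜ) :=
    hΩo.isClosed_compl.preimage AffineMap.lineMap_continuous
  -- The admissibility argument treats only relative interior points; the endpoints follow because
  -- `Ω` is open.
  have hI := closure_minimal (fun t ht => hopen t ht) hcl
  rw [closure_Ioo zero_ne_one] at hI
  rw [Polygon.edge, segment_eq_image_lineMap] at hx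
  obtain ⟨t, ht, rfl⟩ := hx
  exact hI ht

end Mesh

end NCVEM

namespace NCVEM

/-! ### Jumps across edges -/

section Edge

variable {a b : E2} {σ τ : E2 → ℝ}

/-- On the edge the mean is the best constant, so `‖τ - κ‖²` is at least `‖τ‖²` minus the part
carried by the mean. -/
lemma edgeInt_sq_le_add (hab : a ≠ b) (hτ : MemEdge a b τ) (κ : ℝ) :
    edgeInt a b (fun x => τ x ^ 2) ≤
      edgeInt a b (fun x => (τ x - κ) ^ 2) + (dist a b)⁻¹ * edgeInt a b τ ^ 2 := by
  have hd : 0 < dist a b := dist_pos.2 hab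
  simp only [edgeInt_eq]
  set f : ℝ → ℝ := fun t => τ (AffineMap.lineMap a b t) with hf
  have hf1 : IntegrableOn f (Icc 0 1) := hτ.integrable
  have hf2 : IntegrableOn (fun t => f t ^ 2) (Icc 0 1) := hτ.integrable_sq
  have e : ∫ t in Icc (0 : ℝ) 1, (f t - κ) ^ 2 =
      (∫ t in Icc (0 : ℝ) 1, f t ^ 2) - 2 * κ * (∫ t in Icc (0 : ℝ) 1, f t) + κ ^ 2 := by
    have e1 : ∀ t, (f t - κ) ^ 2 = f t ^ 2 - 2 * κ * f t + κ ^ 2 := fun t => by ring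
    simp only [e1]
    have hf3 : IntegrableOn (fun t => f t ^ 2 - 2 * κ * f t) (Icc 0 1) :=
      hf2.sub (hf1.const_mul _)
    rw [integral_add hf3 (integrable_const _), integral_sub hf2 (hf1.const_mul _),
      integral_const_mul]
    simp
  change dist a b * (∫ t in Icc (0 : ℝ) 1, f t ^ 2) ≤
    dist a b * (∫ t in Icc (0 : ℝ) 1, (f t - κ) ^ 2) +
      (dist a b)⁻¹ * (dist a b * ∫ t in Icc (0 : ℝ) 1, f t) ^ 2
  rw [e]
  set m := ∫ t in Icc (0 : ℝ) 1, f t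
  have e2 : (dist a b)⁻¹ * (dist a b * m) ^ 2 = dist a b * m ^ 2 := by field_simp
  rw [e2, ← mul_add]
  refine mul_le_mul_of_nonneg_left ?_ hd.le
  nlinarith [sq_nonneg (m - κ)]

lemma edgeInt_congr (h : ∀ x ∈ segment ℝ a b, σ x = τ x) : edgeInt a b σ = edgeInt a b τ := by
  rw [edgeInt_eq, edgeInt_eq]
  congr 1
  exact setIntegral_congr_fun measurableSet_Icc fun t ht => h _ (StarBall.lineMap_mem_segment ht)

end Edge

namespace Mesh

variable {Ω : Set E2} {T : Mesh Ω} {i : Fin T.N} {j : (T.cell i).Idx}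

lemma jump_sub (w z : Fin T.N → E2 → ℝ) (x : E2) :
    T.jump i j (fun k => w k - z k) x = T.jump i j w x - T.jump i j z x := by
  simp only [jump, Pi.sub_apply, Finset.sum_sub_distrib]
  ring

lemma memEdge_jump {a b : E2} {w : Fin T.N → E2 → ℝ} (hw : ∀ k ∈ T.patch i j, MemEdge a b (w k)) :
    MemEdge a b (T.jump i j w) :=
  MemLp.sub (hw i (self_mem_patch i j))
    (memLp_finsetSum _ fun k hk => hw k (Finset.mem_of_mem_erase hk))

lemma edgeInt_jump_sq_le (hcard : ((T.patch i j).erase i).card ≤ 1) {a b : E2}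
    {w : Fin T.N → E2 → ℝ} (hw : ∀ k ∈ T.patch i j, MemEdge a b (w k)) :
    edgeInt a b (fun x => T.jump i j w x ^ 2) ≤
      2 * ∑ k ∈ T.patch i j, edgeInt a b (fun x => w k x ^ 2) := by
  have hi := self_mem_patch i j
  have : Nonempty (Fin T.N) := ⟨i⟩
  rw [← Finset.add_sum_erase _ _ hi]
  rcases Finset.card_le_one_iff_subset_singleton.1 hcard with ⟨k, hk⟩
  rcases Finset.subset_singleton_iff.1 hk with h | h
  · simp only [jump, h, Finset.sum_empty, sub_zero, add_zero]
    linarith [edgeInt_sq_nonneg a b (w i)]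
  · have hkp : k ∈ T.patch i j :=
      Finset.mem_of_mem_erase (h ▸ Finset.mem_singleton_self k : k ∈ (T.patch i j).erase i)
    simp only [jump, h, Finset.sum_singleton]
    exact edgeInt_sq_sub_le (hw i hi) (hw k hkp)

/-- A function with support in the open set `Ω` has no jumps across edges. -/
lemma jump_const_eq_zero (hΩo : IsOpen Ω) (hcard : ((T.patch i j).erase i).card ≤ 1)
    {φ : E2 → ℝ} (hφ : tsupport φ ⊆ Ω) {x : E2} (hx : x ∈ (T.cell i).edge j) :
    T.jump i j (fun _ => φ) x = 0 := by
  rw [jump, Finset.sum_const]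
  rcases Nat.le_one_iff_eq_zero_or_eq_one.1 hcard with h | h
  · have := notMem_of_erase_patch_eq_empty hΩo (Finset.card_eq_zero.1 h) hx
    rw [h, zero_smul, sub_zero]
    exact image_eq_zero_of_notMem_tsupport fun h' => this (hφ h')
  · rw [h, one_smul, sub_self]

end Mesh

/-- The constant of the scaled trace inequality for functions with integral mean zero. -/
noncomputable def traceConst (ρ : ℝ) : ℝ := 4 * (ρ ^ 2)⁻¹ * (3 * poincareConst ρ + 1)

lemma traceConst_pos {ρ : ℝ} (hρ : 0 < ρ) : 0 < traceConst ρ := by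
  have := poincareConst_pos ρ
  unfold traceConst
  positivity

/-- The weight and the trace inequality each cost `(ρ h)⁻¹`, and Poincaré returns `h ^ 2`; the
result is scale invariant. -/
lemma StarBall.inv_dist_mul_edgeInt_sq_le {P : Polygon} {c a b : E2} {ρ : ℝ} {v τ : E2 → ℝ}
    (hρ : 0 < ρ) (hK : StarBall P.carrier c (ρ * P.h)) (hab : a ≠ b)
    (hE : segment ℝ a b ⊆ frontier P.carrier) (hlen : ρ * P.h ≤ dist a b) (hv : MemH1 P.dom v)
    (h0 : ∫ x in P.dom, v x = 0) (hτ : IsTrace P.dom a b v τ) :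
    (dist a b)⁻¹ * edgeInt a b (fun x => τ x ^ 2) ≤ traceConst ρ * h1SemiSq P.dom v := by
  have h1 := hK.edgeInt_sq_le hab hE hv hτ
  have h2 := hK.l2Sq_le_of_integral_eq_zero hρ hv h0
  have hh := P.h_pos
  have hr := hK.pos
  have h3 : 4 * (ρ * P.h)⁻¹ * (3 * l2Sq P.dom v + P.h ^ 2 * h1SemiSq P.dom v) ≤
      4 * (ρ * P.h)⁻¹ * (3 * (poincareConst ρ * P.h ^ 2 * h1SemiSq P.dom v) +
        P.h ^ 2 * h1SemiSq P.dom v) := by gcongr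
  calc (dist a b)⁻¹ * edgeInt a b (fun x => τ x ^ 2)
      ≤ (ρ * P.h)⁻¹ * edgeInt a b (fun x => τ x ^ 2) :=
        mul_le_mul_of_nonneg_right (inv_anti₀ hr hlen) (edgeInt_sq_nonneg _ _ _)
    _ ≤ (ρ * P.h)⁻¹ * (4 * (ρ * P.h)⁻¹ * (3 * (poincareConst ρ * P.h ^ 2 * h1SemiSq P.dom v) +
        P.h ^ 2 * h1SemiSq P.dom v)) :=
        mul_le_mul_of_nonneg_left (h1.trans h3) (inv_nonneg.2 hr.le)
    _ = traceConst ρ * h1SemiSq P.dom v := by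
        rw [traceConst]; field_simp

lemma h1SemiSq_sub_const {U : Set E2} (hUo : IsOpen U) (hU : Bornology.IsBounded U) {v : E2 → ℝ}
    (hv : MemH1 U v) (m : ℝ) : h1SemiSq U (v - fun _ => m) = h1SemiSq U v := by
  have hm : MemH1 U fun _ : E2 => m := memH1_of_contDiff hU contDiff_const
  have h0 := weakGrad_of_contDiff hUo hU (contDiff_const (c := m))
  refine l2Sq_congr ?_
  filter_upwards [hv.weakGrad_sub hUo hm, h0] with x h1 h2
  rw [h1, Pi.sub_apply, h2, gradient_affine (p := fun _ => m) (c := m) (g := 0) (by simp), sub_zero]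

/-! ### The nonconformity term -/

section Xi

variable {Ω : Set E2} {T : Mesh Ω} {ρ : ℝ} {u uh : E2 → ℝ}

/-- The jump is split on the edge into its deviation from a constant and its mean. The deviation is
estimated by comparison with `φ`, which has no jumps, and the mean by comparison with `u_h`, whose
jumps have mean zero. Working with smooth `φ` instead of `u` avoids traces of `u`. -/
lemma inv_len_mul_eInt_jump_sq_le_of_contDiff (hρ : 0 < ρ) (hΩ : IsPolygonalLipschitzDomain Ω)
    (hT : ∀ i, (T.cell i).Regular ρ) (hu : MemH1 Ω u) (hv : T.MemVh uh) (i : Fin T.N)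
    (j : (T.cell i).Idx) {φ : E2 → ℝ} (hφ : ContDiff ℝ ∞ φ) (hφs : tsupport φ ⊆ Ω) :
    ((T.cell i).len j)⁻¹ *
        (T.cell i).eInt j (fun x => T.jump i j (fun k => Pi1 (T.cell k) uh) x ^ 2) ≤
      8 * traceConst ρ * ∑ k ∈ T.patch i j,
        (h1NormSq (T.cell k).dom (u - uh) + h1SemiSq (T.cell k).dom (u - Pi1 (T.cell k) uh) +
          h1NormSq Ω (φ - u)) := by
  choose c hc using fun k => (hT k).exists_starBall hρ
  have hcard := Mesh.card_erase_patch_le hρ hT i j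
  have hab := (T.cell i).vert_ne j
  have hE := fun k (hk : k ∈ T.patch i j) => Mesh.segment_subset_frontier hk
  have hlen := fun k (hk : k ∈ T.patch i j) => Mesh.mul_h_le_len hT hk
  have hjump : ∀ x ∈ (T.cell i).edge j, T.jump i j (fun _ => φ) x = 0 := fun x hx =>
    Mesh.jump_const_eq_zero hΩ.1 hcard hφs hx
  have hmean := hv.2 i j
  simp only [Polygon.len, Polygon.eInt, Polygon.edge] at *
  set a := (T.cell i).vert j
  set b := (T.cell i).vert (j + 1)
  have hd : 0 < dist a b := dist_pos.2 hab
  have hH : ∀ k, MemH1 (T.cell k).dom uh := fun k => (hv.1 k).1.1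
  have hq : ∀ k, IsAffine (Pi1 (T.cell k) uh) := fun k => (isL2Proj_Pi1 (hH k).1).1
  have hu1 : ∀ k, MemH1 (T.cell k).dom u := fun k => hu.mono (T.dom_subset hΩ k)
  set J := T.jump i j fun k => Pi1 (T.cell k) uh with hJ
  have hJm : MemEdge a b J :=
    Mesh.memEdge_jump fun k _ => memEdge_of_continuous (hq k).contDiff.continuous
  -- the part with integral mean zero
  set w : Fin T.N → E2 → ℝ := fun k => Pi1 (T.cell k) uh - φ with hw
  have hwd : ∀ k, ContDiff ℝ ∞ (w k) := fun k => (hq k).contDiff.sub hφ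
  -- Subtracting the cell means `m k` makes Poincaré available. On the edge this changes the jump
  -- only by the constant `κ`, for which `edgeInt_sq_le_add` leaves complete freedom.
  set m : Fin T.N → ℝ := fun k => ⨍ x in (T.cell k).dom, w k x with hm
  set y : Fin T.N → E2 → ℝ := fun k => w k - fun _ => m k with hy
  have hwm : ∀ k, ContDiff ℝ ∞ (y k) := fun k => (hwd k).sub contDiff_const
  set κ : ℝ := m i - ∑ k ∈ (T.patch i j).erase i, m k with hκ
  have hJκ : ∀ x ∈ segment ℝ a b,
      (J x - κ) ^ 2 = T.jump i j y x ^ 2 := by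
    intro x hx
    have e1 := Mesh.jump_sub (i := i) (j := j) w (fun k _ => m k) x
    have e2 := Mesh.jump_sub (i := i) (j := j) (fun k => Pi1 (T.cell k) uh) (fun _ => φ) x
    have e3 : T.jump i j (fun k _ => m k) x = κ := rfl
    rw [e1, e2, e3, hjump x hx, sub_zero]
  have hosc : ∀ k ∈ T.patch i j,
      (dist a b)⁻¹ * edgeInt a b (fun x => y k x ^ 2) ≤
        traceConst ρ * (2 * (h1SemiSq (T.cell k).dom (u - Pi1 (T.cell k) uh) +
          h1NormSq Ω (φ - u))) := by
    intro k hk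
    have hDo := (T.cell k).isOpen_dom
    have hDb := (T.cell k).isBounded_dom
    have hfin : IsFiniteMeasure (volume.restrict (T.cell k).dom) :=
      ⟨by rw [Measure.restrict_apply_univ]; exact hDb.measure_lt_top⟩
    have hwk := memH1_of_contDiff hDb (hwd k)
    have h1 := (hc k).inv_dist_mul_edgeInt_sq_le hρ hab (hE k hk) (hlen k hk)
      (memH1_of_contDiff hDb (hwm k)) (integral_sub_average _ _) (isTrace_of_contDiff hDo (hwm k))
    refine h1.trans (mul_le_mul_of_nonneg_left ?_ (traceConst_pos hρ).le)
    rw [hy, h1SemiSq_sub_const hDo hDb hwk]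
    have hφ1 : MemH1 Ω φ := memH1_of_contDiff hΩ.2.2.1 hφ
    have hq1 := (hq k).memH1 (T.cell k)
    have hφk := hφ1.mono (T.dom_subset hΩ k)
    have e : w k = (u - φ) - (u - Pi1 (T.cell k) uh) := by simp only [hw]; abel
    have h2 := h1SemiSq_sub_le hDo ((hu1 k).sub hφk) ((hu1 k).sub hq1)
    rw [← e, h1SemiSq_sub_comm hDo (hu1 k) hφk] at h2
    have h3 : h1SemiSq (T.cell k).dom (φ - u) ≤ h1NormSq Ω (φ - u) := by
      have h4 := h1NormSq_mono hDo (T.dom_subset hΩ k) (hφ1.sub hu)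
      exact (le_add_of_nonneg_left (l2Sq_nonneg _ _)).trans h4
    linarith
  -- the mean
  set z : Fin T.N → E2 → ℝ := fun k => trace (T.cell k).dom a b uh - Pi1 (T.cell k) uh with hz
  have hztr : ∀ k ∈ T.patch i j,
      IsTrace (T.cell k).dom a b (uh - Pi1 (T.cell k) uh) (z k) := fun k hk =>
    ((hc k).isTrace_trace hab (hE k hk) (hH k)).sub (T.cell k).isOpen_dom (T.cell k).isBounded_dom
      (hH k) ((hq k).memH1 _) (isTrace_of_contDiff (T.cell k).isOpen_dom (hq k).contDiff)
  have hzm : ∀ k ∈ T.patch i j, MemEdge a b (z k) := fun k hk => (hztr k hk).1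
  -- Here the nonconforming continuity condition of `V_h` enters.
  have hJz : edgeInt a b J = -edgeInt a b (T.jump i j z) := by
    have htr : MemEdge a b (T.jump i j fun k => trace (T.cell k).dom a b uh) :=
      Mesh.memEdge_jump fun k hk => ((hc k).isTrace_trace hab (hE k hk) (hH k)).1
    have e1 : T.jump i j z =
        fun x => (T.jump i j fun k => trace (T.cell k).dom a b uh) x - J x :=
      funext fun x => Mesh.jump_sub _ _ x
    rw [e1, edgeInt_sub htr hJm, hmean, zero_sub, neg_neg]
  have hmn : ∀ k ∈ T.patch i j, (dist a b)⁻¹ * edgeInt a b (fun x => z k x ^ 2) ≤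
      traceConst ρ * (2 * (h1SemiSq (T.cell k).dom (u - uh) +
        h1SemiSq (T.cell k).dom (u - Pi1 (T.cell k) uh))) := by
    intro k hk
    have h1 := (hc k).inv_dist_mul_edgeInt_sq_le hρ hab (hE k hk) (hlen k hk)
      ((hH k).sub ((hq k).memH1 _)) (integral_sub_Pi1 (hH k).1) (hztr k hk)
    exact h1.trans (mul_le_mul_of_nonneg_left (h1SemiSq_sub_Pi1_le (hu1 k) (hH k))
      (traceConst_pos hρ).le)
  have hA := edgeInt_sq_le_add hab hJm κ
  rw [edgeInt_congr hJκ, hJz, neg_sq] at hA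
  have hA1 := Mesh.edgeInt_jump_sq_le hcard
    (fun k _ => memEdge_of_continuous (a := a) (b := b) (hwm k).continuous)
  have hA2 := edgeInt_sq_le_mul (Mesh.memEdge_jump hzm)
  have hA3 := Mesh.edgeInt_jump_sq_le hcard hzm
  have hA4 : (dist a b)⁻¹ * edgeInt a b (T.jump i j z) ^ 2 ≤
      edgeInt a b (fun x => T.jump i j z x ^ 2) := by
    rwa [inv_mul_le_iff₀ hd]
  have hB : edgeInt a b (fun x => J x ^ 2) ≤
      2 * ∑ k ∈ T.patch i j, (edgeInt a b (fun x => y k x ^ 2) +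
        edgeInt a b (fun x => z k x ^ 2)) := by
    rw [Finset.sum_add_distrib]
    linarith
  refine (mul_le_mul_of_nonneg_left hB (inv_nonneg.2 hd.le)).trans ?_
  rw [mul_left_comm, Finset.mul_sum, Finset.mul_sum, Finset.mul_sum]
  refine Finset.sum_le_sum fun k hk => ?_
  have h1 := hosc k hk
  have h2 := hmn k hk
  have h3 : 0 ≤ l2Sq (T.cell k).dom (u - uh) := l2Sq_nonneg _ _
  have h4 := h1SemiSq_nonneg (T.cell k).dom (u - uh)
  have h5 := h1NormSq_nonneg Ω (φ - u)
  have ht := traceConst_pos hρ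
  -- The slack between the combined estimates and the stated bound, which involves the full norm
  -- with a common factor `8`.
  have h6 : 0 ≤ traceConst ρ * (4 * h1SemiSq (T.cell k).dom (u - uh) +
    4 * h1NormSq Ω (φ - u) + 8 * l2Sq (T.cell k).dom (u - uh)) := by positivity
  have h7 : h1NormSq (T.cell k).dom (u - uh) =
    l2Sq (T.cell k).dom (u - uh) + h1SemiSq (T.cell k).dom (u - uh) := rfl
  rw [h7]
  linarith

/-- Passes to the limit along test functions that converge to `u` in `H¹(Ω)`; the boundary condition
of `u` enters through their compact supports in `Ω`. -/
lemma xiSq_le (hρ : 0 < ρ) (hΩ : IsPolygonalLipschitzDomain Ω)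
    (hT : ∀ i, (T.cell i).Regular ρ) (hu : MemH10 Ω u) (hv : T.MemVh uh) (i : Fin T.N) :
    xiSq T i uh ≤ 8 * traceConst ρ * ∑ j, ∑ k ∈ T.patch i j,
      (h1NormSq (T.cell k).dom (u - uh) + h1SemiSq (T.cell k).dom (u - Pi1 (T.cell k) uh)) := by
  obtain ⟨hu1, φ, hφ, hlim⟩ := hu
  rw [xiSq, Finset.mul_sum]
  refine Finset.sum_le_sum fun j _ => ?_
  have hlim' : Tendsto (fun n => 8 * traceConst ρ * ∑ k ∈ T.patch i j,
      (h1NormSq (T.cell k).dom (u - uh) + h1SemiSq (T.cell k).dom (u - Pi1 (T.cell k) uh) +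
        h1NormSq Ω (φ n - u))) atTop (𝓝 (8 * traceConst ρ * ∑ k ∈ T.patch i j,
      (h1NormSq (T.cell k).dom (u - uh) + h1SemiSq (T.cell k).dom (u - Pi1 (T.cell k) uh) +
        0))) :=
    (tendsto_finsetSum _ fun k _ => hlim.const_add _).const_mul _
  simp only [add_zero] at hlim'
  exact ge_of_tendsto' hlim' fun n =>
    inv_len_mul_eInt_jump_sq_le_of_contDiff hρ hΩ hT hu1 hv i j (hφ n).1 (hφ n).2.2

end Xi

end NCVEM

/-! ### Assembly of the four estimates -/

namespace NCVEM

lemma Coeffs.PiecewiseLipschitz.contCoeffs {co : Coeffs} {Ω : Set E2} {T : Mesh Ω}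
    (h : co.PiecewiseLipschitz T) (i : Fin T.N) : ContCoeffs co (T.cell i).dom := by
  obtain ⟨K, hK⟩ := h
  exact ⟨(hK i).1.continuousOn, (hK i).2.1.continuousOn, (hK i).2.2.continuousOn⟩

lemma approxSq_nonneg (P : Polygon) (F : E2 → E2) : 0 ≤ approxSq P F := l2Sq_nonneg _ _

lemma oscSq_nonneg (P : Polygon) (g : E2 → ℝ) : 0 ≤ oscSq P g := l2Sq_nonneg _ _

end NCVEM

open NCVEM in
theorem mainTheorem5 (ρ Cs a₀ a₁ M : ℝ) (hρ : 0 < ρ) (hCs : 0 < Cs) (ha₀ : 0 < a₀) (ha₁ : 0 < a₁) :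
    ∃ C : ℝ, 0 < C ∧
      ∀ (Ω : Set E2), IsPolygonalLipschitzDomain Ω →
      ∀ (c : Coeffs), c.BoundedBy Ω M → c.Elliptic Ω a₀ a₁ → c.InjectiveOp Ω →
      ∀ (T : Mesh Ω), (∀ i, (T.cell i).Regular ρ) → (∀ i, (T.cell i).h ≤ 1) →
        c.PiecewiseLipschitz T →
      ∀ (S : Fin T.N → LinearMap.BilinForm ℝ (E2 → ℝ)),
        (∀ i, c.IsStabilization (T.cell i) Cs (S i)) →
      ∀ (f : E2 → ℝ), MemLp f 2 (volume.restrict Ω) →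
      ∀ (u : E2 → ℝ), c.IsWeakSolution Ω f u →
      ∀ (uh : E2 → ℝ), c.IsDiscreteSolution T S f uh →
      ∀ i : Fin T.N,
        zetaSq (T.cell i) (S i) uh ≤
            C * (h1SemiSq (T.cell i).dom (u - uh) +
              h1SemiSq (T.cell i).dom (u - Pi1 (T.cell i) uh)) ∧
        etaSq c (T.cell i) f uh ≤
            C * (h1NormSq (T.cell i).dom (u - uh) +
              h1SemiSq (T.cell i).dom (u - Pi1 (T.cell i) uh) +
              approxSq (T.cell i) (c.flux Ω u) +
              oscSq (T.cell i) (fun x => f x - c.γ x * u x)) ∧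
        lambdaSq c (T.cell i) uh ≤
            C * (h1NormSq (T.cell i).dom (u - uh) +
              h1SemiSq (T.cell i).dom (u - Pi1 (T.cell i) uh) +
              approxSq (T.cell i) (c.flux Ω u)) ∧
        xiSq T i uh ≤
            C * ∑ j, ∑ k ∈ T.patch i j,
              (h1NormSq (T.cell k).dom (u - uh) +
                h1SemiSq (T.cell k).dom (u - Pi1 (T.cell k) uh)) := by
  have hp := poincareConst_pos ρ
  have hi := inverseConst_pos hρ
  have ht := traceConst_pos hρ
  set C₁ := 2 * Cs * a₁ with hC₁
  set C₂ := 4 + 8 * ((8 / ρ) ^ 4) ^ 2 * (1 + inverseConst ρ) +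
    2 * M ^ 2 * (2 + 4 * poincareConst ρ) with hC₂
  set C₃ := 2 + 4 * M ^ 2 * (3 + 4 * poincareConst ρ) with hC₃
  set C₄ := 8 * traceConst ρ with hC₄
  have h₁ : 0 < C₁ := by positivity
  have h₂ : 0 < C₂ := by positivity
  have h₃ : 0 < C₃ := by positivity
  have h₄ : 0 < C₄ := by positivity
  refine ⟨C₁ + C₂ + C₃ + C₄, by positivity, ?_⟩
  intro Ω hΩ co hb he _ T hT hh hL S hS f hf u hu uh huh i
  obtain ⟨c, hK⟩ := (hT i).exists_starBall hρ
  have hsub := T.dom_subset hΩ i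
  have hco := hL.contCoeffs i
  have hv := huh.1.1 i
  have n₁ := fun k => h1NormSq_nonneg (T.cell k).dom (u - uh)
  have n₂ := fun k => h1SemiSq_nonneg (T.cell k).dom (u - Pi1 (T.cell k) uh)
  have n₃ := h1SemiSq_nonneg (T.cell i).dom (u - uh)
  have n₄ := approxSq_nonneg (T.cell i) (co.flux Ω u)
  have n₅ := oscSq_nonneg (T.cell i) fun x => f x - co.γ x * u x
  refine ⟨?_, ?_, ?_, ?_⟩
  · refine (zetaSq_le ha₀ ha₁ hCs hK (he.mono hsub) (hS i) (hu.1.1.mono hsub) hv).trans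
      (mul_le_mul_of_nonneg_right (by linarith) (add_nonneg n₃ (n₂ i)))
  · refine (etaSq_le hρ hK (hh i) hΩ.1 hΩ.2.2.1 hsub hco (hb.mono hsub) hf hu hv.1.1).trans
      (mul_le_mul_of_nonneg_right (by linarith) ?_)
    exact add_nonneg (add_nonneg (add_nonneg (n₁ i) (n₂ i)) n₄) n₅
  · refine (lambdaSq_le hρ hK (hh i) hsub hco (hb.mono hsub) hu.1.1 hv.1.1).trans
      (mul_le_mul_of_nonneg_right (by linarith) ?_)
    exact add_nonneg (add_nonneg (n₁ i) (n₂ i)) n₄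
  · refine (xiSq_le hρ hΩ hT hu.1 huh.1 i).trans
      (mul_le_mul_of_nonneg_right (by linarith) ?_)
    exact Finset.sum_nonneg fun j _ => Finset.sum_nonneg fun k _ => add_nonneg (n₁ k) (n₂ k)
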